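/- **Setting.** Let $\nu\ge 3$, $E=L^2(\mathbb R^\nu;\mathbb C)$ with inner product antilinear in the first argument, and $\sigma(f,g)=\operatorname{Im}\langle f,g\rangle$. For a complex subspace $E_0\subseteq E$ let $\mathcal W(E_0,0)$ be the commutative Weyl $C^*$-algebra: the sup-norm closure of the span of the functions $W^0(f)[g]=e^{i\operatorname{Re}\langle f,g\rangle}$, $f\in E_0$, of $g\in E$. A state $\omega$ on $\mathcal W(E_0,0)$ is a positive normalised linear functional; it is $C^2$ (resp. analytic) if its GNS representation is regular and the cyclic vector lies in the domain of (resp. is an analytic vector for) every field operator $\Phi_\omega(f)$, $f\in E_0$, the generator of $t\mapsto\pi_\omega(W^0(tf))$. For a $C^2$ state put $\omega(\Phi_0(h)W^0(k))=-i\frac{d}{dt}\omega(W^0(k+th))|_{t=0}$. For an operator $A$ let $D=\{f\in E_0\cap D(A):Af\in E_0\}$, and let $\delta_A(W^0(f))=i\Phi_0(iAf)W^0(f)$, $f\in D$, where $\Phi_0(f)[g]=\operatorname{Re}\langle f,g\rangle$. A $(\delta_A,\beta)$-weak KMS state on $\mathcal W(E_0,0)$ is a $C^2$ state with $\omega(\{a,b\})=\beta\,\omega(b\,\delta_A(a))$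 for all $a,b$ in the span of $\{W^0(f):f\in D\}$, where $\{W^0(f),W^0(g)\}=\sigma(g,f)W^0(f+g)$; it is part of the notion that $D$ is dense in $E_0$ and that the weak derivation $\delta_A$ is pointwise closed. Let $\Lambda_L=[-L,L]^\nu$, $E_L=L^2(\Lambda_L)\subset E$, let $H_L$ be the Dirichlet realisation of $-\Delta/2$ on $E_L$ with ground-state energy $E_0(L)=\nu\pi^2/(8L^2)$, and let $H$ be the self-adjoint realisation of $-\Delta/2$ on $E$. Put $\hat f(p)=\int e^{-ip\cdot x}f(x)\,dx$ and $\langle f,H^{-1}f\rangle=\int\frac{d^\nu p}{(2\pi)^\nu}\frac{2}{p^2}|\hat f(p)|^2$. For $\mu<E_0(L)$ the finite-volume classical Gibbs state $\omega_0^{L,\mu}$ is the state on $\mathcal W(E_L,0)$ with $$\omega_0^{L,\mu}(W^0(f))=\exp\Big(-\tfrac1{2\beta}\langle f,(H_L-\mu)^{-1}f\rangle\Big),\qquad f\in E_L .$$ **Theorem.** Let $\beta>0$, $\alpha\ge 0$, and let $(\mu_L)_{L>0}$ satisfy $$\mu_L<E_0(L)\ \ (L>0),\qquad \lim_{L\to\infty}\mu_L=0,\qquad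 \lim_{L\to\infty}\frac{1}{|\Lambda_L|\,\beta\,(E_0(L)-\mu_L)}=\alpha .$$ 1. For every $L>0$ the Gibbs state $\omega_0^{L,\mu_L}$ exists and is unique, and it is the unique $(\delta_{H_L-\mu_L},\beta)$-weak KMS state on $\mathcal W(E_L,0)$ for which $E_L\ni f\mapsto\omega(W^0(f))$ is norm continuous. 2. There is an analytic state $\overline{\omega}$ on $\mathcal W(\bigcup_L E_L,0)=\overline{\bigcup_L\mathcal W(E_L,0)}$ with $\lim_{L'\to\infty}\omega_0^{L',\mu_{L'}}(c)=\overline{\omega}(c)$ for all $c\in\mathcal W(E_L,0)$, $L>0$. It satisfies $$\overline{\omega}(W^0(f))=\exp\Big(-\tfrac12\Big(\tfrac1\beta\langle f,H^{-1}f\rangle+2^\nu\alpha\,\Big|\int_{\mathbb R^\nu}f(x)\,dx\Big|^2\Big)\Big),\qquad f\in\bigcup_L E_L,$$ where $\langle f,H^{-1}f\rangle<\infty$, and it is a $(\delta_H,\beta)$-weak KMS state, whatever the value of $\alpha$. 3. $\overline{\omega}$ extends by continuity to $\mathcal W(\mathcal S(\mathbb R^\nu),0)$ in a unique way: there is exactly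 one state $\omega$ on $\mathcal W(\mathcal S(\mathbb R^\nu),0)$ such that $\overline{\omega}(W^0(f_n))\to\omega(W^0(f))$ whenever $f\in\mathcal S(\mathbb R^\nu)$, $f_n\in\bigcup_LE_L$ and $\|f_n-f\|_\omega\to0$, where $\|f\|_\omega^2=|\hat f(0)|^2+\int\frac{d^\nu p}{(2\pi)^\nu}\frac{|\hat f(p)|^2}{p^2}$. This $\omega$ is given on $W^0(f)$, $f\in\mathcal S(\mathbb R^\nu)$, by the same formula (again with $\langle f,H^{-1}f\rangle<\infty$), and it is a $(\delta_H,\beta)$-weak KMS state on $\mathcal W(\mathcal S(\mathbb R^\nu),0)$, whatever the value of $\alpha$. -/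

import Mathlib

open MeasureTheory Filter Topology
open scoped SchwartzMap LineDeriv Laplacian FourierTransform ComplexInnerProductSpace
  BoundedContinuousFunction ENNReal ComplexOrder

noncomputable section

namespace ClassicalBose

/-! ### One-particle space and Weyl algebras -/

/-- Euclidean space `ℝ^ν`. -/
abbrev Space (ν : ℕ) := EuclideanSpace ℝ (Fin ν)

/-- The one-particle space `E = L²(ℝ^ν; ℂ)`; the inner product is antilinear in its first
argument. -/
abbrev OneParticle (ν : ℕ) := Lp ℂ 2 (volume : Measure (Space ν))

variable {ν : ℕ}

/-- The symplectic form `σ(f, g) = Im ⟨f, g⟩`. -/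
def sympl (f g : OneParticle ν) : ℝ := (⟪f, g⟫).im

/-- The field function `Φ₀(f)[g] = Re ⟨f, g⟩`. -/
def field (f g : OneParticle ν) : ℝ := (⟪f, g⟫).re

/-- The classical Weyl element `W⁰(f)[g] = exp (i Re ⟨f, g⟩)`, a bounded continuous function of
`g ∈ E`. -/
def weyl (f : OneParticle ν) : OneParticle ν →ᵇ ℂ :=
  BoundedContinuousFunction.ofNormedAddCommGroup
    (fun g => Complex.exp (Complex.I * (field f g : ℂ)))
    (by unfold field; fun_prop) 1
    (fun g => by rw [mul_comm, Complex.norm_exp_ofReal_mul_I])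

/-- The commutative Weyl C*-algebra `𝒲(E₀, 0)` of a subspace `E₀ ⊆ E`, realised as the algebra
of almost periodic functions: the sup-norm closure of the `*`-algebra generated by the Weyl
elements `W⁰(f)`, `f ∈ E₀`. -/
def weylAlgebra (E₀ : Submodule ℂ (OneParticle ν)) : StarSubalgebra ℂ (OneParticle ν →ᵇ ℂ) :=
  (StarAlgebra.adjoin ℂ (weyl '' (E₀ : Set (OneParticle ν)))).topologicalClosure

theorem weylAlgebra_mono {E₀ E₁ : Submodule ℂ (OneParticle ν)} (h : E₀ ≤ E₁) :
    weylAlgebra E₀ ≤ weylAlgebra E₁ :=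
  StarSubalgebra.topologicalClosure_mono
    (StarAlgebra.adjoin_mono (Set.image_mono (SetLike.coe_subset_coe.mpr h)))

/-- The inclusion `𝒲(E₀, 0) ⊆ 𝒲(E₁, 0)` for `E₀ ⊆ E₁`. -/
def weylIncl {E₀ E₁ : Submodule ℂ (OneParticle ν)} (h : E₀ ≤ E₁)
    (c : weylAlgebra E₀) : weylAlgebra E₁ :=
  ⟨c, weylAlgebra_mono h c.2⟩

/-- The Weyl element `W⁰(f)`, `f ∈ E₀`, as an element of `𝒲(E₀, 0)`. -/
def weylIn (E₀ : Submodule ℂ (OneParticle ν)) (f : E₀) : weylAlgebra E₀ :=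
  ⟨weyl (f : OneParticle ν), StarSubalgebra.le_topologicalClosure _
    (StarAlgebra.subset_adjoin ℂ _ ⟨f, f.2, rfl⟩)⟩

/-! ### States and their regularity -/

/-- Linear functionals on `𝒲(E₀, 0)` (positive functionals are automatically bounded). -/
abbrev Functional (E₀ : Submodule ℂ (OneParticle ν)) := weylAlgebra E₀ →L[ℂ] ℂ

variable {E₀ : Submodule ℂ (OneParticle ν)}

/-- States: positive normalised functionals. -/
structure IsState (ω : Functional E₀) : Prop where
  pos : ∀ a : weylAlgebra E₀, 0 ≤ ω (star a * a)
  unit : ω 1 = 1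

/-- A GNS triple `(H, π, Ω)` of `ω`: a cyclic `*`-representation on a Hilbert space with
`ω(a) = ⟨Ω, π(a) Ω⟩`. It is unique up to unitary equivalence. -/
structure GNSTriple (ω : Functional E₀) where
  H : Type
  [normed : NormedAddCommGroup H]
  [inner : InnerProductSpace ℂ H]
  [complete : CompleteSpace H]
  π : weylAlgebra E₀ →⋆ₐ[ℂ] (H →L[ℂ] H)
  Ω : H
  vector_state : ∀ a, ω a = ⟪Ω, π a Ω⟫
  cyclic : DenseRange fun a => π a Ω

attribute [instance] GNSTriple.normed GNSTriple.inner GNSTriple.complete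

namespace GNSTriple

variable {ω : Functional E₀} (R : GNSTriple ω)

/-- Regularity: every one-parameter group `t ↦ π(W⁰(t f))` is strongly continuous. -/
def Regular : Prop :=
  ∀ (f : E₀) (ψ : R.H), Continuous fun t : ℝ => R.π (weylIn E₀ ((t : ℂ) • f)) ψ

/-- `ψ` is in the domain of the field operator `Φ_ω(f)`, the self-adjoint generator of
`t ↦ π(W⁰(t f)) = exp (i t Φ_ω(f))`, and `Φ_ω(f) ψ = χ`. -/
def FieldApplies (f : E₀) (ψ χ : R.H) : Prop :=
  HasDerivAt (fun t : ℝ => R.π (weylIn E₀ ((t : ℂ) • f)) ψ) (Complex.I • χ) 0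

/-- `Ω` is an analytic vector for `Φ_ω(f)`: all `χ n = Φ_ω(f)ⁿ Ω` exist and
`∑ rⁿ ‖Φ_ω(f)ⁿ Ω‖ / n! < ∞` for some `r > 0`. -/
def AnalyticVector (f : E₀) : Prop :=
  ∃ χ : ℕ → R.H, χ 0 = R.Ω ∧ (∀ n, R.FieldApplies f (χ n) (χ (n + 1))) ∧
    ∃ r : ℝ, 0 < r ∧ Summable fun n => r ^ n * ‖χ n‖ / (n.factorial : ℝ)

end GNSTriple

/-- `C²` states: the GNS representation is regular and `Ω ∈ D(Φ_ω(f))` for all `f ∈ E₀`. -/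
def IsC2 (ω : Functional E₀) : Prop :=
  ∃ R : GNSTriple ω, R.Regular ∧ ∀ f : E₀, ∃ χ : R.H, R.FieldApplies f R.Ω χ

/-- Analytic states: the GNS representation is regular and `Ω` is an analytic vector for all
field operators `Φ_ω(f)`, `f ∈ E₀`. -/
def IsAnalytic (ω : Functional E₀) : Prop :=
  ∃ R : GNSTriple ω, R.Regular ∧ ∀ f : E₀, R.AnalyticVector f

/-- The expectation value
`ω(Φ₀(h) W⁰(k)) = -i d/dt ω(W⁰(k + t h))|_{t = 0}` (meaningful for `C²` states). -/
def fieldExpectation (ω : Functional E₀) (h k : E₀) : ℂ :=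
  -Complex.I * deriv (fun t : ℝ => ω (weylIn E₀ (k + (t : ℂ) • h))) 0

/-! ### Weak derivations and the weak KMS condition -/

/-- For an operator `A` on `E`: the vectors `f ∈ E₀ ∩ D(A)` with `A f ∈ E₀`. -/
def genDomain (E₀ : Submodule ℂ (OneParticle ν)) (A : OneParticle ν →ₗ.[ℂ] OneParticle ν) :
    Set (OneParticle ν) :=
  {f | f ∈ E₀ ∧ ∃ h : f ∈ A.domain, A ⟨f, h⟩ ∈ E₀}

variable (A : OneParticle ν →ₗ.[ℂ] OneParticle ν)

/-- An element of the domain as an element of `E₀`. -/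
def genIncl (f : genDomain E₀ A) : E₀ := ⟨f, f.2.1⟩

/-- The operator `f ↦ i A f` from the domain to `E₀`. -/
def genOp (f : genDomain E₀ A) : E₀ :=
  ⟨Complex.I • A ⟨f, f.2.2.choose⟩, E₀.smul_mem _ f.2.2.choose_spec⟩

/-- The function `δ₀(W⁰(f)) = i Φ₀(i A f) W⁰(f)`. The weak derivation `δ₀` is its linear extension
to the span of `W⁰(f)`, `f ∈ genDomain E₀ A`. -/
def weakDerivation (f : genDomain E₀ A) (g : OneParticle ν) : ℂ :=
  Complex.I * (field (genOp A f : OneParticle ν) g : ℂ) * weyl (f : OneParticle ν) g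

/-- Continuity of a function on the norm dual of `E₀` in the weak topology `σ(E₀', E₀)`; here
`g ∈ E` stands for the functional `f ↦ Re ⟨f, g⟩` on `E₀`, and every norm-continuous real-linear
functional on `E₀` is of this form. -/
def WeakContinuous (E₀ : Submodule ℂ (OneParticle ν)) (Ψ : OneParticle ν → ℂ) : Prop :=
  Continuous[TopologicalSpace.induced (fun (g : OneParticle ν) (f : E₀) => field f g)
    inferInstance, inferInstance] Ψ

/-- Pointwise closedness of the weak derivation `δ₀(W⁰(f)) = i Φ₀(i A f) W⁰(f)`. -/
def PointwiseClosed (E₀ : Submodule ℂ (OneParticle ν))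
    (A : OneParticle ν →ₗ.[ℂ] OneParticle ν) : Prop :=
  ∀ (u : ℕ → genDomain E₀ A) (f : E₀) (Ψ : OneParticle ν → ℂ),
    (∀ g, Tendsto (fun n => field (u n : OneParticle ν) g) atTop
      (𝓝 (field (f : OneParticle ν) g))) →
    WeakContinuous E₀ Ψ →
    (∀ g, Tendsto (fun n => weakDerivation A (u n) g) atTop (𝓝 (Ψ g))) →
    ∃ h : (f : OneParticle ν) ∈ genDomain E₀ A, Ψ = weakDerivation A ⟨f, h⟩

/-- `ω({a, b})` for `a = ∑ a_f W⁰(f)`, `b = ∑ b_g W⁰(g)` in the domain of `δ₀`, where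
`{W⁰(f), W⁰(g)} = σ(g, f) W⁰(f + g)`. -/
def bracketExpectation (ω : Functional E₀) (a b : genDomain E₀ A →₀ ℂ) : ℂ :=
  a.sum fun f c => b.sum fun g d =>
    c * d * (sympl (g : OneParticle ν) (f : OneParticle ν) : ℂ) *
      ω (weylIn E₀ (genIncl A f + genIncl A g))

/-- `ω(b δ₀(a))` for `a = ∑ a_f W⁰(f)`, `b = ∑ b_g W⁰(g)` in the domain of `δ₀`, where
`W⁰(g) δ₀(W⁰(f)) = i Φ₀(i A f) W⁰(f + g)`. -/
def derivationExpectation (ω : Functional E₀) (a b : genDomain E₀ A →₀ ℂ) : ℂ :=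
  a.sum fun f c => b.sum fun g d =>
    c * d * (Complex.I * fieldExpectation ω (genOp A f) (genIncl A f + genIncl A g))

/-- `ω` is a `(δ₀, β)`-weak KMS state on `𝒲(E₀, 0)`, for the (densely defined, pointwise closed)
weak derivation `δ₀(W⁰(f)) = i Φ₀(i A f) W⁰(f)`. -/
structure IsWeakKMS (E₀ : Submodule ℂ (OneParticle ν))
    (A : OneParticle ν →ₗ.[ℂ] OneParticle ν) (β : ℝ) (ω : Functional E₀) : Prop where
  dense : Dense {f : E₀ | (f : OneParticle ν) ∈ genDomain E₀ A}
  closed : PointwiseClosed E₀ A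
  state : IsState ω
  c2 : IsC2 ω
  kms : ∀ a b : genDomain E₀ A →₀ ℂ,
    bracketExpectation A ω a b = β * derivationExpectation A ω a b

/-! ### Local spaces -/

/-- The box `Λ_L = [-L, L]^ν`. -/
def box (ν : ℕ) (L : ℝ) : Set (Space ν) := {x | ∀ i, x i ∈ Set.Icc (-L) L}

/-- The interior `(-L, L)^ν` of the box. -/
def openBox (ν : ℕ) (L : ℝ) : Set (Space ν) := {x | ∀ i, x i ∈ Set.Ioo (-L) L}

/-- `E_L = L²(Λ_L)`, embedded in `E` by extension by zero. -/
def localSpace (ν : ℕ) (L : ℝ) : Submodule ℂ (OneParticle ν) where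
  carrier := {f | ∀ᵐ x, x ∉ box ν L → f x = 0}
  add_mem' {f g} hf hg := by
    filter_upwards [hf, hg, Lp.coeFn_add f g] with x h1 h2 h3 hx
    rw [h3, Pi.add_apply, h1 hx, h2 hx, add_zero]
  zero_mem' := by
    filter_upwards [Lp.coeFn_zero ℂ 2 (volume : Measure (Space ν))] with x h _
    rw [h, Pi.zero_apply]
  smul_mem' c f hf := by
    filter_upwards [hf, Lp.coeFn_smul c f] with x h1 h2 hx
    rw [h2, Pi.smul_apply, h1 hx, smul_zero]

theorem box_mono {L L' : ℝ} (h : L ≤ L') : box ν L ⊆ box ν L' :=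
  fun _ hx i => ⟨(neg_le_neg h).trans (hx i).1, (hx i).2.trans h⟩

theorem localSpace_mono {L L' : ℝ} (h : L ≤ L') : localSpace ν L ≤ localSpace ν L' :=
  fun f hf => by
    have hf' : ∀ᵐ x, x ∉ box ν L → f x = 0 := hf
    exact hf'.mono fun _ hx hx' => hx fun hxL => hx' (box_mono h hxL)

/-- `⋃_L E_L`: the square-integrable functions of bounded support. -/
def localUnion (ν : ℕ) : Submodule ℂ (OneParticle ν) where
  carrier := {f | ∃ L : ℝ, 0 < L ∧ f ∈ localSpace ν L}
  add_mem' := by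
    rintro f g ⟨L, hL, hf⟩ ⟨L', _, hg⟩
    exact ⟨max L L', lt_max_of_lt_left hL, (localSpace ν _).add_mem
      (localSpace_mono (le_max_left _ _) hf) (localSpace_mono (le_max_right _ _) hg)⟩
  zero_mem' := ⟨1, one_pos, (localSpace ν 1).zero_mem⟩
  smul_mem' := by
    rintro c f ⟨L, hL, hf⟩
    exact ⟨L, hL, (localSpace ν L).smul_mem c hf⟩

theorem localSpace_le_localUnion {L : ℝ} (hL : 0 < L) : localSpace ν L ≤ localUnion ν :=
  fun _ hf => ⟨L, hL, hf⟩

/-- A Schwartz function as an element of `E`. -/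
def ofSchwartz (φ : 𝓢(Space ν, ℂ)) : OneParticle ν := φ.toLp 2 volume

/-- The Schwartz space `𝒮(ℝ^ν)` as a subspace of `E`. -/
def schwartzSpace (ν : ℕ) : Submodule ℂ (OneParticle ν) :=
  LinearMap.range (SchwartzMap.toLpCLM ℂ ℂ 2 (volume : Measure (Space ν))).toLinearMap

/-! ### The Hamiltonians -/

/-- `φ ∈ C_c^∞(U)`. -/
def IsTest (U : Set (Space ν)) (φ : 𝓢(Space ν, ℂ)) : Prop :=
  HasCompactSupport φ ∧ tsupport φ ⊆ U

/-- `-Δφ/2` for a Schwartz function. -/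
def kinetic (φ : 𝓢(Space ν, ℂ)) : 𝓢(Space ν, ℂ) := (-(1 / 2 : ℂ)) • Δ φ

/-- `u = -Δf/2` in the sense of distributions on `U`. -/
def IsDistribKinetic (U : Set (Space ν)) (f u : OneParticle ν) : Prop :=
  ∀ φ : 𝓢(Space ν, ℂ), IsTest U φ → ⟪ofSchwartz φ, u⟫ = ⟪ofSchwartz (kinetic φ), f⟫

/-- The Sobolev space `H¹₀((-L, L)^ν)`, extended by zero: `L²`-limits of sequences of test functions
in the open box whose gradients are Cauchy in `L²`. -/
def IsH10 (L : ℝ) (f : OneParticle ν) : Prop :=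
  ∃ φ : ℕ → 𝓢(Space ν, ℂ), (∀ n, IsTest (openBox ν L) (φ n)) ∧
    Tendsto (fun n => ofSchwartz (φ n)) atTop (𝓝 f) ∧
    ∀ i : Fin ν, CauchySeq fun n => ofSchwartz (∂_{EuclideanSpace.single i (1 : ℝ)} (φ n))

theorem ofSchwartz_add (φ ψ : 𝓢(Space ν, ℂ)) :
    ofSchwartz (φ + ψ) = ofSchwartz φ + ofSchwartz ψ :=
  map_add (SchwartzMap.toLpCLM ℂ ℂ 2 (volume : Measure (Space ν))) φ ψ

theorem ofSchwartz_smul (c : ℂ) (φ : 𝓢(Space ν, ℂ)) :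
    ofSchwartz (c • φ) = c • ofSchwartz φ :=
  map_smul (SchwartzMap.toLpCLM ℂ ℂ 2 (volume : Measure (Space ν))) c φ

theorem ofSchwartz_zero : ofSchwartz (0 : 𝓢(Space ν, ℂ)) = 0 :=
  map_zero (SchwartzMap.toLpCLM ℂ ℂ 2 (volume : Measure (Space ν)))

theorem isTest_zero {U : Set (Space ν)} : IsTest U (0 : 𝓢(Space ν, ℂ)) := by
  refine ⟨HasCompactSupport.zero, ?_⟩
  have h : ((0 : 𝓢(Space ν, ℂ)) : Space ν → ℂ) = 0 := rfl
  rw [h, tsupport_eq_empty_iff.mpr rfl]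
  exact Set.empty_subset _

theorem IsTest.add {U : Set (Space ν)} {φ ψ : 𝓢(Space ν, ℂ)} (h : IsTest U φ) (k : IsTest U ψ) :
    IsTest U (φ + ψ) :=
  ⟨HasCompactSupport.add h.1 k.1, (tsupport_add (φ : Space ν → ℂ) ψ).trans
    (Set.union_subset h.2 k.2)⟩

theorem IsTest.smul {U : Set (Space ν)} (c : ℂ) {φ : 𝓢(Space ν, ℂ)} (h : IsTest U φ) :
    IsTest U (c • φ) :=
  ⟨HasCompactSupport.smul_left (f := fun _ => c) h.1,
    (tsupport_smul_subset_right (fun _ : Space ν => c) φ).trans h.2⟩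

theorem IsH10.add {L : ℝ} {f g : OneParticle ν} (hf : IsH10 L f) (hg : IsH10 L g) :
    IsH10 L (f + g) := by
  obtain ⟨φ, h1, h2, h3⟩ := hf
  obtain ⟨ψ, k1, k2, k3⟩ := hg
  refine ⟨fun n => φ n + ψ n, fun n => (h1 n).add (k1 n), ?_, fun i => ?_⟩
  · simpa only [ofSchwartz_add] using h2.add k2
  · simp only [LineDeriv.lineDerivOp_add, ofSchwartz_add]
    exact (h3 i).add (k3 i)

theorem IsH10.smul {L : ℝ} (c : ℂ) {f : OneParticle ν} (hf : IsH10 L f) : IsH10 L (c • f) := by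
  obtain ⟨φ, h1, h2, h3⟩ := hf
  refine ⟨fun n => c • φ n, fun n => (h1 n).smul c, ?_, fun i => ?_⟩
  · simpa only [ofSchwartz_smul] using h2.const_smul c
  · simp only [LineDeriv.lineDerivOp_smul, ofSchwartz_smul]
    exact (uniformContinuous_const_smul c).comp_cauchySeq (h3 i)

theorem isH10_zero {L : ℝ} : IsH10 L (0 : OneParticle ν) :=
  ⟨fun _ => 0, fun _ => isTest_zero, by
    simp only [ofSchwartz_zero]; exact tendsto_const_nhds, fun _ => cauchySeq_const _⟩

theorem IsDistribKinetic.add {U : Set (Space ν)} {f g u v : OneParticle ν}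
    (h : IsDistribKinetic U f u) (k : IsDistribKinetic U g v) :
    IsDistribKinetic U (f + g) (u + v) :=
  fun φ hφ => by rw [inner_add_right, inner_add_right, h φ hφ, k φ hφ]

theorem IsDistribKinetic.smul {U : Set (Space ν)} (c : ℂ) {f u : OneParticle ν}
    (h : IsDistribKinetic U f u) : IsDistribKinetic U (c • f) (c • u) :=
  fun φ hφ => by rw [inner_smul_right, inner_smul_right, h φ hφ]

/-- The graph of `H_L`: the pairs `(f, u)` with `f ∈ H¹₀(Λ_L)`, `u ∈ L²(Λ_L)` and `u = -Δf/2` on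
the open box. -/
def dirichletGraph (ν : ℕ) (L : ℝ) : Submodule ℂ (OneParticle ν × OneParticle ν) where
  carrier := {p | IsH10 L p.1 ∧ p.2 ∈ localSpace ν L ∧ IsDistribKinetic (openBox ν L) p.1 p.2}
  add_mem' h k := ⟨h.1.add k.1, (localSpace ν L).add_mem h.2.1 k.2.1, h.2.2.add k.2.2⟩
  zero_mem' := ⟨isH10_zero, (localSpace ν L).zero_mem, fun φ _ => by simp⟩
  smul_mem' c _ h := ⟨h.1.smul c, (localSpace ν L).smul_mem c h.2.1, h.2.2.smul c⟩

/-- A function in `L²` of an open set is determined by its pairings with test functions. -/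
theorem eq_zero_of_test {U : Set (Space ν)} (hU : IsOpen U) {u : OneParticle ν}
    (hu : ∀ᵐ x, x ∉ U → u x = 0)
    (h : ∀ φ : 𝓢(Space ν, ℂ), IsTest U φ → ⟪ofSchwartz φ, u⟫ = 0) : u = 0 := by
  have hloc : LocallyIntegrable (u : Space ν → ℂ) volume :=
    (Lp.memLp u).locallyIntegrable (by norm_num)
  have key : ∀ᵐ x, x ∈ U → u x = 0 := by
    refine hU.ae_eq_zero_of_integral_contDiff_smul_eq_zero (hloc.locallyIntegrableOn U) ?_
    intro g hg hgc hgU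
    have hc : HasCompactSupport fun x => (g x : ℂ) :=
      hgc.comp_left (g := fun y : ℝ => (y : ℂ)) (by simp)
    have hs : ContDiff ℝ (⊤ : ℕ∞) fun x => (g x : ℂ) := Complex.ofRealCLM.contDiff.comp hg
    have ht : tsupport (fun x => (g x : ℂ)) ⊆ U :=
      (closure_mono fun x hx => by
        simpa [Function.mem_support] using hx).trans hgU
    have := h (hc.toSchwartzMap hs) ⟨hc, ht⟩
    rw [L2.inner_def] at this
    rw [← this]
    refine integral_congr_ae ?_
    filter_upwards [SchwartzMap.coeFn_toLp (hc.toSchwartzMap hs) 2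
      (volume : Measure (Space ν))] with x hx
    have hx' : (ofSchwartz (hc.toSchwartzMap hs) : Space ν → ℂ) x = (g x : ℂ) := hx
    simp [hx', RCLike.inner_apply, mul_comm]
  refine (Lp.eq_zero_iff_ae_eq_zero).mpr ?_
  filter_upwards [hu, key] with x h1 h2
  by_cases hx : x ∈ U
  · exact h2 hx
  · exact h1 hx

theorem isOpen_openBox (ν : ℕ) (L : ℝ) : IsOpen (openBox ν L) := by
  have : openBox ν L = ⋂ i, (fun x : Space ν => x i) ⁻¹' Set.Ioo (-L) L := by
    ext x; simp [openBox]
  rw [this]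
  exact isOpen_iInter_of_finite fun i => isOpen_Ioo.preimage (by fun_prop)

theorem box_diff_openBox_null (ν : ℕ) (L : ℝ) : volume (box ν L \ openBox ν L) = 0 := by
  have hsub : box ν L \ openBox ν L ⊆
      ⋃ i : Fin ν, (fun x : Space ν => x i) ⁻¹' ({-L, L} : Set ℝ) := by
    rintro x ⟨hx, hx'⟩
    simp only [openBox, Set.mem_ofPred_eq, not_forall] at hx'
    obtain ⟨i, hi⟩ := hx'
    refine Set.mem_iUnion.mpr ⟨i, ?_⟩
    have h1 := (hx i).1
    have h2 := (hx i).2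
    by_contra hne
    simp only [Set.mem_preimage, Set.mem_insert_iff, Set.mem_singleton_iff, not_or] at hne
    exact hi ⟨lt_of_le_of_ne h1 (Ne.symm hne.1), lt_of_le_of_ne h2 hne.2⟩
  refine measure_mono_null hsub (measure_iUnion_null fun i => ?_)
  have hq : Measure.QuasiMeasurePreserving (fun x : Space ν => x i) volume volume :=
    (Measure.quasiMeasurePreserving_eval (fun _ : Fin ν => (volume : Measure ℝ)) i).comp
      (PiLp.volume_preserving_ofLp (Fin ν)).quasiMeasurePreserving
  exact hq.preimage_null (Set.Finite.measure_zero (Set.toFinite _) _)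

/-- The graphs of the Hamiltonians are single-valued, so they are the graphs of the operators
defined below. -/
theorem dirichletGraph_single (L : ℝ) (p : OneParticle ν × OneParticle ν)
    (hp : p ∈ dirichletGraph ν L) (h0 : p.1 = 0) : p.2 = 0 := by
  refine eq_zero_of_test (isOpen_openBox ν L) ?_ fun φ hφ => ?_
  · have hn : ∀ᵐ x : Space ν, x ∉ box ν L \ openBox ν L :=
      measure_eq_zero_iff_ae_notMem.mp (box_diff_openBox_null ν L)
    have h2 : ∀ᵐ x, x ∉ box ν L → p.2 x = 0 := hp.2.1
    filter_upwards [h2, hn] with x h2 h3 hx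
    exact h2 fun hb => h3 ⟨hb, hx⟩
  · rw [hp.2.2 φ hφ, h0, inner_zero_right]

/-- The Hamiltonian `H_L`: the self-adjoint extension of `-Δ/2` on `C_c^∞` of the box `Λ_L` with
Dirichlet boundary conditions. -/
def dirichletHamiltonian (ν : ℕ) (L : ℝ) : OneParticle ν →ₗ.[ℂ] OneParticle ν :=
  (dirichletGraph ν L).toLinearPMap

/-- The graph of `H`: the pairs `(f, u)` of square-integrable functions with `u = -Δf/2`. -/
def freeGraph (ν : ℕ) : Submodule ℂ (OneParticle ν × OneParticle ν) where
  carrier := {p | IsDistribKinetic Set.univ p.1 p.2}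
  add_mem' h k := IsDistribKinetic.add h k
  zero_mem' := fun φ _ => by simp
  smul_mem' c _ h := IsDistribKinetic.smul c h

theorem freeGraph_single (p : OneParticle ν × OneParticle ν)
    (hp : p ∈ freeGraph ν) (h0 : p.1 = 0) : p.2 = 0 :=
  eq_zero_of_test isOpen_univ (by simp) fun φ hφ => by
    rw [hp φ hφ, h0, inner_zero_right]

/-- The free Hamiltonian `H`: the unique self-adjoint extension (the adjoint) of `-Δ/2` on
`C_c^∞(ℝ^ν)`. -/
def freeHamiltonian (ν : ℕ) : OneParticle ν →ₗ.[ℂ] OneParticle ν :=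
  (freeGraph ν).toLinearPMap

/-- The operator `A - μ`. -/
def shift (A : OneParticle ν →ₗ.[ℂ] OneParticle ν) (μ : ℝ) :
    OneParticle ν →ₗ.[ℂ] OneParticle ν where
  domain := A.domain
  toFun := A.toFun - (μ : ℂ) • A.domain.subtype

/-- The eigenvalues `E_n(L) = (1/2) ∑ π² n_i² / (2L)²` of `H_L`, `n_i ≥ 1`. -/
def dirichletEnergy (L : ℝ) (n : Fin ν → ℕ) : ℝ :=
  1 / 2 * ∑ i, Real.pi ^ 2 * (n i : ℝ) ^ 2 / (2 * L) ^ 2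

/-- The ground-state energy `E₀(L) = E_{(1, …, 1)}(L)` of `H_L`. -/
def groundEnergy (ν : ℕ) (L : ℝ) : ℝ := dirichletEnergy L fun _ : Fin ν => 1

/-! ### Gibbs states and the limiting quadratic form -/

/-- The finite-volume Gibbs state with chemical potential `μ`: the state on `𝒲(E_L, 0)` with
`ω(W⁰(f)) = exp (-(1/(2β)) ⟨f, (H_L - μ)⁻¹ f⟩)`, where `f = (H_L - μ) u`. -/
structure IsGibbs (L μ β : ℝ) (ω : Functional (localSpace ν L)) : Prop where
  state : IsState ω
  apply_weyl : ∀ (f : localSpace ν L) (u : (shift (dirichletHamiltonian ν L) μ).domain),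
    shift (dirichletHamiltonian ν L) μ u = f →
    ω (weylIn _ f) = Complex.exp (-(1 / (2 * β)) * ⟪(f : OneParticle ν), (u : OneParticle ν)⟫)

/-- The integrand of `⟨f, H⁻¹ f⟩ = ∫ (2 / p²) |f̂(p)|² dp / (2π)^ν` after the substitution
`p = 2π ξ`; `𝓕 f` is the unitary Fourier transform with kernel `exp (-2π i ξ·x)`. -/
def inverseDensity (f : OneParticle ν) (ξ : Space ν) : ℝ :=
  2 / (2 * Real.pi * ‖ξ‖) ^ 2 * ‖(𝓕 f : OneParticle ν) ξ‖ ^ 2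

/-- The quadratic form `⟨f, H⁻¹ f⟩`. -/
def inverseForm (f : OneParticle ν) : ℝ := ∫ ξ, inverseDensity f ξ

/-- `‖f‖²_ω = |f̂(0)|² + ∫ |f̂(p)|² / p² dp / (2π)^ν`. -/
def condensateNormSq (f : OneParticle ν) : ℝ := ‖∫ x, f x‖ ^ 2 + 1 / 2 * inverseForm f

/-- The characteristic functional of the limit,
`exp (-(1/2) ((1/β) ⟨f, H⁻¹ f⟩ + 2^ν α |∫ f|²))`. -/
def limitCharacteristic (α β : ℝ) (f : OneParticle ν) : ℝ :=
  Real.exp (-(1 / 2) * (1 / β * inverseForm f + 2 ^ ν * α * ‖∫ x, f x‖ ^ 2))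

/-- `ω'` on `𝒲(𝒮(ℝ^ν), 0)` extends `ω` on `𝒲(⋃_L E_L, 0)` by continuity:
`ω'(W⁰(f)) = lim ω(W⁰(u n))` whenever `‖u n - f‖_ω → 0`. -/
def ExtendsByContinuity (ω : Functional (localUnion ν)) (ω' : Functional (schwartzSpace ν)) :
    Prop :=
  ∀ (f : schwartzSpace ν) (u : ℕ → localUnion ν),
    Tendsto (fun n => condensateNormSq ((u n : OneParticle ν) - (f : OneParticle ν))) atTop
      (𝓝 0) →
    Tendsto (fun n => ω (weylIn _ (u n))) atTop (𝓝 (ω' (weylIn _ f)))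

end ClassicalBose

end

open ClassicalBose

open MeasureTheory Filter Topology
open scoped SchwartzMap LineDeriv Laplacian FourierTransform ComplexInnerProductSpace
  BoundedContinuousFunction ENNReal ComplexOrder

noncomputable section

namespace ClassicalBose

variable {ν : ℕ} {E₀ : Submodule ℂ (OneParticle ν)}

/-! ### Weyl elements -/

/-! The span of the Weyl elements is dense, so a state is determined by its values on them, and
every formula in the statement is Gaussian: `exp (-‖T f‖² / 2)` for a real-linear map `T` into a
Hilbert space. Such a state exists for every `T`, continuous or not (`exists_gaussian_state`):
finitely many directions are served by an honest Gaussian measure on a finite-dimensional subspace,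
and weak-* compactness gives the rest. Gaussian states are analytic, because the Weyl orbit of the
cyclic vector has the Gram matrix of the exponentials `exp (i t x)` in `L²` of a Gaussian measure on
the line (`GNSTriple.analyticVector_of_gaussian`). For them the weak KMS condition follows from the
single identity `β ⟨T k, T (i A f)⟩ = -σ(k, f)` (`isWeakKMS_of_gaussian`), which holds when `‖T ·‖²`
is the form of `(β A)⁻¹`.

In finite volume the sine modes form an explicit Hilbert basis that diagonalises `H_L`
(`dirichletBasis`, `mem_dirichletGraph_iff`), and `T` divides the coefficients by `√(β (E_n - μ))`.
Conversely, the KMS condition tested on `a = W(f)`, `b = W(k - f)` is a linear differential equation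
for `s ↦ ω(W(s k))` when `k = i A f`, and its solution is Gaussian. Invertibility of `H_L - μ`,
density of the domain and norm continuity then fix the state.

For the limit the ground mode is split off. It contributes `2^ν / (|Λ_L| β (E₀ - μ))` times `|∫ ψ
f|²`, where the unnormalised ground mode `ψ` increases to the constant one; this yields the
condensate term. The excited modes are bounded uniformly by a multiple of `⟨f, H⁻¹ f⟩`
(`excitedForm_le`). For `f = H g` with `g` a test function their contribution is computed
explicitly, and such `f` are dense for the form of `H⁻¹` (`dense_testKinetic`), so
`tendsto_excitedForm` follows. The dimension enters through local integrability of `1 / p²`, which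
makes the form finite on `L¹ ∩ L²`. Contractivity carries the convergence from Weyl elements to the
whole algebra.

The limit is KMS for every `α` because `∫ H f = 0` when `f` and `H f` are integrable: the condensate
term is invisible to the KMS identity. Finally the map `T` of the limit is continuous for `‖·‖_ω`,
and truncations to boxes approximate Schwartz functions in that norm, which gives the extension and
its uniqueness. -/

theorem weyl_apply (f g : OneParticle ν) :
    weyl f g = Complex.exp (Complex.I * (field f g : ℂ)) := rfl

theorem field_add_left (f g h : OneParticle ν) : field (f + g) h = field f h + field g h := by
  simp [field, inner_add_left]

theorem field_neg_left (f h : OneParticle ν) : field (-f) h = -field f h := by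
  simp [field, inner_neg_left]

theorem field_add_right (f g h : OneParticle ν) : field f (g + h) = field f g + field f h := by
  simp [field, inner_add_right]

theorem field_smul_right (f g : OneParticle ν) (r : ℝ) : field f (r • g) = r * field f g := by
  simp [field, inner_smul_right_eq_smul]

theorem weyl_add (f g : OneParticle ν) : weyl (f + g) = weyl f * weyl g := by
  ext h
  rw [BoundedContinuousFunction.mul_apply, weyl_apply, weyl_apply, weyl_apply, ← Complex.exp_add,
    field_add_left]
  push_cast
  ring_nf

theorem weyl_zero : weyl (0 : OneParticle ν) = 1 := by
  ext h
  simp [weyl_apply, field]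

theorem star_weyl (f : OneParticle ν) : star (weyl f) = weyl (-f) := by
  ext h
  rw [BoundedContinuousFunction.star_apply, weyl_apply, weyl_apply, Complex.star_def,
    ← Complex.exp_conj, field_neg_left]
  simp

theorem norm_weyl_apply (f g : OneParticle ν) : ‖weyl f g‖ = 1 := by
  rw [weyl_apply, mul_comm, Complex.norm_exp_ofReal_mul_I]


theorem weylIn_add (f g : E₀) : weylIn E₀ (f + g) = weylIn E₀ f * weylIn E₀ g :=
  Subtype.ext (weyl_add _ _)

theorem weylIn_zero : weylIn E₀ 0 = 1 := Subtype.ext weyl_zero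

theorem star_weylIn (f : E₀) : star (weylIn E₀ f) = weylIn E₀ (-f) := Subtype.ext (star_weyl _)

/-- Products and adjoints of Weyl elements are again Weyl elements, so nothing beyond linear
combinations is generated. -/
theorem adjoin_weyl_le_span :
    ((StarAlgebra.adjoin ℂ (weyl '' (E₀ : Set (OneParticle ν))) :
      StarSubalgebra ℂ (OneParticle ν →ᵇ ℂ)) : Set (OneParticle ν →ᵇ ℂ)) ⊆
      Submodule.span ℂ (weyl '' (E₀ : Set (OneParticle ν))) := by
  intro x hx
  refine StarAlgebra.adjoin_induction (p := fun x _ => x ∈ Submodule.span ℂ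
    (weyl '' (E₀ : Set (OneParticle ν)))) ?_ ?_ ?_ ?_ ?_ hx
  · exact fun x hx => Submodule.subset_span hx
  · intro r
    rw [Algebra.algebraMap_eq_smul_one, ← weyl_zero]
    exact Submodule.smul_mem _ _ (Submodule.subset_span ⟨0, E₀.zero_mem, rfl⟩)
  · exact fun x y _ _ hx hy => Submodule.add_mem _ hx hy
  · intro x y _ _ hx hy
    have := Submodule.mul_mem_mul hx hy
    rw [Submodule.span_mul_span] at this
    refine Submodule.span_mono ?_ this
    rintro _ ⟨_, ⟨f, hf, rfl⟩, _, ⟨g, hg, rfl⟩, rfl⟩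
    exact ⟨f + g, E₀.add_mem hf hg, weyl_add _ _⟩
  · intro x _ hx
    refine Submodule.span_induction (p := fun x _ => star x ∈ Submodule.span ℂ
      (weyl '' (E₀ : Set (OneParticle ν)))) ?_ ?_ ?_ ?_ hx
    · rintro _ ⟨f, hf, rfl⟩
      rw [star_weyl]
      exact Submodule.subset_span ⟨-f, E₀.neg_mem hf, rfl⟩
    · simp
    · intro x y _ _ hx hy
      rw [star_add]
      exact Submodule.add_mem _ hx hy
    · intro c x _ hx
      rw [star_smul]
      exact Submodule.smul_mem _ _ hx

theorem dense_span_weylIn (E₀ : Submodule ℂ (OneParticle ν)) :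
    Dense (Submodule.span ℂ (Set.range (weylIn E₀)) : Set (weylAlgebra E₀)) := by
  intro a
  rw [closure_subtype]
  have ha : (a : OneParticle ν →ᵇ ℂ) ∈ closure (Submodule.span ℂ
      (weyl '' (E₀ : Set (OneParticle ν))) : Set (OneParticle ν →ᵇ ℂ)) :=
    closure_mono adjoin_weyl_le_span a.2
  refine closure_mono ?_ ha
  intro x hx
  have h2 : weyl '' (E₀ : Set (OneParticle ν)) =
      (weylAlgebra E₀).toSubalgebra.toSubmodule.subtype '' Set.range (weylIn E₀) := by
    ext y
    constructor
    · rintro ⟨f, hf, rfl⟩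
      exact ⟨_, ⟨⟨f, hf⟩, rfl⟩, rfl⟩
    · rintro ⟨_, ⟨f, rfl⟩, rfl⟩
      exact ⟨f, f.2, rfl⟩
  rw [h2, SetLike.mem_coe, Submodule.span_image] at hx
  obtain ⟨y, hy, rfl⟩ := hx
  exact ⟨y, hy, rfl⟩

/-- Closed linear properties of `𝒲(E₀, 0)` hold as soon as they hold for Weyl elements. -/
theorem weylAlgebra_induction {p : weylAlgebra E₀ → Prop} (hc : IsClosed {a | p a})
    (hw : ∀ f, p (weylIn E₀ f)) (h0 : p 0) (hadd : ∀ a b, p a → p b → p (a + b))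
    (hsmul : ∀ (c : ℂ) a, p a → p (c • a)) (a : weylAlgebra E₀) : p a := by
  have : (Submodule.span ℂ (Set.range (weylIn E₀)) : Set (weylAlgebra E₀)) ⊆ {a | p a} := by
    intro x hx
    refine Submodule.span_induction (p := fun x _ => p x) ?_ h0 ?_ ?_ hx
    · rintro _ ⟨f, rfl⟩
      exact hw f
    · exact fun x y _ _ => hadd x y
    · exact fun c x _ => hsmul c x
  exact (hc.closure_subset_iff.mpr this) (dense_span_weylIn E₀ a)

/-- Source of all the uniqueness statements: only characteristic functions have to be compared. -/
theorem functional_ext {ω ω' : Functional E₀} (h : ∀ f, ω (weylIn E₀ f) = ω' (weylIn E₀ f)) :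
    ω = ω' := by
  ext a
  refine weylAlgebra_induction (p := fun a => ω a = ω' a)
    (isClosed_eq ω.continuous ω'.continuous) h (by simp) ?_ ?_ a
  · intro a b ha hb
    simp only [map_add, ha, hb]
  · intro c a ha
    simp only [map_smul, ha]

/-! ### Existence of Gaussian states -/

/-- `S` is the adjoint of `T ∘ i⁻¹` on the range of `i`. Injectivity of `i` lets functionals on `V`
be prescribed freely by vectors of `E`. -/
theorem exists_dual_map {E V W : Type*} [NormedAddCommGroup E] [InnerProductSpace ℝ E]
    [AddCommGroup V] [Module ℝ V] [FiniteDimensional ℝ V] [NormedAddCommGroup W]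
    [InnerProductSpace ℝ W] [FiniteDimensional ℝ W] (i : V →ₗ[ℝ] E)
    (hi : Function.Injective i) (T : V →ₗ[ℝ] W) :
    ∃ S : W →ₗ[ℝ] E, ∀ f x, inner ℝ (i f) (S x) = inner ℝ x (T f) := by
  let j := LinearEquiv.ofInjective i hi
  have hfin : FiniteDimensional ℝ (LinearMap.range i) := inferInstance
  let TR : LinearMap.range i →ₗ[ℝ] W := T ∘ₗ j.symm.toLinearMap
  refine ⟨(LinearMap.range i).subtype ∘ₗ TR.adjoint, fun f x => ?_⟩
  have h2 := LinearMap.adjoint_inner_right TR (j f) x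
  have h3 : TR (j f) = T f := by simp [TR]
  rw [h3] at h2
  rw [real_inner_comm (T f) x, ← h2]
  rfl

theorem field_eq_inner (f g : OneParticle ν) : field f g = inner ℝ f g := by
  rw [field, L2.inner_def, L2.inner_def]
  exact (integral_re (L2.integrable_inner (𝕜 := ℂ) f g)).symm

/-- Over finitely many field directions the field functionals are represented by a linear map
from a Euclidean space to the one-particle space. -/
theorem exists_gaussian_average {K : Type*} [NormedAddCommGroup K] [InnerProductSpace ℝ K]
    (T : E₀ →ₗ[ℝ] K) (s : Finset E₀) :
    ∃ (W : Submodule ℝ K) (_ : FiniteDimensional ℝ W) (S : W →L[ℝ] OneParticle ν),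
      ∀ f ∈ s, ∃ hf : T f ∈ W, ∀ x : W, field f (S x) = inner ℝ x ⟨T f, hf⟩ := by
  let V : Submodule ℝ E₀ := Submodule.span ℝ (s : Set E₀)
  have hV : FiniteDimensional ℝ V := FiniteDimensional.span_finset ℝ s
  let W : Submodule ℝ K := V.map T
  have hW : FiniteDimensional ℝ W := inferInstance
  let i : V →ₗ[ℝ] OneParticle ν := (E₀.subtype.restrictScalars ℝ) ∘ₗ V.subtype
  have hi : Function.Injective i := Subtype.coe_injective.comp Subtype.coe_injective
  let TV : V →ₗ[ℝ] W := T.restrict fun x hx => Submodule.mem_map_of_mem hx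
  obtain ⟨S, hS⟩ := exists_dual_map i hi TV
  refine ⟨W, hW, LinearMap.toContinuousLinearMap S, fun f hf => ?_⟩
  have hfV : f ∈ V := Submodule.subset_span hf
  exact ⟨Submodule.mem_map_of_mem hfV, fun x => (field_eq_inner _ _).trans (hS ⟨f, hfV⟩ x)⟩

-- The functional is the average over the image under `S` of the standard Gaussian measure on the
-- finite-dimensional space spanned by `T f`, `f ∈ s`. Its characteristic function gives the
-- prescribed values, and averages are positive and contractive.
open ProbabilityTheory in
theorem exists_gaussian_positive_functional {K : Type*} [NormedAddCommGroup K]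
    [InnerProductSpace ℝ K] (T : E₀ →ₗ[ℝ] K) (s : Finset E₀) :
    ∃ φ : (OneParticle ν →ᵇ ℂ) → ℂ, (∀ a b, φ (a + b) = φ a + φ b) ∧
      (∀ (c : ℂ) a, φ (c • a) = c * φ a) ∧ (∀ a, ‖φ a‖ ≤ ‖a‖) ∧ (∀ a, 0 ≤ φ (star a * a)) ∧
      ∀ f ∈ s, φ (weyl f) = Complex.exp (-(1 / 2) * (‖T f‖ : ℂ) ^ 2) := by
  obtain ⟨W, _, S, hS⟩ := exists_gaussian_average T s
  let _ : MeasurableSpace W := borel W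
  have : BorelSpace W := ⟨rfl⟩
  let P := stdGaussian W
  have hint : ∀ a : OneParticle ν →ᵇ ℂ, Integrable (fun x => a (S x)) P := fun a =>
    Integrable.of_bound ((a.continuous.comp S.continuous).aestronglyMeasurable) ‖a‖
      (Eventually.of_forall fun x => a.norm_coe_le_norm _)
  refine ⟨fun a => ∫ x, a (S x) ∂P, fun a b => integral_add (hint a) (hint b),
    fun c a => integral_const_mul c _, fun a => ?_, fun a => ?_, fun f hf => ?_⟩
  · refine (norm_integral_le_of_norm_le_const (Eventually.of_forall fun x =>
      a.norm_coe_le_norm _)).trans ?_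
    simp
  · have : ∀ x, (star a * a) (S x) = ((‖a (S x)‖ ^ 2 : ℝ) : ℂ) := fun x => by
      simp [BoundedContinuousFunction.mul_apply, RCLike.star_def, Complex.conj_mul']
    simp only [this]
    rw [integral_complex_ofReal]
    exact_mod_cast integral_nonneg fun x => by positivity
  · obtain ⟨hfW, hx⟩ := hS f hf
    have := charFun_stdGaussian (⟨T f, hfW⟩ : W)
    rw [charFun_apply] at this
    have h2 : (‖(⟨T f, hfW⟩ : W)‖ : ℝ) = ‖T f‖ := rfl
    rw [h2] at this
    convert this using 1
    · refine integral_congr_ae (Eventually.of_forall fun x => ?_)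
      simp only [weyl_apply, hx]
      rw [mul_comm]
    · congr 1
      ring

/-- A Gaussian measure on the whole one-particle space need not exist, so the state is obtained as
an ultrafilter limit of the averages over finite sets of directions. On a fixed Weyl element the net
is eventually constant. -/
theorem exists_gaussian_state {K : Type*} [NormedAddCommGroup K] [InnerProductSpace ℝ K]
    (T : E₀ →ₗ[ℝ] K) :
    ∃ ω : Functional E₀, IsState ω ∧ (∀ a, ‖ω a‖ ≤ ‖a‖) ∧
      ∀ f, ω (weylIn E₀ f) = Complex.exp (-(1 / 2) * (‖T f‖ : ℂ) ^ 2) := by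
  classical
  choose φ hadd hsmul hnorm hpos hval using fun s : Finset E₀ =>
    exists_gaussian_positive_functional T s
  let U : Ultrafilter (Finset E₀) := Ultrafilter.of atTop
  have hU : (U : Filter (Finset E₀)) ≤ atTop := Ultrafilter.of_le atTop
  have hlim : ∀ a : OneParticle ν →ᵇ ℂ, ∃ z : ℂ, Tendsto (fun s => φ s a) U (𝓝 z) := by
    intro a
    -- Contractivity keeps the net in a compact disc, which is the weak-* compactness argument one
    -- element at a time.
    obtain ⟨z, -, hz⟩ := (isCompact_closedBall (0 : ℂ) ‖a‖).ultrafilter_le_nhds (U.map fun s => φ s a)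
      (by
        rw [Ultrafilter.coe_map, le_principal_iff]
        exact mem_map.mpr (univ_mem' fun s => by simpa using hnorm s a))
    exact ⟨z, hz⟩
  choose l hl using hlim
  let Λ : (OneParticle ν →ᵇ ℂ) →ₗ[ℂ] ℂ :=
    { toFun := l
      map_add' := fun a b => tendsto_nhds_unique (hl (a + b))
        (((hl a).add (hl b)).congr fun s => (hadd s a b).symm)
      map_smul' := fun c a => tendsto_nhds_unique (hl (c • a))
        (((hl a).const_mul c).congr fun s => (hsmul s c a).symm) }
  have hΛ : ∀ a, ‖Λ a‖ ≤ 1 * ‖a‖ := fun a => by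
    rw [one_mul]
    exact le_of_tendsto (hl a).norm (Eventually.of_forall fun s => hnorm s a)
  have hw : ∀ f : E₀, l (weyl f) = Complex.exp (-(1 / 2) * (‖T f‖ : ℂ) ^ 2) := by
    intro f
    refine tendsto_nhds_unique (hl _) (tendsto_const_nhds.congr' ?_)
    filter_upwards [hU (mem_atTop {f})] with s hs
    exact (hval s f (hs (by simp))).symm
  refine ⟨(Λ.mkContinuous 1 hΛ).comp ((weylAlgebra E₀).toSubalgebra.toSubmodule.subtypeL),
    ⟨fun a => ?_, ?_⟩, fun a => (hΛ a).trans_eq (one_mul _), fun f => hw f⟩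
  · exact ge_of_tendsto (hl (star (a : OneParticle ν →ᵇ ℂ) * a))
      (Eventually.of_forall fun s => hpos s a)
  · have := hw 0
    rw [map_zero] at this
    have h1 : weyl ((0 : E₀) : OneParticle ν) = 1 := weyl_zero
    rw [h1] at this
    refine Eq.trans this ?_
    simp

/-! ### The GNS representation -/

theorem exists_cyclic_representation {A : Type} [CStarAlgebra A] [PartialOrder A]
    [StarOrderedRing A] (ω : A →ₗ[ℂ] ℂ)
    (hω : ∀ a, 0 ≤ ω (star a * a)) :
    ∃ (H : Type) (_ : NormedAddCommGroup H) (_ : InnerProductSpace ℂ H) (_ : CompleteSpace H)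
      (π : A →⋆ₐ[ℂ] (H →L[ℂ] H)) (Ω : H), (∀ a, ω a = ⟪Ω, π a Ω⟫) ∧
        DenseRange fun a => π a Ω := by
  let φ : A →ₚ[ℂ] ℂ := PositiveLinearMap.mk₀ ω
    fun x hx => by
      obtain ⟨y, hy⟩ := CStarAlgebra.nonneg_iff_eq_star_mul_self.mp hx
      rw [hy]
      exact hω y
  have hΩ : ∀ a : A, φ.gnsStarAlgHom a ((φ.toPreGNS 1 : φ.PreGNS) : φ.GNS) =
      ((φ.toPreGNS a : φ.PreGNS) : φ.GNS) := fun a => by simp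
  have hd : DenseRange fun a : A => φ.gnsStarAlgHom a ((φ.toPreGNS 1 : φ.PreGNS) : φ.GNS) := by
    simp only [hΩ]
    exact (UniformSpace.Completion.denseRange_coe (α := φ.PreGNS)).comp
      φ.toPreGNS.surjective.denseRange (UniformSpace.Completion.continuous_coe _)
  have hv : ∀ a, ω a = ⟪((φ.toPreGNS 1 : φ.PreGNS) : φ.GNS),
      φ.gnsStarAlgHom a ((φ.toPreGNS 1 : φ.PreGNS) : φ.GNS)⟫ := fun a => by
    rw [hΩ, UniformSpace.Completion.inner_coe, PositiveLinearMap.preGNS_inner_def]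
    simp
    rfl
  exact ⟨φ.GNS, inferInstance, inferInstance, inferInstance, φ.gnsStarAlgHom,
    ((φ.toPreGNS 1 : φ.PreGNS) : φ.GNS), hv, hd⟩

theorem nonempty_gnsTriple {ω : Functional E₀} (hω : IsState ω) : Nonempty (GNSTriple ω) := by
  have hcl : IsClosed (weylAlgebra E₀ : Set (OneParticle ν →ᵇ ℂ)) :=
    StarSubalgebra.isClosed_topologicalClosure _
  let _ : CStarAlgebra (weylAlgebra E₀) := StarSubalgebra.cstarAlgebra _
  -- The closed star subalgebra is a C*-algebra; the spectral order is supplied because the GNS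
  -- construction is phrased for positive maps between ordered algebras.
  obtain ⟨H, i1, i2, i3, π, Ω, h1, h2⟩ :=
    @exists_cyclic_representation (weylAlgebra E₀) (StarSubalgebra.cstarAlgebra _)
      (CStarAlgebra.spectralOrder _) (CStarAlgebra.spectralOrderedRing _)
      (ω : weylAlgebra E₀ →ₗ[ℂ] ℂ) hω.pos
  exact ⟨⟨H, π, Ω, h1, h2⟩⟩

namespace GNSTriple

variable {ω : Functional E₀} (R : GNSTriple ω)

/-- The represented Weyl operator `π(W⁰(f))`. -/
def weylOp (f : E₀) : R.H →L[ℂ] R.H := R.π (weylIn E₀ f)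

theorem weylOp_weylOp (f g : E₀) (ψ : R.H) :
    R.weylOp f (R.weylOp g ψ) = R.weylOp (f + g) ψ := by
  have h : R.π (weylIn E₀ f * weylIn E₀ g) = R.π (weylIn E₀ f) * R.π (weylIn E₀ g) :=
    map_mul R.π _ _
  unfold weylOp
  rw [weylIn_add, h]
  rfl

theorem weylOp_zero (ψ : R.H) : R.weylOp 0 ψ = ψ := by
  have h : R.π 1 = 1 := map_one R.π
  unfold weylOp
  rw [weylIn_zero, h]
  rfl

theorem inner_weylOp_left (f : E₀) (ψ χ : R.H) :
    ⟪R.weylOp f ψ, χ⟫ = ⟪ψ, R.weylOp (-f) χ⟫ := by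
  have h : R.π (star (weylIn E₀ f)) = star (R.π (weylIn E₀ f)) := map_star R.π _
  unfold weylOp
  rw [← star_weylIn, h, ContinuousLinearMap.star_eq_adjoint,
    ContinuousLinearMap.adjoint_inner_right]

/-- Commutativity of the algebra transports continuity at `Ω` to all vectors `π(a) Ω`. -/
theorem weylOp_comm (f : E₀) (a : weylAlgebra E₀) (ψ : R.H) :
    R.weylOp f (R.π a ψ) = R.π a (R.weylOp f ψ) := by
  have h1 : R.π (weylIn E₀ f * a) = R.π (weylIn E₀ f) * R.π a := map_mul R.π _ _
  have h2 : R.π (a * weylIn E₀ f) = R.π a * R.π (weylIn E₀ f) := map_mul R.π _ _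
  have h3 : weylIn E₀ f * a = a * weylIn E₀ f := Subtype.ext (mul_comm _ _)
  have h4 : R.π (weylIn E₀ f) * R.π a = R.π a * R.π (weylIn E₀ f) :=
    h1.symm.trans ((congrArg R.π h3).trans h2)
  exact DFunLike.congr_fun h4 ψ

theorem inner_vector_weylOp (f : E₀) : ⟪R.Ω, R.weylOp f R.Ω⟫ = ω (weylIn E₀ f) :=
  (R.vector_state _).symm

theorem norm_vector (h1 : ω 1 = 1) : ‖R.Ω‖ = 1 := by
  have h := R.inner_vector_weylOp 0
  rw [weylOp_zero, weylIn_zero, h1, inner_self_eq_norm_sq_to_K] at h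
  have h2 : ((‖R.Ω‖ ^ 2 : ℝ) : ℂ) = (1 : ℝ) := by push_cast; exact h
  have h3 : ‖R.Ω‖ ^ 2 = 1 := Complex.ofReal_injective h2
  exact (pow_eq_one_iff_of_nonneg (norm_nonneg _) two_ne_zero).mp h3

theorem norm_weylOp (f : E₀) (ψ : R.H) : ‖R.weylOp f ψ‖ = ‖ψ‖ := by
  have : ⟪R.weylOp f ψ, R.weylOp f ψ⟫ = ⟪ψ, ψ⟫ := by
    rw [inner_weylOp_left, weylOp_weylOp, neg_add_cancel, weylOp_zero]
  rw [inner_self_eq_norm_sq_to_K, inner_self_eq_norm_sq_to_K] at this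
  have h2 : ‖R.weylOp f ψ‖ ^ 2 = ‖ψ‖ ^ 2 := by exact_mod_cast this
  exact (sq_eq_sq₀ (norm_nonneg _) (norm_nonneg _)).mp h2

theorem dist_weylOp (f : E₀) (ψ χ : R.H) :
    dist (R.weylOp f ψ) (R.weylOp f χ) = dist ψ χ := by
  rw [dist_eq_norm, dist_eq_norm, ← (R.weylOp f).map_sub, norm_weylOp]

theorem inner_weylOp_vector (f g : E₀) :
    ⟪R.weylOp f R.Ω, R.weylOp g R.Ω⟫ = ω (weylIn E₀ (g - f)) := by
  rw [inner_weylOp_left, weylOp_weylOp, inner_vector_weylOp, neg_add_eq_sub]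

/-- By unitarity `‖Ω - W(t f) Ω‖² = 2 - 2 Re ω(W(t f))`. -/
theorem tendsto_weylOp_vector (f : E₀)
    (h : Tendsto (fun t : ℝ => ω (weylIn E₀ ((t : ℂ) • f))) (𝓝 0) (𝓝 1)) (h1 : ω 1 = 1) :
    Tendsto (fun t : ℝ => R.weylOp ((t : ℂ) • f) R.Ω) (𝓝 0) (𝓝 R.Ω) := by
  have key : ∀ t : ℝ, ‖R.Ω - R.weylOp ((t : ℂ) • f) R.Ω‖ ^ 2 =
      2 - 2 * (ω (weylIn E₀ ((t : ℂ) • f))).re := by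
    intro t
    rw [@norm_sub_sq ℂ, norm_weylOp, R.norm_vector h1, inner_vector_weylOp]
    change 1 ^ 2 - 2 * (ω (weylIn E₀ ((t : ℂ) • f))).re + 1 ^ 2 = _
    ring
  rw [tendsto_iff_norm_sub_tendsto_zero]
  have h3 : Tendsto (fun t : ℝ => 2 - 2 * (ω (weylIn E₀ ((t : ℂ) • f))).re) (𝓝 0) (𝓝 0) := by
    have := (((Complex.continuous_re.tendsto _).comp h).const_mul 2).const_sub 2
    simpa using this
  have h4 := (Real.continuous_sqrt.tendsto _).comp (h3.congr fun t => (key t).symm)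
  simp only [Function.comp_def, Real.sqrt_sq (norm_nonneg _), Real.sqrt_zero] at h4
  exact h4.congr fun t => norm_sub_rev _ _

/-- Weyl operators are isometric and the vectors `π(a) Ω` are dense, so continuity on these is
enough: an `ε / 3` argument. -/
theorem tendsto_weylOp (f : E₀)
    (h : Tendsto (fun t : ℝ => ω (weylIn E₀ ((t : ℂ) • f))) (𝓝 0) (𝓝 1)) (h1 : ω 1 = 1)
    (ψ : R.H) : Tendsto (fun t : ℝ => R.weylOp ((t : ℂ) • f) ψ) (𝓝 0) (𝓝 ψ) := by
  rw [Metric.tendsto_nhds]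
  intro ε hε
  obtain ⟨φ, ha, h2⟩ : ∃ φ : R.H, dist ψ φ < ε / 3 ∧
      Tendsto (fun t : ℝ => R.weylOp ((t : ℂ) • f) φ) (𝓝 0) (𝓝 φ) := by
    obtain ⟨a, ha⟩ := R.cyclic.exists_dist_lt ψ (show 0 < ε / 3 by positivity)
    exact ⟨_, ha, (((R.π a).continuous.tendsto _).comp (R.tendsto_weylOp_vector f h h1)).congr
      fun t => (R.weylOp_comm _ a R.Ω).symm⟩
  rw [Metric.tendsto_nhds] at h2
  filter_upwards [h2 (ε / 3) (by positivity)] with t ht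
  have h3 := R.dist_weylOp ((t : ℂ) • f) ψ φ
  have h4 := dist_triangle4 (R.weylOp ((t : ℂ) • f) ψ) (R.weylOp ((t : ℂ) • f) φ) φ ψ
  rw [dist_comm φ ψ] at h4
  linarith

theorem regular_of_tendsto (h1 : ω 1 = 1)
    (h : ∀ f : E₀, Tendsto (fun t : ℝ => ω (weylIn E₀ ((t : ℂ) • f))) (𝓝 0) (𝓝 1)) :
    R.Regular := by
  intro f ψ
  change Continuous fun t : ℝ => R.weylOp ((t : ℂ) • f) ψ
  rw [continuous_iff_continuousAt]
  intro s
  have h2 := (R.tendsto_weylOp f (h f) h1 (R.weylOp ((s : ℂ) • f) ψ)).comp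
    (show Tendsto (fun t : ℝ => t - s) (𝓝 s) (𝓝 0) from
      (continuous_sub_right s).tendsto' _ _ (sub_self s))
  refine h2.congr fun t => ?_
  rw [Function.comp_apply, weylOp_weylOp, ← add_smul]
  push_cast
  rw [sub_add_cancel]

end GNSTriple

/-! ### Moments of Gaussian measures -/

/-- Vectors with the Gram matrix of a family `G` are the image of `G` under a bounded map. -/
theorem exists_clm_of_gram {ι H M : Type*} [NormedAddCommGroup H] [InnerProductSpace ℂ H]
    [CompleteSpace H] [NormedAddCommGroup M] [InnerProductSpace ℂ M] [CompleteSpace M]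
    (F : ι → H) (G : ι → M) (h : ∀ s t, ⟪F s, F t⟫ = ⟪G s, G t⟫) :
    ∃ V : M →L[ℂ] H, ∀ t, V (G t) = F t := by
  let f : (ι →₀ ℂ) →ₗ[ℂ] H := Finsupp.linearCombination ℂ F
  let e : (ι →₀ ℂ) →ₗ[ℂ] M := Finsupp.linearCombination ℂ G
  have hn : ∀ x, ‖f x‖ = ‖e x‖ := by
    intro x
    have : ⟪f x, f x⟫ = ⟪e x, e x⟫ := by
      simp only [f, e, Finsupp.linearCombination_apply, Finsupp.sum, sum_inner, inner_sum,
        inner_smul_left, inner_smul_right, h]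
    rw [inner_self_eq_norm_sq_to_K, inner_self_eq_norm_sq_to_K] at this
    have h2 : ‖f x‖ ^ 2 = ‖e x‖ ^ 2 := by exact_mod_cast this
    exact (sq_eq_sq₀ (norm_nonneg _) (norm_nonneg _)).mp h2
  let K : Submodule ℂ M := (LinearMap.range e).topologicalClosure
  have hK : IsClosed (K : Set M) := Submodule.isClosed_topologicalClosure _
  have : CompleteSpace K := hK.completeSpace_coe
  let e' : (ι →₀ ℂ) →ₗ[ℂ] K := e.codRestrict K fun x =>
    Submodule.le_topologicalClosure _ (LinearMap.mem_range_self e x)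
  have hd : DenseRange e' := by
    intro y
    rw [closure_subtype]
    have hy := y.2
    refine closure_mono ?_ hy
    rintro _ ⟨x, rfl⟩
    exact ⟨e' x, ⟨x, rfl⟩, rfl⟩
  have hb : ∃ C, ∀ x, ‖f x‖ ≤ C * ‖e' x‖ := ⟨1, fun x => by rw [one_mul, hn]; rfl⟩
  -- Equal Gram matrices make `G t ↦ F t` isometric on the span. The isometry extends to the closed
  -- span and is set to zero on the orthogonal complement.
  refine ⟨(f.extendOfNorm e').comp K.orthogonalProjectionOnto, fun t => ?_⟩
  have h1 : G t = e' (Finsupp.single t 1) := by simp [e', e]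
  rw [ContinuousLinearMap.comp_apply, h1, Submodule.orthogonalProjectionOnto_mem_subspace_eq_self,
    LinearMap.extendOfNorm_eq hd hb]
  simp [f]

/-- A Taylor remainder valid on the whole line: for `|y| > 1` the trivial bound `2 + |y|` is at most
`3 y²`. -/
theorem norm_exp_I_mul_sub_le (y : ℝ) :
    ‖Complex.exp (Complex.I * y) - 1 - Complex.I * y‖ ≤ 3 * y ^ 2 := by
  have hn : ‖Complex.I * (y : ℂ)‖ = |y| := by simp
  rcases le_or_gt |y| 1 with hy | hy
  · have := Complex.norm_exp_sub_one_sub_id_le (x := Complex.I * y) (by rw [hn]; exact hy)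
    rw [hn, sq_abs] at this
    nlinarith [sq_nonneg y]
  · have h1 : ‖Complex.exp (Complex.I * y)‖ = 1 := by
      rw [mul_comm, Complex.norm_exp_ofReal_mul_I]
    calc _ ≤ ‖Complex.exp (Complex.I * y)‖ + ‖(1 : ℂ)‖ + ‖Complex.I * (y : ℂ)‖ :=
          (norm_sub_le _ _).trans (by gcongr; exact norm_sub_le _ _)
      _ ≤ 3 * y ^ 2 := by
          rw [h1, hn, norm_one, ← sq_abs y]
          nlinarith

section Moments

open ProbabilityTheory

variable (γ : Measure ℝ)

/-- The function `x ↦ exp (i t x) xⁿ`. -/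
def charMoment (n : ℕ) (t : ℝ) (x : ℝ) : ℂ := Complex.exp (Complex.I * (t * x : ℝ)) * (x : ℂ) ^ n

theorem continuous_charMoment (n : ℕ) (t : ℝ) : Continuous (charMoment n t) := by
  unfold charMoment
  fun_prop

theorem norm_charMoment (n : ℕ) (t x : ℝ) : ‖charMoment n t x‖ = |x| ^ n := by
  rw [charMoment, norm_mul, mul_comm Complex.I, Complex.norm_exp_ofReal_mul_I, one_mul, norm_pow,
    Complex.norm_real, Real.norm_eq_abs]

theorem norm_charMoment_le (n : ℕ) (t x : ℝ) :
    ‖charMoment n t x‖ ≤ n.factorial * Real.exp |x| := by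
  rw [norm_charMoment]
  have := Real.pow_div_factorial_le_exp |x| (abs_nonneg x) n
  rwa [div_le_iff₀' (by positivity)] at this

theorem memLp_exp_abs (v : NNReal) :
    MemLp (fun x : ℝ => Real.exp |x|) 2 (gaussianReal 0 v) := by
  rw [memLp_two_iff_integrable_sq (by fun_prop)]
  have h := integrable_exp_mul_abs (μ := gaussianReal 0 v) (X := id) (t := 2)
    (integrable_exp_mul_gaussianReal 2) (integrable_exp_mul_gaussianReal (-2))
  refine h.congr (Eventually.of_forall fun x => ?_)
  simp only [id, ← Real.exp_nat_mul]
  norm_num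

theorem memLp_charMoment (v : NNReal) (n : ℕ) (t : ℝ) :
    MemLp (charMoment n t) 2 (gaussianReal 0 v) := by
  refine ((memLp_exp_abs v).const_mul (n.factorial : ℝ)).mono
    (continuous_charMoment n t).aestronglyMeasurable (Eventually.of_forall fun x => ?_)
  refine (norm_charMoment_le n t x).trans (le_of_eq ?_)
  rw [Real.norm_of_nonneg (by positivity)]

/-- The function `x ↦ exp (i t x) xⁿ` in `L²` of a centred Gaussian measure. -/
def charMomentLp (v : NNReal) (n : ℕ) (t : ℝ) : Lp ℂ 2 (gaussianReal 0 v) :=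
  (memLp_charMoment v n t).toLp

/-- From `|x|ⁿ ≤ n! exp |x|` and square integrability of `exp |x|`. The growth `n!`, uniform in `t`,
is what makes the power series of the cyclic vector converge. -/
theorem exists_norm_charMomentLp_le (v : NNReal) :
    ∃ C, ∀ n t, ‖charMomentLp v n t‖ ≤ n.factorial * C := by
  refine ⟨‖(memLp_exp_abs v).toLp‖, fun n t => ?_⟩
  have h : ‖((n.factorial : ℝ) • (memLp_exp_abs v).toLp)‖ =
      n.factorial * ‖(memLp_exp_abs v).toLp‖ := by
    rw [norm_smul, Real.norm_of_nonneg (by positivity)]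
  rw [← h]
  refine Lp.norm_le_norm_of_ae_le ?_
  filter_upwards [(memLp_charMoment v n t).coeFn_toLp, (memLp_exp_abs v).coeFn_toLp,
    Lp.coeFn_smul (n.factorial : ℝ) (memLp_exp_abs v).toLp] with x h1 h2 h3
  rw [charMomentLp, h1, h3, Pi.smul_apply, h2]
  refine (norm_charMoment_le n t x).trans (le_of_eq ?_)
  rw [smul_eq_mul, Real.norm_of_nonneg (by positivity)]

/-- The Taylor remainder is at most `3 s² |x|^(n+2)` pointwise, hence `O(s²)` in `L²` because all
moments are finite. -/
theorem hasDerivAt_charMomentLp (v : NNReal) (n : ℕ) (t : ℝ) :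
    HasDerivAt (charMomentLp v n) (Complex.I • charMomentLp v (n + 1) t) t := by
  have hb : ∀ s : ℝ, ‖charMomentLp v n (t + s) - charMomentLp v n t -
      s • Complex.I • charMomentLp v (n + 1) t‖ ≤ 3 * ‖charMomentLp v (n + 2) 0‖ * ‖s ^ 2‖ := by
    intro s
    have h : ‖((3 * s ^ 2 : ℝ) • charMomentLp v (n + 2) 0)‖ =
        3 * ‖charMomentLp v (n + 2) 0‖ * ‖s ^ 2‖ := by
      rw [norm_smul, norm_mul, Real.norm_of_nonneg (by positivity : (0 : ℝ) ≤ 3)]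
      ring
    rw [← h]
    refine Lp.norm_le_norm_of_ae_le ?_
    filter_upwards [(memLp_charMoment v n (t + s)).coeFn_toLp, (memLp_charMoment v n t).coeFn_toLp,
      (memLp_charMoment v (n + 1) t).coeFn_toLp, (memLp_charMoment v (n + 2) 0).coeFn_toLp,
      Lp.coeFn_smul (3 * s ^ 2 : ℝ) (charMomentLp v (n + 2) 0),
      Lp.coeFn_sub (charMomentLp v n (t + s)) (charMomentLp v n t),
      Lp.coeFn_sub (charMomentLp v n (t + s) - charMomentLp v n t)
        (s • Complex.I • charMomentLp v (n + 1) t),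
      Lp.coeFn_smul s (Complex.I • charMomentLp v (n + 1) t),
      Lp.coeFn_smul Complex.I (charMomentLp v (n + 1) t)] with x h1 h2 h3 h4 h5 h6 h7 h8 h9
    have e1 : charMomentLp v n (t + s) x = charMoment n (t + s) x := h1
    have e2 : charMomentLp v n t x = charMoment n t x := h2
    have e3 : charMomentLp v (n + 1) t x = charMoment (n + 1) t x := h3
    have e4 : charMomentLp v (n + 2) 0 x = charMoment (n + 2) 0 x := h4
    rw [h7, Pi.sub_apply, h6, Pi.sub_apply, h8, Pi.smul_apply, h9, Pi.smul_apply, h5, Pi.smul_apply,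
      e1, e2, e3, e4, norm_smul, norm_charMoment, Real.norm_of_nonneg (by positivity)]
    have e5 : charMoment n (t + s) x - charMoment n t x - s • Complex.I • charMoment (n + 1) t x =
        charMoment n t x * (Complex.exp (Complex.I * (s * x : ℝ)) - 1 - Complex.I * (s * x : ℝ)) := by
      simp only [charMoment, add_mul, Complex.ofReal_add, mul_add, Complex.exp_add,
        Complex.real_smul, smul_eq_mul]
      push_cast
      ring
    rw [e5, norm_mul, norm_charMoment]
    calc |x| ^ n * _ ≤ |x| ^ n * (3 * (s * x) ^ 2) := by
          gcongr
          exact norm_exp_I_mul_sub_le _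
      _ = 3 * s ^ 2 * |x| ^ (n + 2) := by
          rw [pow_add, sq_abs]
          ring
  rw [hasDerivAt_iff_isLittleO_nhds_zero]
  refine (Asymptotics.IsBigO.of_bound _ (Eventually.of_forall hb)).trans_isLittleO ?_
  simpa using Asymptotics.isLittleO_pow_id (𝕜 := ℝ) (n := 2) (by norm_num)

theorem inner_charMomentLp_zero (v : NNReal) (s t : ℝ) :
    ⟪charMomentLp v 0 s, charMomentLp v 0 t⟫ = Complex.exp (-(1 / 2) * v * ((t - s : ℝ) : ℂ) ^ 2) := by
  have := charFun_gaussianReal (μ := 0) (v := v) (t - s)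
  rw [charFun_apply_real] at this
  rw [L2.inner_def]
  refine Eq.trans ?_ (this.trans ?_)
  · refine integral_congr_ae ?_
    filter_upwards [(memLp_charMoment v 0 s).coeFn_toLp,
      (memLp_charMoment v 0 t).coeFn_toLp] with x h1 h2
    rw [charMomentLp, charMomentLp, h1, h2, RCLike.inner_apply]
    simp only [charMoment, pow_zero, mul_one]
    rw [← Complex.exp_conj, ← Complex.exp_add]
    congr 1
    simp
    ring
  · congr 1
    push_cast
    ring

end Moments

/-! ### Gaussian states are analytic -/

/-- The vectors `W(t f) Ω` and the functions `exp (i t x)` in `L²` of the centred Gaussian of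
variance `q` have the same Gram matrix. The resulting map `V` carries multiplication by `x` to the
field operator, so that `Φ(f)ⁿ Ω` is the image of `xⁿ`. -/
theorem GNSTriple.analyticVector_of_gaussian {ω : Functional E₀} (R : GNSTriple ω) (f : E₀) (q : ℝ)
    (hq : 0 ≤ q)
    (h : ∀ t : ℝ, ω (weylIn E₀ ((t : ℂ) • f)) = Complex.exp (-(1 / 2) * q * (t : ℂ) ^ 2)) :
    R.AnalyticVector f := by
  obtain ⟨V, hV⟩ := exists_clm_of_gram (fun t : ℝ => R.weylOp ((t : ℂ) • f) R.Ω)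
    (charMomentLp q.toNNReal 0) fun s t => by
      rw [R.inner_weylOp_vector, ← sub_smul, ← Complex.ofReal_sub, h, inner_charMomentLp_zero,
        Real.coe_toNNReal _ hq]
  have hder : ∀ n t, HasDerivAt (fun t => V (charMomentLp q.toNNReal n t))
      (Complex.I • V (charMomentLp q.toNNReal (n + 1) t)) t := by
    intro n t
    rw [← V.map_smul]
    exact (V.restrictScalars ℝ).hasFDerivAt.comp_hasDerivAt t (hasDerivAt_charMomentLp _ n t)
  -- Translation covariance is clear for `n = 0`; differentiating it in `t` raises the power of `x`
  -- by one, since both sides are differentiated through bounded maps.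
  have hint : ∀ n (s t : ℝ), R.weylOp ((s : ℂ) • f)
      (V (charMomentLp q.toNNReal n t)) = V (charMomentLp q.toNNReal n (s + t)) := by
    intro n
    induction n with
    | zero =>
      intro s t
      rw [hV, hV, R.weylOp_weylOp, ← add_smul, Complex.ofReal_add]
    | succ n ih =>
      intro s t
      have h1 := ((R.weylOp ((s : ℂ) • f)).restrictScalars ℝ).hasFDerivAt.comp_hasDerivAt
        t (hder n t)
      have h2 := (hder n (s + t)).comp_const_add s t
      have h3 : (fun x => V (charMomentLp q.toNNReal n (s + x))) =
          ((R.weylOp ((s : ℂ) • f)).restrictScalars ℝ) ∘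
            (fun t => V (charMomentLp q.toNNReal n t)) := by
        funext x
        exact (ih s x).symm
      rw [h3] at h2
      have h4 := h1.unique h2
      rw [ContinuousLinearMap.coe_restrictScalars', (R.weylOp ((s : ℂ) • f)).map_smul] at h4
      exact smul_right_injective _ Complex.I_ne_zero h4
  refine ⟨fun n => V (charMomentLp q.toNNReal n 0), ?_, fun n => ?_, 1 / 2, by norm_num, ?_⟩
  · beta_reduce
    rw [hV, Complex.ofReal_zero, zero_smul, R.weylOp_zero]
  · have := hder n 0
    refine this.congr_of_eventuallyEq (Eventually.of_forall fun t => ?_)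
    exact (hint n t 0).trans (by simp only [add_zero])
  · obtain ⟨C, hC⟩ := exists_norm_charMomentLp_le q.toNNReal
    refine Summable.of_nonneg_of_le (fun n => by positivity) (fun n => ?_)
      -- The moments are at most `n!` times a constant, so any radius below one would do.
      (summable_geometric_two.mul_right (‖V‖ * C))
    rw [mul_div_assoc]
    gcongr
    rw [div_le_iff₀ (by positivity)]
    calc ‖V (charMomentLp q.toNNReal n 0)‖ ≤ ‖V‖ * ‖charMomentLp q.toNNReal n 0‖ :=
          V.le_opNorm _
      _ ≤ ‖V‖ * (n.factorial * C) := by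
          gcongr
          exact hC n 0
      _ = _ := by ring

theorem isAnalytic_of_gaussian {ω : Functional E₀} (hω : IsState ω) (q : E₀ → ℝ)
    (hq : ∀ f, 0 ≤ q f)
    (h : ∀ f (t : ℝ), ω (weylIn E₀ ((t : ℂ) • f)) = Complex.exp (-(1 / 2) * q f * (t : ℂ) ^ 2)) :
    IsAnalytic ω := by
  obtain ⟨R⟩ := nonempty_gnsTriple hω
  refine ⟨R, R.regular_of_tendsto hω.unit fun f => ?_,
    fun f => R.analyticVector_of_gaussian f (q f) (hq f) (h f)⟩
  simp only [h]
  exact Continuous.tendsto' (by fun_prop) _ _ (by simp)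

theorem IsAnalytic.isC2 {ω : Functional E₀} (h : IsAnalytic ω) : IsC2 ω := by
  obtain ⟨R, hR, hA⟩ := h
  refine ⟨R, hR, fun f => ?_⟩
  obtain ⟨χ, h0, h1, -⟩ := hA f
  exact ⟨χ 1, h0 ▸ h1 0⟩

/-- Differentiability of the orbit at `t = 0` is transported to `s` and to the base point `k` by
applying the Weyl operator of `k + s f`. -/
theorem IsC2.differentiableAt {ω : Functional E₀} (h : IsC2 ω) (k f : E₀) (s : ℝ) :
    DifferentiableAt ℝ (fun t : ℝ => ω (weylIn E₀ (k + (t : ℂ) • f))) s := by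
  obtain ⟨R, -, hR⟩ := h
  obtain ⟨χ, hχ⟩ := hR f
  have hχ' : HasDerivAt (fun t : ℝ => R.weylOp ((t : ℂ) • f) R.Ω) (Complex.I • χ) (s - s) := by
    rw [sub_self]
    exact hχ
  have h1 := hχ'.comp_sub_const s s
  have h2 := (((innerSL ℂ R.Ω).comp
    (R.weylOp (k + (s : ℂ) • f))).restrictScalars ℝ).hasFDerivAt.comp_hasDerivAt s h1
  refine (h2.congr_of_eventuallyEq (Eventually.of_forall fun t => ?_)).differentiableAt
  have h3 : k + (s : ℂ) • f + ((t - s : ℝ) : ℂ) • f = k + (t : ℂ) • f := by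
    rw [add_assoc, ← add_smul]
    push_cast
    rw [add_sub_cancel]
  change _ = ⟪R.Ω, R.weylOp (k + (s : ℂ) • f) (R.weylOp (((t - s : ℝ) : ℂ) • f) R.Ω)⟫
  rw [R.weylOp_weylOp, h3, R.inner_vector_weylOp]

/-! ### Weak KMS states -/

theorem sympl_self (f : OneParticle ν) : sympl f f = 0 := by
  rw [sympl]
  exact inner_self_im (𝕜 := ℂ) f

theorem sympl_add_left (f g h : OneParticle ν) : sympl (f + g) h = sympl f h + sympl g h := by
  simp [sympl, inner_add_left]

theorem sympl_sub_left (f g h : OneParticle ν) : sympl (f - g) h = sympl f h - sympl g h := by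
  simp [sympl, inner_sub_left]

theorem hasDerivAt_gaussian {K : Type*} [NormedAddCommGroup K] [InnerProductSpace ℝ K]
    (T : E₀ →ₗ[ℝ] K) (k h : E₀) :
    HasDerivAt (fun t : ℝ => Complex.exp (-(1 / 2) * (‖T (k + (t : ℂ) • h)‖ : ℂ) ^ 2))
      (-(inner ℝ (T k) (T h) : ℝ) * Complex.exp (-(1 / 2) * (‖T k‖ : ℂ) ^ 2)) 0 := by
  have h1 : ∀ t : ℝ, Complex.exp (-(1 / 2) * (‖T (k + (t : ℂ) • h)‖ : ℂ) ^ 2) =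
      Complex.exp ((-(1 / 2) * ‖T k‖ ^ 2 - t * inner ℝ (T k) (T h) -
        t ^ 2 / 2 * ‖T h‖ ^ 2 : ℝ) : ℂ) := by
    intro t
    congr 1
    rw [map_add, Complex.coe_smul, map_smul, ← Complex.ofReal_pow, norm_add_sq_real,
      inner_smul_right, norm_smul, mul_pow, Real.norm_eq_abs, sq_abs]
    push_cast
    ring
  simp only [h1]
  have h2 : HasDerivAt (fun t : ℝ => -(1 / 2) * ‖T k‖ ^ 2 - t * inner ℝ (T k) (T h) -
      t ^ 2 / 2 * ‖T h‖ ^ 2) (-inner ℝ (T k) (T h)) 0 := by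
    have := (((hasDerivAt_id (0 : ℝ)).mul_const (inner ℝ (T k) (T h))).const_sub
      (-(1 / 2) * ‖T k‖ ^ 2)).sub ((((hasDerivAt_id (0 : ℝ)).pow 2).div_const 2).mul_const
        (‖T h‖ ^ 2))
    exact this.congr_deriv (by simp)
  have h3 := h2.ofReal_comp.cexp
  refine h3.congr_deriv ?_
  push_cast
  simp
  ring

theorem fieldExpectation_gaussian {K : Type*} [NormedAddCommGroup K] [InnerProductSpace ℝ K]
    (T : E₀ →ₗ[ℝ] K) {ω : Functional E₀}
    (h : ∀ f, ω (weylIn E₀ f) = Complex.exp (-(1 / 2) * (‖T f‖ : ℂ) ^ 2)) (f k : E₀) :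
    fieldExpectation ω f k = Complex.I * (inner ℝ (T k) (T f) : ℝ) * ω (weylIn E₀ k) := by
  rw [fieldExpectation]
  simp only [h]
  rw [(hasDerivAt_gaussian T k f).deriv]
  ring

theorem isAnalytic_of_gaussian_map {K : Type*} [NormedAddCommGroup K] [InnerProductSpace ℝ K]
    (T : E₀ →ₗ[ℝ] K) {ω : Functional E₀} (hω : IsState ω)
    (h : ∀ f, ω (weylIn E₀ f) = Complex.exp (-(1 / 2) * (‖T f‖ : ℂ) ^ 2)) : IsAnalytic ω := by
  refine isAnalytic_of_gaussian hω (fun f => ‖T f‖ ^ 2) (fun f => sq_nonneg _) fun f t => ?_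
  rw [h, Complex.coe_smul, map_smul, norm_smul, Real.norm_eq_abs]
  congr 1
  rw [← Complex.ofReal_pow, mul_pow, sq_abs]
  push_cast
  ring

/-- By bilinearity it suffices to take `a = W(f)`, `b = W(g)`. Differentiating the Gaussian brings
down `⟨T (f + g), T (i A f)⟩`, and `σ(f, f) = 0` reduces `σ(f + g, f)` to the Poisson bracket `σ(g,
f)`. -/
theorem isWeakKMS_of_gaussian {K : Type*} [NormedAddCommGroup K] [InnerProductSpace ℝ K]
    (T : E₀ →ₗ[ℝ] K) {ω : Functional E₀} {A : OneParticle ν →ₗ.[ℂ] OneParticle ν} {β : ℝ}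
    (hd : Dense {f : E₀ | (f : OneParticle ν) ∈ genDomain E₀ A}) (hc : PointwiseClosed E₀ A)
    (hω : IsState ω)
    (h : ∀ f, ω (weylIn E₀ f) = Complex.exp (-(1 / 2) * (‖T f‖ : ℂ) ^ 2))
    (hT : ∀ (k : E₀) (f : genDomain E₀ A),
      β * inner ℝ (T k) (T (genOp A f)) = -sympl (k : OneParticle ν) f) :
    IsWeakKMS E₀ A β ω := by
  refine ⟨hd, hc, hω, (isAnalytic_of_gaussian_map T hω h).isC2, fun a b => ?_⟩
  rw [bracketExpectation, derivationExpectation, Finsupp.sum, Finsupp.sum, Finset.mul_sum]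
  refine Finset.sum_congr rfl fun f _ => ?_
  rw [Finsupp.sum, Finsupp.sum, Finset.mul_sum]
  refine Finset.sum_congr rfl fun g _ => ?_
  rw [fieldExpectation_gaussian T h]
  have h1 := hT (genIncl A f + genIncl A g) f
  have h2 : sympl ((genIncl A f + genIncl A g : E₀) : OneParticle ν) f =
      sympl (g : OneParticle ν) (f : OneParticle ν) := by
    rw [Submodule.coe_add, sympl_add_left]
    change sympl (f : OneParticle ν) f + sympl (g : OneParticle ν) f = _
    rw [sympl_self, zero_add]
  rw [h2] at h1
  have h3 : (sympl (g : OneParticle ν) (f : OneParticle ν) : ℂ) =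
      -(β * (inner ℝ (T (genIncl A f + genIncl A g)) (T (genOp A f)) : ℝ)) := by
    rw [← Complex.ofReal_mul, h1]
    push_cast
    ring
  rw [h3]
  linear_combination (-(a f * b g * β * (inner ℝ (T (genIncl A f + genIncl A g)) (T (genOp A f)) : ℝ)
    * ω (weylIn E₀ (genIncl A f + genIncl A g)))) * Complex.I_mul_I

theorem genDomain_sub {A : OneParticle ν →ₗ.[ℂ] OneParticle ν} {f g : OneParticle ν}
    (hf : f ∈ genDomain E₀ A) (hg : g ∈ genDomain E₀ A) : f - g ∈ genDomain E₀ A := by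
  obtain ⟨h1, h2, h3⟩ := hf
  obtain ⟨k1, k2, k3⟩ := hg
  refine ⟨E₀.sub_mem h1 k1, A.domain.sub_mem h2 k2, ?_⟩
  have := E₀.sub_mem h3 k3
  rwa [← A.map_sub] at this

theorem genDomain_smul {A : OneParticle ν →ₗ.[ℂ] OneParticle ν} {f : OneParticle ν} (c : ℂ)
    (hf : f ∈ genDomain E₀ A) : c • f ∈ genDomain E₀ A := by
  obtain ⟨h1, h2, h3⟩ := hf
  refine ⟨E₀.smul_mem c h1, A.domain.smul_mem c h2, ?_⟩
  have := E₀.smul_mem c h3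
  rwa [← A.map_smul] at this

theorem bracketExpectation_single (A : OneParticle ν →ₗ.[ℂ] OneParticle ν) (ω : Functional E₀)
    (f g : genDomain E₀ A) :
    bracketExpectation A ω (Finsupp.single f 1) (Finsupp.single g 1) =
      (sympl (g : OneParticle ν) (f : OneParticle ν) : ℂ) *
        ω (weylIn E₀ (genIncl A f + genIncl A g)) := by
  rw [bracketExpectation, Finsupp.sum_single_index, Finsupp.sum_single_index]
  · rw [one_mul, one_mul]
  · simp only [mul_zero, zero_mul]
  · simp only [zero_mul]
    exact Finset.sum_const_zero

theorem derivationExpectation_single (A : OneParticle ν →ₗ.[ℂ] OneParticle ν) (ω : Functional E₀)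
    (f g : genDomain E₀ A) :
    derivationExpectation A ω (Finsupp.single f 1) (Finsupp.single g 1) =
      Complex.I * fieldExpectation ω (genOp A f) (genIncl A f + genIncl A g) := by
  rw [derivationExpectation, Finsupp.sum_single_index, Finsupp.sum_single_index]
  · rw [one_mul, one_mul]
  · simp only [mul_zero, zero_mul]
  · simp only [zero_mul]
    exact Finset.sum_const_zero

/-- The KMS condition for `a = W(f)` and `b = W(k - f)`, whose product is `W(k)`. It is a
differential equation for the characteristic function in the direction `i A f`. -/
theorem IsWeakKMS.hasDerivAt {A : OneParticle ν →ₗ.[ℂ] OneParticle ν} {β : ℝ} (hβ : β ≠ 0)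
    {ω : Functional E₀} (h : IsWeakKMS E₀ A β ω) (k f : genDomain E₀ A) :
    HasDerivAt (fun t : ℝ => ω (weylIn E₀ (genIncl A k + (t : ℂ) • genOp A f)))
      ((sympl (k : OneParticle ν) (f : OneParticle ν) / β : ℝ) * ω (weylIn E₀ (genIncl A k))) 0 := by
  have h1 := (h.c2.differentiableAt (genIncl A k) (genOp A f) 0).hasDerivAt
  obtain ⟨g, hg⟩ : ∃ g : genDomain E₀ A, (g : OneParticle ν) = (k : OneParticle ν) - f :=
    ⟨⟨_, genDomain_sub k.2 f.2⟩, rfl⟩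
  have h2 := h.kms (Finsupp.single f 1) (Finsupp.single g 1)
  have h3 : genIncl A f + genIncl A g = genIncl A k := by
    refine Subtype.ext ?_
    change (f : OneParticle ν) + (g : OneParticle ν) = k
    rw [hg, add_sub_cancel]
  have h4 : sympl (g : OneParticle ν) (f : OneParticle ν) = sympl (k : OneParticle ν) f := by
    rw [hg, sympl_sub_left, sympl_self, sub_zero]
  rw [bracketExpectation_single, derivationExpectation_single, h3, h4, fieldExpectation] at h2
  refine h1.congr_deriv ?_
  have hβ' : (β : ℂ) ≠ 0 := by exact_mod_cast hβ
  rw [Complex.ofReal_div, div_mul_eq_mul_div, h2, eq_div_iff hβ']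
  linear_combination
    (β * deriv (fun t : ℝ => ω (weylIn E₀ (genIncl A k + (t : ℂ) • genOp A f))) 0) *
      Complex.I_mul_I

/-- If `A` is invertible, the weak KMS condition determines the characteristic function on the
domain. -/
theorem IsWeakKMS.apply_weyl {A : OneParticle ν →ₗ.[ℂ] OneParticle ν} {β : ℝ} (hβ : β ≠ 0)
    {ω : Functional E₀} (h : IsWeakKMS E₀ A β ω) (k f : genDomain E₀ A)
    (hf : genOp A f = genIncl A k) :
    ω (weylIn E₀ (genIncl A k)) = Complex.exp ((sympl (k : OneParticle ν) f / (2 * β) : ℝ) : ℂ) := by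
  set c : ℝ := sympl (k : OneParticle ν) f / β with hc
  let F : ℝ → ℂ := fun s => ω (weylIn E₀ ((s : ℂ) • genIncl A k))
  -- With `i A f = k` the direction of differentiation is the line itself; applied at the base point
  -- `s k`, the condition reads `F'(s) = s c F(s)`.
  have hF : ∀ s, HasDerivAt F ((s * c : ℝ) * F s) s := by
    intro s
    have h1 := h.hasDerivAt hβ ⟨(s : ℂ) • (k : OneParticle ν), genDomain_smul s k.2⟩ f
    rw [hf] at h1
    have h2 : HasDerivAt (fun t : ℝ => F (s + t)) ((s * c : ℝ) * F s) 0 := by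
      convert h1 using 1
      · funext t
        simp only [F]
        congr 2
        refine Subtype.ext ?_
        push_cast
        rw [add_smul]
        rfl
      · congr 2
        simp [sympl, hc]
        ring
    have h4 : HasDerivAt (fun t : ℝ => F (s + t)) ((s * c : ℝ) * F s) (s - s) := by
      rw [sub_self]
      exact h2
    have h3 := HasDerivAt.comp_sub_const s s h4
    simpa using h3
  -- Integrating factor: `G` is constant, and `G 0 = 1` by normalisation.
  let G : ℝ → ℂ := fun s => F s * Complex.exp ((-(s ^ 2 / 2 * c) : ℝ) : ℂ)
  have hG : ∀ s, HasDerivAt G 0 s := by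
    intro s
    have h1 : HasDerivAt (fun s : ℝ => -(s ^ 2 / 2 * c)) (-(s * c)) s := by
      have := ((((hasDerivAt_id s).pow 2).div_const 2).mul_const c).neg
      exact this.congr_deriv (by simp)
    have h2 := (hF s).mul h1.ofReal_comp.cexp
    refine h2.congr_deriv ?_
    push_cast
    ring
  have hconst := is_const_of_deriv_eq_zero (fun s => (hG s).differentiableAt)
    (fun s => (hG s).deriv) 1 0
  have h0 : G 0 = 1 := by
    simp only [G, F]
    rw [Complex.ofReal_zero, zero_smul, weylIn_zero, h.state.unit]
    simp
  have h1 : G 1 = ω (weylIn E₀ (genIncl A k)) * Complex.exp ((-(c / 2) : ℝ) : ℂ) := by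
    simp only [G, F]
    rw [Complex.ofReal_one, one_smul]
    congr 3
    ring
  rw [h1, h0] at hconst
  have h5 : Complex.exp ((sympl (k : OneParticle ν) f / (2 * β) : ℝ) : ℂ) *
      Complex.exp ((-(c / 2) : ℝ) : ℂ) = 1 := by
    rw [← Complex.exp_add, ← Complex.ofReal_add, hc]
    have : sympl (k : OneParticle ν) f / (2 * β) + -(sympl (k : OneParticle ν) f / β / 2) = 0 := by
      field_simp
      ring
    rw [this]
    simp
  exact mul_right_cancel₀ (Complex.exp_ne_zero _) (hconst.trans h5.symm)

/-! ### Pointwise closedness -/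

/-- The functional `Re ⟨f, ·⟩` as a linear functional, linearly in `f ∈ E₀`. -/
def fieldFunctional (E₀ : Submodule ℂ (OneParticle ν)) :
    E₀ →ₗ[ℝ] OneParticle ν →ₗ[ℝ] ℝ where
  toFun f :=
    { toFun := field f
      map_add' := field_add_right _
      map_smul' := fun r g => field_smul_right _ _ r }
  map_add' f g := LinearMap.ext fun h => field_add_left _ _ _
  map_smul' r f := LinearMap.ext fun h => by
    change field ((r • f : E₀) : OneParticle ν) h = r * field f h
    have : ((r • f : E₀) : OneParticle ν) = (r : ℂ) • (f : OneParticle ν) := rfl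
    simp [this, field]

/-- A linear functional which is small on a weak neighbourhood of zero is given by an element of
`E₀`. -/
theorem exists_field_eq (ℓ : OneParticle ν →ₗ[ℝ] ℝ) (I : Set E₀) (hI : I.Finite)
    (h : ∀ g, (∀ f ∈ I, field (f : OneParticle ν) g = 0) → |ℓ g| < 1) :
    ∃ w : E₀, ∀ g, ℓ g = field (w : OneParticle ν) g := by
  have : Finite I := hI
  have hker : ⨅ i : I, LinearMap.ker (fieldFunctional E₀ i) ≤ LinearMap.ker ℓ := by
    intro g hg
    rw [Submodule.mem_iInf] at hg
    rw [LinearMap.mem_ker]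
    -- Homogeneity: a nonzero value of `ℓ` on the joint kernel could be rescaled to one, against the
    -- bound. So `ℓ` vanishes there and is a combination of finitely many field functionals.
    by_contra hne
    have := h ((ℓ g)⁻¹ • g) fun f hf => by
      rw [field_smul_right]
      have : field (f : OneParticle ν) g = 0 := hg ⟨f, hf⟩
      rw [this, mul_zero]
    rw [map_smul, smul_eq_mul, inv_mul_cancel₀ hne] at this
    simp at this
  have hspan := mem_span_of_iInf_ker_le_ker hker
  have hle : Submodule.span ℝ (Set.range fun i : I => fieldFunctional E₀ i) ≤
      LinearMap.range (fieldFunctional E₀) := by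
    rw [Submodule.span_le]
    rintro _ ⟨i, rfl⟩
    exact ⟨i, rfl⟩
  obtain ⟨w, hw⟩ := hle hspan
  exact ⟨w, fun g => by rw [← hw]; rfl⟩

/-- The imaginary part of `⟨v, g⟩` is the real part of `⟨v, -i g⟩`. -/
theorem tendsto_inner_of_field {u : ℕ → OneParticle ν} {f : OneParticle ν}
    (h : ∀ g, Tendsto (fun n => field (u n) g) atTop (𝓝 (field f g))) (g : OneParticle ν) :
    Tendsto (fun n => ⟪u n, g⟫) atTop (𝓝 ⟪f, g⟫) := by
  have key : ∀ v : OneParticle ν, ⟪v, g⟫ = (field v g : ℂ) +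
      (field v (-(Complex.I • g)) : ℂ) * Complex.I := by
    intro v
    refine (Complex.re_add_im _).symm.trans ?_
    simp [field, inner_smul_right]
  rw [key f]
  refine Tendsto.congr (fun n => (key (u n)).symm) ?_
  exact (Complex.continuous_ofReal.tendsto _ |>.comp (h g)).add
    ((Complex.continuous_ofReal.tendsto _ |>.comp (h _)).mul_const _)

/-- Reduces pointwise closedness to weak sequential closedness of the graph of `A` within `E₀`.
Dividing the limit by the nowhere vanishing Weyl function shows that `Re ⟨i A u_n, g⟩` converges for
every `g`, to a real-linear functional of `g`. Weak continuity of `Ψ` forces that functional to come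
from a vector of `E₀`. -/
theorem pointwiseClosed_of_weakly_closed {A : OneParticle ν →ₗ.[ℂ] OneParticle ν}
    (h : ∀ (u : ℕ → genDomain E₀ A) (f v : E₀),
      (∀ g, Tendsto (fun n => ⟪(u n : OneParticle ν), g⟫) atTop (𝓝 ⟪(f : OneParticle ν), g⟫)) →
      (∀ g, Tendsto (fun n => ⟪A ⟨u n, (u n).2.2.choose⟩, g⟫) atTop
        (𝓝 ⟪(v : OneParticle ν), g⟫)) →
      ∃ hf : (f : OneParticle ν) ∈ A.domain, A ⟨f, hf⟩ = v) : PointwiseClosed E₀ A := by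
  intro u f Ψ hu hΨ hlim
  have hweyl : ∀ g, Tendsto (fun n => weyl (u n : OneParticle ν) g) atTop
      (𝓝 (weyl (f : OneParticle ν) g)) := fun g => by
    simp only [weyl_apply]
    exact ((Complex.continuous_exp.comp (continuous_const.mul Complex.continuous_ofReal)).tendsto
      _).comp (hu g)
  have hne : ∀ (v g : OneParticle ν), weyl v g ≠ 0 := fun v g => Complex.exp_ne_zero _
  have hlimC : ∀ g, Tendsto (fun n => (field (genOp A (u n) : OneParticle ν) g : ℂ)) atTop
      (𝓝 (Ψ g / (Complex.I * weyl (f : OneParticle ν) g))) := fun g => by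
    refine ((hlim g).div ((hweyl g).const_mul Complex.I)
      (mul_ne_zero Complex.I_ne_zero (hne _ _))).congr fun n => ?_
    have h1 : weakDerivation A (u n) g =
      Complex.I * (field (genOp A (u n) : OneParticle ν) g : ℂ) * weyl (u n : OneParticle ν) g := rfl
    change weakDerivation A (u n) g / (Complex.I * weyl (u n : OneParticle ν) g) = _
    rw [h1]
    have := hne (u n) g
    have := Complex.I_ne_zero
    field_simp
  have hlimR : ∀ g, Tendsto (fun n => field (genOp A (u n) : OneParticle ν) g) atTop
      (𝓝 (Ψ g / (Complex.I * weyl (f : OneParticle ν) g)).re) := fun g =>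
    ((Complex.continuous_re.tendsto _).comp (hlimC g)).congr fun n => Complex.ofReal_re _
  let ℓ : OneParticle ν →ₗ[ℝ] ℝ :=
    { toFun := fun g => (Ψ g / (Complex.I * weyl (f : OneParticle ν) g)).re
      map_add' := fun g k => tendsto_nhds_unique (hlimR (g + k))
        (((hlimR g).add (hlimR k)).congr fun n => (field_add_right _ _ _).symm)
      map_smul' := fun r g => tendsto_nhds_unique (hlimR (r • g))
        (((hlimR g).const_mul r).congr fun n => (field_smul_right _ _ r).symm) }
  have hℓ : ∀ g, Tendsto (fun n => field (genOp A (u n) : OneParticle ν) g) atTop (𝓝 (ℓ g)) := hlimR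
  have hΨℓ : ∀ g, Ψ g = Complex.I * (ℓ g : ℂ) * weyl (f : OneParticle ν) g := fun g => by
    have h1 := tendsto_nhds_unique (hlimC g) ((Complex.continuous_ofReal.tendsto _).comp (hℓ g))
    rw [div_eq_iff (mul_ne_zero Complex.I_ne_zero (hne _ _))] at h1
    rw [h1]
    ring
  -- Since `|Ψ| = |ℓ|`, weak continuity of `Ψ` at zero bounds `ℓ` on a basic weak neighbourhood,
  -- which involves only finitely many `f ∈ E₀`.
  obtain ⟨w, hw⟩ : ∃ w : E₀, ∀ g, ℓ g = field (w : OneParticle ν) g := by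
    have h1 : {g | ‖Ψ g‖ < 1} ∈ @nhds _ (TopologicalSpace.induced
        (fun (g : OneParticle ν) (f : E₀) => field f g) inferInstance) 0 := by
      have h2 := @Continuous.tendsto _ _ (_) _ _ hΨ 0
      have h3 : Ψ 0 = 0 := by rw [hΨℓ, map_zero]; simp
      rw [h3] at h2
      have := h2 (Metric.ball_mem_nhds 0 one_pos)
      have h4 : {g | ‖Ψ g‖ < 1} = Ψ ⁻¹' Metric.ball 0 1 := by
        ext g
        simp
      rw [h4]
      exact this
    rw [nhds_induced, mem_comap] at h1
    obtain ⟨t, ht, hts⟩ := h1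
    rw [nhds_pi, Filter.mem_pi] at ht
    obtain ⟨I, hI, s, hs, hst⟩ := ht
    refine exists_field_eq ℓ I hI fun g hg => ?_
    have h4 : ‖Ψ g‖ < 1 := by
      refine hts (hst fun i hi => ?_)
      have h5 := mem_of_mem_nhds (hs i)
      have h6 : field (i : OneParticle ν) 0 = 0 := by simp [field]
      simp only [h6] at h5
      change field (i : OneParticle ν) g ∈ s i
      rw [hg i hi]
      exact h5
    rw [hΨℓ, norm_mul, norm_mul, norm_weyl_apply] at h4
    simpa using h4
  -- The limit of `i A u_n` is `w`, so that of `A u_n` is `-i w`.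
  obtain ⟨hf, hA⟩ := h u f (-(Complex.I • w)) (tendsto_inner_of_field hu) fun g => by
    have h1 := tendsto_inner_of_field (u := fun n => (genOp A (u n) : OneParticle ν))
      (f := (w : OneParticle ν)) (fun g => by rw [← hw]; exact hℓ g) (Complex.I • g)
    have h2 : ⟪((-(Complex.I • w) : E₀) : OneParticle ν), g⟫ =
        ⟪(w : OneParticle ν), Complex.I • g⟫ := by
      simp [inner_neg_left, inner_smul_left, inner_smul_right]
    rw [h2]
    refine h1.congr fun n => ?_
    have h3 : (genOp A (u n) : OneParticle ν) =
      Complex.I • A ⟨u n, (u n).2.2.choose⟩ := rfl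
    rw [h3, inner_smul_left, inner_smul_right, ← mul_assoc, Complex.conj_I, neg_mul,
      Complex.I_mul_I, neg_neg, one_mul]
  have hmem : (f : OneParticle ν) ∈ genDomain E₀ A := ⟨f.2, hf, by rw [hA]; exact (-(Complex.I • w)).2⟩
  refine ⟨hmem, funext fun g => ?_⟩
  have h1 : (genOp A ⟨(f : OneParticle ν), hmem⟩ : OneParticle ν) = w := by
    change Complex.I • A ⟨f, _⟩ = (w : OneParticle ν)
    rw [hA]
    simp [smul_smul]
  have h2 : weakDerivation A ⟨(f : OneParticle ν), hmem⟩ g = Complex.I *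
    (field (genOp A ⟨(f : OneParticle ν), hmem⟩ : OneParticle ν) g : ℂ) *
      weyl (f : OneParticle ν) g := rfl
  rw [hΨℓ, hw, h2, h1]

/-! ### Inner products of Schwartz functions -/

theorem inner_ofSchwartz (φ : 𝓢(Space ν, ℂ)) (f : OneParticle ν) :
    ⟪ofSchwartz φ, f⟫ = ∫ x, (starRingEnd ℂ) (φ x) * f x := by
  rw [L2.inner_def]
  refine integral_congr_ae ?_
  filter_upwards [SchwartzMap.coeFn_toLp φ 2 (volume : Measure (Space ν))] with x hx
  have hx' : (ofSchwartz φ : Space ν → ℂ) x = φ x := hx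
  rw [hx', RCLike.inner_apply, mul_comm]

theorem inner_ofSchwartz_ofSchwartz (φ ψ : 𝓢(Space ν, ℂ)) :
    ⟪ofSchwartz φ, ofSchwartz ψ⟫ = ∫ x, (starRingEnd ℂ) (φ x) * ψ x := by
  rw [inner_ofSchwartz]
  refine integral_congr_ae ?_
  filter_upwards [SchwartzMap.coeFn_toLp ψ 2 (volume : Measure (Space ν))] with x hx
  have hx' : (ofSchwartz ψ : Space ν → ℂ) x = ψ x := hx
  rw [hx']

/-- The real-bilinear map `(a, b) ↦ conj a * b`. -/
def conjMul : ℂ →L[ℝ] ℂ →L[ℝ] ℂ :=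
  (ContinuousLinearMap.mul ℝ ℂ).comp (Complex.conjCLE : ℂ →L[ℝ] ℂ)

theorem inner_lineDeriv_right (φ ψ : 𝓢(Space ν, ℂ)) (v : Space ν) :
    ⟪ofSchwartz φ, ofSchwartz (∂_{v} ψ)⟫ = -⟪ofSchwartz (∂_{v} φ), ofSchwartz ψ⟫ := by
  rw [inner_ofSchwartz_ofSchwartz, inner_ofSchwartz_ofSchwartz]
  exact SchwartzMap.integral_bilinear_lineDerivOp_right_eq_neg_left φ ψ conjMul v

theorem kinetic_eq_sum (φ : 𝓢(Space ν, ℂ)) :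
    kinetic φ = (-(1 / 2 : ℂ)) • ∑ i : Fin ν, ∂_{EuclideanSpace.single i (1 : ℝ)}
      (∂_{EuclideanSpace.single i (1 : ℝ)} φ) := by
  rw [kinetic, SchwartzMap.laplacian_eq_sum (EuclideanSpace.basisFun (Fin ν) ℝ)]
  simp

theorem ofSchwartz_sum {ι : Type*} (s : Finset ι) (φ : ι → 𝓢(Space ν, ℂ)) :
    ofSchwartz (∑ i ∈ s, φ i) = ∑ i ∈ s, ofSchwartz (φ i) :=
  map_sum (SchwartzMap.toLpCLM ℂ ℂ 2 (volume : Measure (Space ν))) φ s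

theorem inner_kinetic (φ ψ : 𝓢(Space ν, ℂ)) :
    ⟪ofSchwartz φ, ofSchwartz (kinetic ψ)⟫ =
      1 / 2 * ∑ i : Fin ν, ⟪ofSchwartz (∂_{EuclideanSpace.single i (1 : ℝ)} φ),
        ofSchwartz (∂_{EuclideanSpace.single i (1 : ℝ)} ψ)⟫ := by
  rw [kinetic_eq_sum, ofSchwartz_smul, ofSchwartz_sum, inner_smul_right, inner_sum]
  simp only [inner_lineDeriv_right, Finset.sum_neg_distrib]
  ring

theorem inner_kinetic_left (φ ψ : 𝓢(Space ν, ℂ)) :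
    ⟪ofSchwartz (kinetic φ), ofSchwartz ψ⟫ = ⟪ofSchwartz φ, ofSchwartz (kinetic ψ)⟫ := by
  rw [← inner_conj_symm, inner_kinetic, inner_kinetic]
  simp only [map_mul, map_sum, inner_conj_symm, map_div₀, map_one, map_ofNat]

/-! ### Dirichlet forms -/

/-- `u` is the limit in `H¹₀` of test functions in the open box, with gradient `G`. -/
def HasDirichletGrad (L : ℝ) (u : OneParticle ν) (G : Fin ν → OneParticle ν) : Prop :=
  ∃ φ : ℕ → 𝓢(Space ν, ℂ), (∀ n, IsTest (openBox ν L) (φ n)) ∧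
    Tendsto (fun n => ofSchwartz (φ n)) atTop (𝓝 u) ∧
    ∀ i : Fin ν, Tendsto (fun n => ofSchwartz (∂_{EuclideanSpace.single i (1 : ℝ)} (φ n))) atTop
      (𝓝 (G i))

theorem isH10_iff {L : ℝ} {u : OneParticle ν} : IsH10 L u ↔ ∃ G, HasDirichletGrad L u G := by
  constructor
  · rintro ⟨φ, h1, h2, h3⟩
    choose G hG using fun i => cauchySeq_tendsto_of_complete (h3 i)
    exact ⟨G, φ, h1, h2, hG⟩
  · rintro ⟨G, φ, h1, h2, h3⟩
    exact ⟨φ, h1, h2, fun i => (h3 i).cauchySeq⟩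

theorem HasDirichletGrad.sub {L : ℝ} {u w : OneParticle ν} {G K : Fin ν → OneParticle ν}
    (hu : HasDirichletGrad L u G) (hw : HasDirichletGrad L w K) :
    HasDirichletGrad L (u - w) (G - K) := by
  obtain ⟨φ, h1, h2, h3⟩ := hu
  obtain ⟨ψ, k1, k2, k3⟩ := hw
  refine ⟨fun n => φ n + (-1 : ℂ) • ψ n, fun n => (h1 n).add ((k1 n).smul _), ?_, fun i => ?_⟩
  · simp only [ofSchwartz_add, ofSchwartz_smul]
    simp only [sub_eq_add_neg, neg_one_smul]
    exact h2.add k2.neg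
  · simp only [LineDeriv.lineDerivOp_add, LineDeriv.lineDerivOp_smul, ofSchwartz_add,
      ofSchwartz_smul, Pi.sub_apply]
    simp only [sub_eq_add_neg, neg_one_smul]
    exact (h3 i).add (k3 i).neg

theorem hasDirichletGrad_of_approx {L : ℝ} {u : OneParticle ν} {G : Fin ν → OneParticle ν}
    (h : ∀ ε : ℝ, 0 < ε → ∃ φ : 𝓢(Space ν, ℂ), IsTest (openBox ν L) φ ∧ ‖ofSchwartz φ - u‖ ≤ ε ∧
      ∀ i, ‖ofSchwartz (∂_{EuclideanSpace.single i (1 : ℝ)} φ) - G i‖ ≤ ε) :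
    HasDirichletGrad L u G := by
  choose φ h1 h2 h3 using fun n : ℕ => h (1 / ((n : ℝ) + 1)) (by positivity)
  refine ⟨φ, h1, ?_, fun i => ?_⟩
  · rw [tendsto_iff_norm_sub_tendsto_zero]
    exact squeeze_zero (fun n => norm_nonneg _) h2 tendsto_one_div_add_atTop_nhds_zero_nat
  · rw [tendsto_iff_norm_sub_tendsto_zero]
    exact squeeze_zero (fun n => norm_nonneg _) (fun n => h3 n i)
      tendsto_one_div_add_atTop_nhds_zero_nat

/-- The weak formulation of `v = -Δu/2` extends to `H¹₀`. -/
theorem HasDirichletGrad.inner_eq {L : ℝ} {u u' v : OneParticle ν} {G G' : Fin ν → OneParticle ν}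
    (hu : HasDirichletGrad L u G) (hu' : HasDirichletGrad L u' G')
    (h : IsDistribKinetic (openBox ν L) u v) : ⟪u', v⟫ = 1 / 2 * ∑ i, ⟪G' i, G i⟫ := by
  obtain ⟨φ, h1, h2, h3⟩ := hu
  obtain ⟨ψ, k1, k2, k3⟩ := hu'
  have key : ∀ n, ⟪ofSchwartz (ψ n), v⟫ = 1 / 2 * ∑ i,
      ⟪ofSchwartz (∂_{EuclideanSpace.single i (1 : ℝ)} (ψ n)), G i⟫ := by
    intro n
    rw [h _ (k1 n)]
    have e1 : Tendsto (fun m => ⟪ofSchwartz (kinetic (ψ n)), ofSchwartz (φ m)⟫) atTop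
        (𝓝 ⟪ofSchwartz (kinetic (ψ n)), u⟫) := tendsto_const_nhds.inner h2
    refine tendsto_nhds_unique e1 ?_
    simp only [inner_kinetic_left, inner_kinetic]
    exact (tendsto_finsetSum _ fun i _ => tendsto_const_nhds.inner (h3 i)).const_mul _
  refine tendsto_nhds_unique (k2.inner tendsto_const_nhds) ?_
  simp only [key]
  exact (tendsto_finsetSum _ fun i _ => (k3 i).inner tendsto_const_nhds).const_mul _

/-- The energy identity. It controls gradients by the graph norm and turns the inverse form into a
Dirichlet integral. -/
theorem HasDirichletGrad.norm_sq_eq {L : ℝ} {u v : OneParticle ν} {G : Fin ν → OneParticle ν}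
    (hu : HasDirichletGrad L u G) (h : IsDistribKinetic (openBox ν L) u v) :
    (⟪u, v⟫).re = 1 / 2 * ∑ i, ‖G i‖ ^ 2 := by
  have h1 : ⟪u, v⟫ = ((1 / 2 * ∑ i, ‖G i‖ ^ 2 : ℝ) : ℂ) := by
    rw [hu.inner_eq hu h]
    simp only [inner_self_eq_norm_sq_to_K]
    push_cast
    rfl
  rw [h1, Complex.ofReal_re]

/-- The Dirichlet Hamiltonian is symmetric. -/
theorem dirichletGraph_symm {L : ℝ} {p q : OneParticle ν × OneParticle ν}
    (hp : p ∈ dirichletGraph ν L) (hq : q ∈ dirichletGraph ν L) : ⟪p.1, q.2⟫ = ⟪p.2, q.1⟫ := by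
  obtain ⟨G, hG⟩ := isH10_iff.mp hp.1
  obtain ⟨K, hK⟩ := isH10_iff.mp hq.1
  rw [hK.inner_eq hG hq.2.2, ← inner_conj_symm p.2 q.1, hG.inner_eq hK hp.2.2]
  simp only [map_mul, map_sum, inner_conj_symm, map_div₀, map_one, map_ofNat]

theorem isClosed_localSpace (L : ℝ) : IsClosed (localSpace ν L : Set (OneParticle ν)) := by
  have hm : MeasurableSet (box ν L)ᶜ := by
    have : box ν L = ⋂ i, (fun x : Space ν => x i) ⁻¹' Set.Icc (-L) L := by
      ext x; simp [box]
    rw [this]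
    exact (MeasurableSet.iInter fun i => measurableSet_Icc.preimage (by fun_prop)).compl
  have h : (localSpace ν L : Set (OneParticle ν)) =
      (LpToLpRestrictCLM (Space ν) ℂ ℂ (volume : Measure (Space ν)) 2 (box ν L)ᶜ) ⁻¹' {0} := by
    ext f
    have h1 := LpToLpRestrictCLM_coeFn ℂ (box ν L)ᶜ f
    rw [Set.mem_preimage, Set.mem_singleton_iff, Lp.eq_zero_iff_ae_eq_zero]
    constructor
    · intro hf
      have hf' : ∀ᵐ x, x ∉ box ν L → f x = 0 := hf
      filter_upwards [h1, (ae_restrict_iff' hm).mpr hf'] with x h2 h3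
      rw [h2, h3]
      rfl
    · intro hf
      change ∀ᵐ x, x ∈ (box ν L)ᶜ → f x = 0
      rw [← ae_restrict_iff' hm]
      filter_upwards [h1, hf] with x h2 h3
      rw [← h2, h3]
      rfl
  rw [h]
  exact isClosed_singleton.preimage (ContinuousLinearMap.continuous _)

/-- By the energy identity each gradient component of a difference satisfies `‖G_i‖² ≤ 2 ‖u‖ ‖v‖`,
so convergence in the graph norm makes the gradients Cauchy. The limit stays in `H¹₀` by a diagonal
choice of test functions. -/
theorem isClosed_dirichletGraph (L : ℝ) :
    IsClosed (dirichletGraph ν L : Set (OneParticle ν × OneParticle ν)) := by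
  refine IsSeqClosed.isClosed fun p q hp hpq => ?_
  choose G hG using fun n => isH10_iff.mp (hp n).1
  have h1 := (continuous_fst.tendsto _).comp hpq
  have h2 := (continuous_snd.tendsto _).comp hpq
  have hb : ∀ m n i, ‖G m i - G n i‖ ≤ 2 * ‖p m - p n‖ := by
    intro m n i
    have hmem := (dirichletGraph ν L).sub_mem (hp m) (hp n)
    have e := ((hG m).sub (hG n)).norm_sq_eq hmem.2.2
    have e2 : ‖G m i - G n i‖ ^ 2 ≤ ∑ i, ‖(G m - G n) i‖ ^ 2 :=
      Finset.single_le_sum (f := fun i => ‖(G m - G n) i‖ ^ 2) (fun i _ => sq_nonneg _)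
        (Finset.mem_univ i)
    have e3 : (⟪(p m - p n).1, (p m - p n).2⟫).re ≤ ‖(p m - p n).1‖ * ‖(p m - p n).2‖ :=
      (Complex.re_le_norm _).trans (norm_inner_le_norm _ _)
    have e4 : ‖(p m - p n).1‖ * ‖(p m - p n).2‖ ≤ ‖p m - p n‖ * ‖p m - p n‖ :=
      mul_le_mul (norm_fst_le _) (norm_snd_le _) (norm_nonneg _) (norm_nonneg _)
    have e5 : (p m - p n).1 = (p m).1 - (p n).1 := rfl
    rw [← e5] at e
    refine le_of_sq_le_sq ?_ (by positivity)
    nlinarith [norm_nonneg (p m - p n)]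
  have hc : ∀ i, CauchySeq fun n => G n i := by
    intro i
    rw [Metric.cauchySeq_iff]
    intro ε hε
    obtain ⟨N, hN⟩ := Metric.cauchySeq_iff.mp hpq.cauchySeq (ε / 2) (by positivity)
    refine ⟨N, fun m hm n hn => ?_⟩
    have := hN m hm n hn
    rw [dist_eq_norm] at this ⊢
    linarith [hb m n i]
  choose K hK using fun i => cauchySeq_tendsto_of_complete (hc i)
  refine ⟨isH10_iff.mpr ⟨K, hasDirichletGrad_of_approx fun ε hε => ?_⟩, ?_, fun φ hφ => ?_⟩
  · have a1 : ∀ᶠ n in atTop, ‖(p n).1 - q.1‖ < ε / 2 := by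
      have := (tendsto_iff_norm_sub_tendsto_zero.mp h1).eventually_lt_const (half_pos hε)
      exact this
    have a2 : ∀ᶠ n in atTop, ∀ i, ‖G n i - K i‖ < ε / 2 := by
      rw [eventually_all]
      exact fun i => (tendsto_iff_norm_sub_tendsto_zero.mp (hK i)).eventually_lt_const (half_pos hε)
    obtain ⟨n, b1, b2⟩ := (a1.and a2).exists
    obtain ⟨φ, k1, k2, k3⟩ := hG n
    have a3 : ∀ᶠ m in atTop, ‖ofSchwartz (φ m) - (p n).1‖ < ε / 2 :=
      (tendsto_iff_norm_sub_tendsto_zero.mp k2).eventually_lt_const (half_pos hε)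
    have a4 : ∀ᶠ m in atTop, ∀ i,
        ‖ofSchwartz (∂_{EuclideanSpace.single i (1 : ℝ)} (φ m)) - G n i‖ < ε / 2 := by
      rw [eventually_all]
      exact fun i => (tendsto_iff_norm_sub_tendsto_zero.mp (k3 i)).eventually_lt_const (half_pos hε)
    obtain ⟨m, c1, c2⟩ := (a3.and a4).exists
    refine ⟨φ m, k1 m, ?_, fun i => ?_⟩
    · have := norm_sub_le_norm_sub_add_norm_sub (ofSchwartz (φ m)) (p n).1 q.1
      linarith
    · have := norm_sub_le_norm_sub_add_norm_sub
        (ofSchwartz (∂_{EuclideanSpace.single i (1 : ℝ)} (φ m))) (G n i) (K i)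
      linarith [c2 i, b2 i]
  · exact (isClosed_localSpace L).mem_of_tendsto h2 (Eventually.of_forall fun n => (hp n).2.1)
  · have e1 : Tendsto (fun n => ⟪ofSchwartz φ, (p n).2⟫) atTop (𝓝 ⟪ofSchwartz φ, q.2⟫) :=
      tendsto_const_nhds.inner h2
    have e2 : Tendsto (fun n => ⟪ofSchwartz (kinetic φ), (p n).1⟫) atTop
        (𝓝 ⟪ofSchwartz (kinetic φ), q.1⟫) := tendsto_const_nhds.inner h1
    exact tendsto_nhds_unique e1 (e2.congr fun n => ((hp n).2.2 φ hφ).symm)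

/-! ### Dominated convergence in `L²` -/

theorem L2_norm_sq_eq_integral {α : Type*} [MeasurableSpace α] {m : Measure α} (h : Lp ℂ 2 m) :
    ‖h‖ ^ 2 = ∫ x, ‖h x‖ ^ 2 ∂m := by
  have h1 : ⟪h, h⟫ = ((‖h‖ ^ 2 : ℝ) : ℂ) := by
    rw [inner_self_eq_norm_sq_to_K]
    push_cast
    rfl
  rw [L2.inner_def] at h1
  have h2 : ∀ x, ⟪h x, h x⟫ = ((‖h x‖ ^ 2 : ℝ) : ℂ) := fun x => by
    rw [inner_self_eq_norm_sq_to_K]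
    push_cast
    rfl
  simp only [h2] at h1
  rw [integral_complex_ofReal] at h1
  exact (Complex.ofReal_injective h1).symm

theorem norm_sq_toLp {α : Type*} [MeasurableSpace α] {m : Measure α} {f : α → ℂ}
    (hf : MemLp f 2 m) : ‖hf.toLp‖ ^ 2 = ∫ x, ‖f x‖ ^ 2 ∂m := by
  rw [L2_norm_sq_eq_integral]
  refine integral_congr_ae ?_
  filter_upwards [hf.coeFn_toLp] with x hx
  rw [hx]

/-- Dominated convergence for the squared differences, with majorant `(2 F)²`. -/
theorem tendsto_toLp_of_dominated {α : Type*} [MeasurableSpace α] {m : Measure α}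
    {f : ℕ → α → ℂ} {g : α → ℂ} (hf : ∀ n, MemLp (f n) 2 m) (hg : MemLp g 2 m) (F : α → ℝ)
    (hF : MemLp F 2 m) (hb : ∀ n, ∀ᵐ x ∂m, ‖f n x‖ ≤ F x)
    (hlim : ∀ᵐ x ∂m, Tendsto (fun n => f n x) atTop (𝓝 (g x))) :
    Tendsto (fun n => (hf n).toLp) atTop (𝓝 hg.toLp) := by
  rw [tendsto_iff_norm_sub_tendsto_zero]
  have h1 : ∀ n, ‖(hf n).toLp - hg.toLp‖ ^ 2 = ∫ x, ‖f n x - g x‖ ^ 2 ∂m := fun n => by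
    rw [← MemLp.toLp_sub, norm_sq_toLp]
    rfl
  have h2 : Tendsto (fun n => ∫ x, ‖f n x - g x‖ ^ 2 ∂m) atTop (𝓝 (∫ _, (0 : ℝ) ∂m)) := by
    refine tendsto_integral_of_dominated_convergence (fun x => (2 * F x) ^ 2)
      (fun n => (((hf n).sub hg).1.norm.pow 2)) ?_ (fun n => ?_) ?_
    · exact (memLp_two_iff_integrable_sq (hF.const_mul 2).1).mp (hF.const_mul 2)
    · filter_upwards [ae_all_iff.mpr hb, hlim] with x hx hx2
      have h3 : ‖g x‖ ≤ F x := le_of_tendsto hx2.norm (Eventually.of_forall hx)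
      have h4 : ‖f n x - g x‖ ≤ 2 * F x := (norm_sub_le _ _).trans (by linarith [hx n])
      rw [Real.norm_of_nonneg (by positivity)]
      exact pow_le_pow_left₀ (norm_nonneg _) h4 2
    · filter_upwards [hlim] with x hx
      have := ((hx.sub_const (g x)).norm).pow 2
      simpa using this
  rw [integral_zero] at h2
  have h3 := (Real.continuous_sqrt.tendsto _).comp (h2.congr fun n => (h1 n).symm)
  simpa [Function.comp_def, Real.sqrt_sq] using h3

/-! ### One-dimensional modes -/

/-- The wave numbers of the interval `[-L, L]` with Dirichlet boundary conditions. -/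
def waveNumber (L : ℝ) (m : ℕ) : ℝ := (m + 1) * (Real.pi / (2 * L))

/-- The one-dimensional Dirichlet modes. -/
def sinMode (L : ℝ) (m : ℕ) (x : ℝ) : ℝ := Real.sin (waveNumber L m * (x + L))

/-- The derivatives of the one-dimensional Dirichlet modes. -/
def cosMode (L : ℝ) (m : ℕ) (x : ℝ) : ℝ :=
  waveNumber L m * Real.cos (waveNumber L m * (x + L))

theorem waveNumber_nonneg {L : ℝ} (hL : 0 < L) (m : ℕ) : 0 ≤ waveNumber L m := by
  unfold waveNumber
  positivity

theorem waveNumber_mul {L : ℝ} (hL : 0 < L) (m : ℕ) :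
    waveNumber L m * (2 * L) = ((m + 1 : ℕ) : ℝ) * Real.pi := by
  unfold waveNumber
  push_cast
  field_simp

theorem hasDerivAt_sinMode (L : ℝ) (m : ℕ) (x : ℝ) :
    HasDerivAt (sinMode L m) (cosMode L m x) x := by
  have h : HasDerivAt (fun x => waveNumber L m * (x + L)) (waveNumber L m) x := by
    simpa using ((hasDerivAt_id x).add_const L).const_mul (waveNumber L m)
  exact h.sin.congr_deriv (by rw [cosMode, mul_comm])

theorem hasDerivAt_cosMode (L : ℝ) (m : ℕ) (x : ℝ) :
    HasDerivAt (cosMode L m) (-(waveNumber L m ^ 2) * sinMode L m x) x := by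
  have h : HasDerivAt (fun x => waveNumber L m * (x + L)) (waveNumber L m) x := by
    simpa using ((hasDerivAt_id x).add_const L).const_mul (waveNumber L m)
  exact (h.cos.const_mul (waveNumber L m)).congr_deriv (by rw [sinMode]; ring)

theorem contDiff_sinMode (L : ℝ) (m : ℕ) : ContDiff ℝ (⊤ : ℕ∞) (sinMode L m) := by
  unfold sinMode
  fun_prop

theorem continuous_sinMode (L : ℝ) (m : ℕ) : Continuous (sinMode L m) :=
  (contDiff_sinMode L m).continuous

theorem continuous_cosMode (L : ℝ) (m : ℕ) : Continuous (cosMode L m) := by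
  unfold cosMode
  fun_prop

theorem abs_sinMode_le_one (L : ℝ) (m : ℕ) (x : ℝ) : |sinMode L m x| ≤ 1 := Real.abs_sin_le_one _

theorem abs_cosMode_le {L : ℝ} (hL : 0 < L) (m : ℕ) (x : ℝ) : |cosMode L m x| ≤ waveNumber L m := by
  rw [cosMode, abs_mul, abs_of_nonneg (waveNumber_nonneg hL m)]
  exact mul_le_of_le_one_right (waveNumber_nonneg hL m) (Real.abs_cos_le_one _)

theorem abs_sinMode_le_left {L : ℝ} (hL : 0 < L) (m : ℕ) (x : ℝ) :
    |sinMode L m x| ≤ waveNumber L m * |L + x| := by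
  refine Real.abs_sin_le_abs.trans_eq ?_
  rw [abs_mul, abs_of_nonneg (waveNumber_nonneg hL m), add_comm]

/-- Reflection in the right end point: `sin (nπ - y)` equals `sin y` up to sign, because `2 L` times
the wave number is an integer multiple of `π`. -/
theorem abs_sinMode_le_right {L : ℝ} (hL : 0 < L) (m : ℕ) (x : ℝ) :
    |sinMode L m x| ≤ waveNumber L m * |L - x| := by
  have h : waveNumber L m * (x + L) =
      ((m + 1 : ℕ) : ℝ) * Real.pi - waveNumber L m * (L - x) := by
    rw [← waveNumber_mul hL]
    ring
  have h2 : |sinMode L m x| = |Real.sin (waveNumber L m * (L - x))| := by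
    rw [sinMode, h, Real.sin_nat_mul_pi_sub, abs_neg, abs_mul, abs_pow, abs_neg, abs_one, one_pow,
      one_mul]
  rw [h2]
  refine Real.abs_sin_le_abs.trans_eq ?_
  rw [abs_mul, abs_of_nonneg (waveNumber_nonneg hL m)]

/-! ### One-dimensional cutoffs -/

theorem deriv_smoothTransition_eq_zero {t : ℝ} (ht : t < 0 ∨ 1 < t) :
    deriv Real.smoothTransition t = 0 := by
  rcases ht with ht | ht
  · have : Real.smoothTransition =ᶠ[𝓝 t] fun _ => 0 := by
      filter_upwards [Iio_mem_nhds ht] with s hs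
      exact Real.smoothTransition.zero_of_nonpos hs.le
    rw [this.deriv_eq, deriv_const]
  · have : Real.smoothTransition =ᶠ[𝓝 t] fun _ => 1 := by
      filter_upwards [Ioi_mem_nhds ht] with s hs
      exact Real.smoothTransition.one_of_one_le hs.le
    rw [this.deriv_eq, deriv_const]

theorem exists_abs_deriv_smoothTransition_le :
    ∃ C : ℝ, 0 ≤ C ∧ ∀ t, |deriv Real.smoothTransition t| ≤ C := by
  have hc : Continuous (deriv Real.smoothTransition) :=
    (Real.smoothTransition.contDiff (n := 1)).continuous_deriv le_rfl
  obtain ⟨C, hC⟩ := (isCompact_Icc (a := (0 : ℝ)) (b := 1)).exists_bound_of_continuousOn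
    hc.continuousOn
  refine ⟨max C 0, le_max_right _ _, fun t => ?_⟩
  by_cases ht : t ∈ Set.Icc (0 : ℝ) 1
  · exact (hC t ht).trans (le_max_left _ _)
  · rw [deriv_smoothTransition_eq_zero, abs_zero]
    · exact le_max_right _ _
    · rw [Set.mem_Icc, not_and_or, not_le, not_le] at ht
      exact ht

/-- A smooth function on the interval, equal to one except close to the end points and to zero
near them. -/
def edgeCutoff (L : ℝ) (j : ℕ) (x : ℝ) : ℝ :=
  Real.smoothTransition ((j + 1) * (L - x) - 1) * Real.smoothTransition ((j + 1) * (L + x) - 1)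

/-- The derivative of `edgeCutoff`. -/
def edgeCutoffDeriv (L : ℝ) (j : ℕ) (x : ℝ) : ℝ :=
  -((j + 1) * deriv Real.smoothTransition ((j + 1) * (L - x) - 1)) *
      Real.smoothTransition ((j + 1) * (L + x) - 1) +
    Real.smoothTransition ((j + 1) * (L - x) - 1) *
      ((j + 1) * deriv Real.smoothTransition ((j + 1) * (L + x) - 1))

theorem contDiff_edgeCutoff (L : ℝ) (j : ℕ) : ContDiff ℝ (⊤ : ℕ∞) (edgeCutoff L j) := by
  unfold edgeCutoff
  have h := Real.smoothTransition.contDiff (n := ⊤)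
  exact (h.comp (by fun_prop)).mul (h.comp (by fun_prop))

theorem hasDerivAt_edgeCutoff (L : ℝ) (j : ℕ) (x : ℝ) :
    HasDerivAt (edgeCutoff L j) (edgeCutoffDeriv L j x) x := by
  have hS : ∀ t, HasDerivAt Real.smoothTransition (deriv Real.smoothTransition t) t := fun t =>
    ((Real.smoothTransition.contDiff (n := 1)).differentiable (by norm_num) t).hasDerivAt
  have h1 : HasDerivAt (fun x : ℝ => ((j : ℝ) + 1) * (L - x) - 1) (-((j : ℝ) + 1)) x := by
    simpa using (((hasDerivAt_id x).const_sub L).const_mul ((j : ℝ) + 1)).sub_const 1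
  have h2 : HasDerivAt (fun x : ℝ => ((j : ℝ) + 1) * (L + x) - 1) ((j : ℝ) + 1) x := by
    simpa using (((hasDerivAt_id x).const_add L).const_mul ((j : ℝ) + 1)).sub_const 1
  refine (((hS _).comp x h1).mul ((hS _).comp x h2)).congr_deriv ?_
  rw [edgeCutoffDeriv]
  simp only [Function.comp_apply]
  ring

theorem abs_edgeCutoff_le_one (L : ℝ) (j : ℕ) (x : ℝ) : |edgeCutoff L j x| ≤ 1 := by
  rw [edgeCutoff, abs_mul, abs_of_nonneg (Real.smoothTransition.nonneg _),
    abs_of_nonneg (Real.smoothTransition.nonneg _)]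
  exact mul_le_one₀ (Real.smoothTransition.le_one _) (Real.smoothTransition.nonneg _)
    (Real.smoothTransition.le_one _)

theorem edgeCutoff_support {L : ℝ} {j : ℕ} {x : ℝ} (h : edgeCutoff L j x ≠ 0) :
    x ∈ Set.Icc (-L + 1 / ((j : ℝ) + 1)) (L - 1 / ((j : ℝ) + 1)) := by
  rw [edgeCutoff] at h
  have hj : (0 : ℝ) < (j : ℝ) + 1 := by positivity
  have h1 : 0 < ((j : ℝ) + 1) * (L - x) - 1 := by
    by_contra hn
    exact left_ne_zero_of_mul h (Real.smoothTransition.zero_of_nonpos (not_lt.mp hn))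
  have h2 : 0 < ((j : ℝ) + 1) * (L + x) - 1 := by
    by_contra hn
    exact right_ne_zero_of_mul h (Real.smoothTransition.zero_of_nonpos (not_lt.mp hn))
  have e1 : 1 / ((j : ℝ) + 1) < L - x := by
    rw [div_lt_iff₀' hj]
    linarith
  have e2 : 1 / ((j : ℝ) + 1) < L + x := by
    rw [div_lt_iff₀' hj]
    linarith
  constructor <;> linarith

theorem edgeCutoffDeriv_support {L : ℝ} {j : ℕ} {x : ℝ} (h : edgeCutoffDeriv L j x ≠ 0) :
    x ∈ Set.Icc (-L) L := by
  by_contra hx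
  have hj : (0 : ℝ) < (j : ℝ) + 1 := by positivity
  refine h ?_
  rw [Set.mem_Icc, not_and_or, not_le, not_le] at hx
  rw [edgeCutoffDeriv]
  rcases hx with hx | hx
  · have h1 : ((j : ℝ) + 1) * (L + x) - 1 < 0 := by nlinarith
    rw [Real.smoothTransition.zero_of_nonpos h1.le, deriv_smoothTransition_eq_zero (Or.inl h1)]
    ring
  · have h1 : ((j : ℝ) + 1) * (L - x) - 1 < 0 := by nlinarith
    rw [Real.smoothTransition.zero_of_nonpos h1.le, deriv_smoothTransition_eq_zero (Or.inl h1)]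
    ring

theorem eventually_edgeCutoff {L x : ℝ} (hx : x ∈ Set.Ioo (-L) L) :
    ∀ᶠ j : ℕ in atTop, edgeCutoff L j x = 1 ∧ edgeCutoffDeriv L j x = 0 := by
  have hlim : ∀ c : ℝ, 0 < c → ∀ᶠ j : ℕ in atTop, 1 < ((j : ℝ) + 1) * c - 1 := by
    intro c hc
    have := (tendsto_atTop_add_const_right _ (1 : ℝ)
      (tendsto_natCast_atTop_atTop (R := ℝ))).atTop_mul_const hc
    filter_upwards [this.eventually_gt_atTop 2] with j hj
    linarith
  filter_upwards [hlim (L - x) (by linarith [hx.2]), hlim (L + x) (by linarith [hx.1])] with j h1 h2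
  rw [edgeCutoff, edgeCutoffDeriv, Real.smoothTransition.one_of_one_le h1.le,
    Real.smoothTransition.one_of_one_le h2.le, deriv_smoothTransition_eq_zero (Or.inr h1),
    deriv_smoothTransition_eq_zero (Or.inr h2)]
  simp

/-- The derivative of the cutoff is of order `j + 1`, but lives where the distance `y` to an end
point satisfies `(j + 1) y ≤ 2`. There the mode is at most its wave number times `y`, and the two
effects cancel uniformly in `j`. -/
theorem exists_abs_edgeCutoffDeriv_mul_le {L : ℝ} (hL : 0 < L) (m : ℕ) :
    ∃ C : ℝ, 0 ≤ C ∧ ∀ j x, |edgeCutoffDeriv L j x * sinMode L m x| ≤ C := by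
  obtain ⟨C, hC0, hC⟩ := exists_abs_deriv_smoothTransition_le
  have hw := waveNumber_nonneg hL m
  have key : ∀ (j : ℕ) (y s : ℝ), |s| ≤ waveNumber L m * |y| →
      |(j + 1) * deriv Real.smoothTransition ((j + 1) * y - 1)| * |s| ≤
        C * (waveNumber L m * 2) := by
    intro j y s hs
    have hj : (0 : ℝ) < (j : ℝ) + 1 := by positivity
    by_cases ht : ((j : ℝ) + 1) * y - 1 < 0 ∨ 1 < ((j : ℝ) + 1) * y - 1
    · rw [deriv_smoothTransition_eq_zero ht, mul_zero, abs_zero, zero_mul]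
      positivity
    · rw [not_or, not_lt, not_lt] at ht
      have hy : 0 ≤ y := by
        by_contra hn
        nlinarith [ht.1]
      rw [abs_of_nonneg hy] at hs
      rw [abs_mul, abs_of_pos hj]
      calc ((j : ℝ) + 1) * |deriv Real.smoothTransition (((j : ℝ) + 1) * y - 1)| * |s|
          ≤ ((j : ℝ) + 1) * C * (waveNumber L m * y) := by
            gcongr
            exact hC _
        _ = C * (waveNumber L m * (((j : ℝ) + 1) * y)) := by ring
        _ ≤ C * (waveNumber L m * 2) := by
            gcongr
            linarith [ht.2]
  refine ⟨2 * (C * (waveNumber L m * 2)), by positivity, fun j x => ?_⟩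
  have h1 := key j (L - x) _ (abs_sinMode_le_right hL m x)
  have h2 := key j (L + x) _ (abs_sinMode_le_left hL m x)
  have hS : ∀ t, |Real.smoothTransition t| ≤ 1 := fun t => by
    rw [abs_of_nonneg (Real.smoothTransition.nonneg _)]
    exact Real.smoothTransition.le_one _
  rw [edgeCutoffDeriv, add_mul]
  refine (abs_add_le _ _).trans ?_
  rw [two_mul]
  refine add_le_add ?_ ?_
  · rw [abs_mul, abs_mul, abs_neg, mul_right_comm]
    refine (mul_le_of_le_one_right (by positivity) (hS _)).trans h1
  · rw [mul_assoc, abs_mul, abs_mul]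
    refine (mul_le_of_le_one_left (by positivity) (hS _)).trans h2

/-- Dirichlet modes cut off near the boundary. -/
def cutMode (L : ℝ) (m j : ℕ) (x : ℝ) : ℝ := edgeCutoff L j x * sinMode L m x

/-- The derivative of `cutMode`. -/
def cutModeDeriv (L : ℝ) (m j : ℕ) (x : ℝ) : ℝ :=
  edgeCutoffDeriv L j x * sinMode L m x + edgeCutoff L j x * cosMode L m x

theorem hasDerivAt_cutMode (L : ℝ) (m j : ℕ) (x : ℝ) :
    HasDerivAt (cutMode L m j) (cutModeDeriv L m j x) x :=
  (hasDerivAt_edgeCutoff L j x).mul (hasDerivAt_sinMode L m x)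

theorem contDiff_cutMode (L : ℝ) (m j : ℕ) : ContDiff ℝ (⊤ : ℕ∞) (cutMode L m j) :=
  (contDiff_edgeCutoff L j).mul (contDiff_sinMode L m)

theorem abs_cutMode_le_one (L : ℝ) (m j : ℕ) (x : ℝ) : |cutMode L m j x| ≤ 1 := by
  rw [cutMode, abs_mul]
  exact mul_le_one₀ (abs_edgeCutoff_le_one L j x) (abs_nonneg _) (abs_sinMode_le_one L m x)

theorem exists_abs_cutModeDeriv_le {L : ℝ} (hL : 0 < L) (m : ℕ) :
    ∃ C : ℝ, 1 ≤ C ∧ ∀ j x, |cutModeDeriv L m j x| ≤ C := by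
  obtain ⟨C, hC0, hC⟩ := exists_abs_edgeCutoffDeriv_mul_le hL m
  have hw := waveNumber_nonneg hL m
  refine ⟨C + waveNumber L m + 1, by linarith, fun j x => ?_⟩
  rw [cutModeDeriv]
  refine (abs_add_le _ _).trans ?_
  have h2 : |edgeCutoff L j x * cosMode L m x| ≤ waveNumber L m := by
    rw [abs_mul]
    exact (mul_le_of_le_one_left (abs_nonneg _) (abs_edgeCutoff_le_one L j x)).trans
      (abs_cosMode_le hL m x)
  linarith [hC j x]

theorem cutMode_support {L : ℝ} {m j : ℕ} {x : ℝ} (h : cutMode L m j x ≠ 0) :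
    x ∈ Set.Icc (-L + 1 / ((j : ℝ) + 1)) (L - 1 / ((j : ℝ) + 1)) :=
  edgeCutoff_support (left_ne_zero_of_mul h)

theorem cutMode_support' {L : ℝ} {m j : ℕ} {x : ℝ} (h : cutMode L m j x ≠ 0) :
    x ∈ Set.Ioo (-L) L := by
  have h1 := cutMode_support h
  have : 0 < 1 / ((j : ℝ) + 1) := by positivity
  exact ⟨by linarith [h1.1], by linarith [h1.2]⟩

theorem cutModeDeriv_support {L : ℝ} {m j : ℕ} {x : ℝ} (h : cutModeDeriv L m j x ≠ 0) :
    x ∈ Set.Icc (-L) L := by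
  by_contra hx
  refine h ?_
  have h1 : edgeCutoffDeriv L j x = 0 := by
    by_contra h0
    exact hx (edgeCutoffDeriv_support h0)
  have h2 : edgeCutoff L j x = 0 := by
    by_contra h0
    have h3 := edgeCutoff_support h0
    have : 0 < 1 / ((j : ℝ) + 1) := by positivity
    exact hx ⟨by linarith [h3.1], by linarith [h3.2]⟩
  rw [cutModeDeriv, h1, h2]
  ring

theorem tendsto_cutMode {L : ℝ} (m : ℕ) {x : ℝ} (hx : x ∈ Set.Ioo (-L) L) :
    Tendsto (fun j => cutMode L m j x) atTop (𝓝 (sinMode L m x)) := by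
  refine tendsto_const_nhds.congr' ?_
  filter_upwards [eventually_edgeCutoff hx] with j hj
  rw [cutMode, hj.1, one_mul]

theorem tendsto_cutModeDeriv {L : ℝ} (m : ℕ) {x : ℝ} (hx : x ∈ Set.Ioo (-L) L) :
    Tendsto (fun j => cutModeDeriv L m j x) atTop (𝓝 (cosMode L m x)) := by
  refine tendsto_const_nhds.congr' ?_
  filter_upwards [eventually_edgeCutoff hx] with j hj
  rw [cutModeDeriv, hj.1, hj.2, one_mul, zero_mul, zero_add]

/-! ### Continuous functions on the box as elements of `E_L` -/

theorem isCompact_cube (ν : ℕ) (a b : ℝ) : IsCompact {x : Space ν | ∀ i, x i ∈ Set.Icc a b} := by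
  have h : {x : Space ν | ∀ i, x i ∈ Set.Icc a b} =
      (WithLp.toLp 2) '' (Set.univ.pi fun _ : Fin ν => Set.Icc a b) := by
    ext x
    constructor
    · exact fun hx => ⟨WithLp.ofLp x, fun i _ => hx i, rfl⟩
    · rintro ⟨y, hy, rfl⟩ i
      exact hy i (Set.mem_univ i)
  rw [h]
  exact (isCompact_univ_pi fun _ => isCompact_Icc).image (PiLp.continuous_toLp 2 _)

theorem isCompact_box (ν : ℕ) (L : ℝ) : IsCompact (box ν L) := isCompact_cube ν (-L) L

theorem measurableSet_box (ν : ℕ) (L : ℝ) : MeasurableSet (box ν L) :=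
  (isCompact_box ν L).isClosed.measurableSet

theorem openBox_subset_box (ν : ℕ) (L : ℝ) : openBox ν L ⊆ box ν L :=
  fun _ hx i => ⟨(hx i).1.le, (hx i).2.le⟩

theorem ae_openBox_iff_box (ν : ℕ) (L : ℝ) : ∀ᵐ x : Space ν, x ∈ box ν L → x ∈ openBox ν L := by
  filter_upwards [measure_eq_zero_iff_ae_notMem.mp (box_diff_openBox_null ν L)] with x hx hb
  by_contra h
  exact hx ⟨hb, h⟩

theorem measureReal_box {L : ℝ} (hL : 0 ≤ L) : volume.real (box ν L) = (2 * L) ^ ν := by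
  have h : box ν L = WithLp.ofLp ⁻¹' (Set.Icc (fun _ : Fin ν => -L) fun _ => L) := by
    ext x
    simp [box, Pi.le_def, forall_and]
  rw [h, (PiLp.volume_preserving_ofLp (Fin ν)).measureReal_preimage
    measurableSet_Icc.nullMeasurableSet, Measure.real,
    Real.volume_Icc_pi_toReal (fun _ => by linarith)]
  simp [two_mul]

theorem memLp_of_bounded_box {L C : ℝ} {f : Space ν → ℂ} (hf : AEStronglyMeasurable f volume)
    (hb : ∀ x, ‖f x‖ ≤ C) (h0 : ∀ x, x ∉ box ν L → f x = 0) : MemLp f 2 volume := by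
  have h1 : MemLp ((box ν L).indicator fun _ => (C : ℝ)) 2 (volume : Measure (Space ν)) :=
    memLp_indicator_const 2 (measurableSet_box ν L) C
      (Or.inr (isCompact_box ν L).measure_lt_top.ne)
  refine h1.mono hf (Eventually.of_forall fun x => ?_)
  by_cases hx : x ∈ box ν L
  · rw [Set.indicator_of_mem hx]
    exact (hb x).trans (le_abs_self C)
  · rw [h0 x hx, norm_zero]
    exact norm_nonneg _

/-- A continuous function restricted to the open box. -/
def boxFun (L : ℝ) (F : C(Space ν, ℝ)) : Space ν → ℂ :=
  (openBox ν L).indicator fun x => (F x : ℂ)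

theorem memLp_boxFun (L : ℝ) (F : C(Space ν, ℝ)) : MemLp (boxFun L F) 2 volume := by
  obtain ⟨C, hC⟩ := (isCompact_box ν L).exists_bound_of_continuousOn F.continuous.continuousOn
  refine memLp_of_bounded_box (L := L) (C := max C 0) ?_ (fun x => ?_) fun x hx => ?_
  · exact ((Complex.continuous_ofReal.comp F.continuous).aestronglyMeasurable).indicator
      (isOpen_openBox ν L).measurableSet
  · by_cases hx : x ∈ openBox ν L
    · rw [boxFun, Set.indicator_of_mem hx, Complex.norm_real]
      exact (hC x (openBox_subset_box ν L hx)).trans (le_max_left _ _)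
    · rw [boxFun, Set.indicator_of_notMem hx, norm_zero]
      exact le_max_right _ _
  · exact Set.indicator_of_notMem (fun h => hx (openBox_subset_box ν L h)) _

/-- A continuous function on the box, extended by zero, as an element of `E_L`. -/
def boxLp (L : ℝ) (F : C(Space ν, ℝ)) : OneParticle ν := (memLp_boxFun L F).toLp

theorem coeFn_boxLp (L : ℝ) (F : C(Space ν, ℝ)) : boxLp L F =ᵐ[volume] boxFun L F :=
  (memLp_boxFun L F).coeFn_toLp

theorem boxLp_mem_localSpace (L : ℝ) (F : C(Space ν, ℝ)) : boxLp L F ∈ localSpace ν L := by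
  change ∀ᵐ x, x ∉ box ν L → boxLp L F x = 0
  filter_upwards [coeFn_boxLp L F] with x hx hb
  rw [hx]
  exact Set.indicator_of_notMem (fun h => hb (openBox_subset_box ν L h)) _

theorem boxLp_const_mul (L c : ℝ) (F : C(Space ν, ℝ)) :
    boxLp L (c • F) = (c : ℂ) • boxLp L F := by
  refine Lp.ext ?_
  filter_upwards [coeFn_boxLp L F, coeFn_boxLp L (c • F), Lp.coeFn_smul (c : ℂ) (boxLp L F)]
    with x h1 h2 h3
  rw [h2, h3, Pi.smul_apply, h1, boxFun, boxFun]
  by_cases hx : x ∈ openBox ν L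
  · rw [Set.indicator_of_mem hx, Set.indicator_of_mem hx]
    simp
  · rw [Set.indicator_of_notMem hx, Set.indicator_of_notMem hx, smul_zero]

theorem inner_boxLp (L : ℝ) (F : C(Space ν, ℝ)) (w : OneParticle ν) :
    ⟪boxLp L F, w⟫ = ∫ x in openBox ν L, (F x : ℂ) * w x := by
  rw [L2.inner_def, ← integral_indicator (isOpen_openBox ν L).measurableSet]
  refine integral_congr_ae ?_
  filter_upwards [coeFn_boxLp L F] with x hx
  rw [hx, boxFun, RCLike.inner_apply]
  by_cases h : x ∈ openBox ν L
  · rw [Set.indicator_of_mem h, Set.indicator_of_mem h, mul_comm]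
    simp
  · rw [Set.indicator_of_notMem h, Set.indicator_of_notMem h]
    simp

theorem inner_boxLp_boxLp (L : ℝ) (F G : C(Space ν, ℝ)) :
    ⟪boxLp L F, boxLp L G⟫ = ((∫ x in openBox ν L, F x * G x : ℝ) : ℂ) := by
  rw [inner_boxLp, ← integral_complex_ofReal]
  refine setIntegral_congr_ae (isOpen_openBox ν L).measurableSet ?_
  filter_upwards [coeFn_boxLp L G] with x hx h
  rw [hx, boxFun, Set.indicator_of_mem h, Complex.ofReal_mul]

theorem isTest_lineDeriv {U : Set (Space ν)} {φ : 𝓢(Space ν, ℂ)} (h : IsTest U φ) (v : Space ν) :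
    IsTest U (∂_{v} φ) :=
  ⟨h.1.mono' ((subset_tsupport _).trans (SchwartzMap.tsupport_lineDerivOp_subset v φ)),
    (SchwartzMap.tsupport_lineDerivOp_subset v φ).trans h.2⟩

theorem inner_test_boxLp {L : ℝ} {φ : 𝓢(Space ν, ℂ)} (h : IsTest (openBox ν L) φ)
    (F : C(Space ν, ℝ)) :
    ⟪ofSchwartz φ, boxLp L F⟫ = ∫ x, conjMul (φ x) (F x : ℂ) := by
  rw [inner_ofSchwartz]
  refine integral_congr_ae ?_
  filter_upwards [coeFn_boxLp L F] with x hx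
  rw [hx, boxFun]
  by_cases hb : x ∈ openBox ν L
  · rw [Set.indicator_of_mem hb]
    rfl
  · have : φ x = 0 := image_eq_zero_of_notMem_tsupport fun hx' => hb (h.2 hx')
    rw [this]
    simp

/-- Integration by parts without boundary terms: the test function has compact support in the open
box, so the jump of the extension by zero is not seen. -/
theorem inner_lineDeriv_boxLp {L : ℝ} {φ : 𝓢(Space ν, ℂ)} (h : IsTest (openBox ν L) φ)
    {F F' : C(Space ν, ℝ)} {v : Space ν} (hF : ∀ x, HasLineDerivAt ℝ F (F' x) x v) :
    ⟪ofSchwartz (∂_{v} φ), boxLp L F⟫ = -⟪ofSchwartz φ, boxLp L F'⟫ := by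
  rw [inner_test_boxLp h, inner_test_boxLp (isTest_lineDeriv h v), eq_neg_iff_add_eq_zero, add_comm,
    ← eq_neg_iff_add_eq_zero]
  have hint : ∀ (ψ : 𝓢(Space ν, ℂ)) (G : C(Space ν, ℝ)), IsTest (openBox ν L) ψ →
      Integrable fun x => conjMul (ψ x) (G x : ℂ) := by
    intro ψ G hψ
    refine Continuous.integrable_of_hasCompactSupport ?_ ?_
    · exact (conjMul.continuous.comp ψ.continuous).clm_apply
        (Complex.continuous_ofReal.comp G.continuous)
    · refine hψ.1.mono fun x hx => ?_
      rw [Function.mem_support] at hx ⊢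
      contrapose! hx
      rw [hx]
      simp
  refine integral_bilinear_hasLineDerivAt_right_eq_neg_left_of_integrable (v := v)
    (hint _ _ (isTest_lineDeriv h v)) (hint _ _ h) (hint _ _ h) (fun x _ => ?_) (fun x _ => ?_)
  · rw [SchwartzMap.lineDerivOp_apply]
    exact (φ.differentiableAt.lineDifferentiableAt).hasLineDerivAt
  · exact (hF x).ofReal_comp

/-! ### Dirichlet eigenfunctions of the box -/

theorem hasLineDerivAt_prod {g : Fin ν → ℝ → ℝ} {d : ℝ} {i : Fin ν} {x : Space ν}
    (h : HasDerivAt (g i) d (x i)) :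
    HasLineDerivAt ℝ (fun x : Space ν => ∏ l, g l (x l))
      (d * ∏ l ∈ Finset.univ.erase i, g l (x l)) x (EuclideanSpace.single i (1 : ℝ)) := by
  have e : (fun t : ℝ => ∏ l, g l ((x + t • EuclideanSpace.single i (1 : ℝ)) l)) =
      fun t => g i (x i + t) * ∏ l ∈ Finset.univ.erase i, g l (x l) := by
    funext t
    rw [← Finset.mul_prod_erase _ _ (Finset.mem_univ i)]
    congr 1
    · simp
    · refine Finset.prod_congr rfl fun l hl => ?_
      simp [Finset.ne_of_mem_erase hl]
  rw [HasLineDerivAt, e]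
  refine HasDerivAt.mul_const ?_ _
  have h' : HasDerivAt (g i) d (x i + 0) := by rwa [add_zero]
  exact HasDerivAt.comp_const_add (x i) 0 h'

/-- The eigenfunctions of the Dirichlet Laplacian (not normalised). -/
def boxMode (L : ℝ) (n : Fin ν → ℕ) : C(Space ν, ℝ) :=
  ⟨fun x => ∏ l, sinMode L (n l) (x l),
    continuous_finsetProd _ fun l _ => (continuous_sinMode L (n l)).comp (by fun_prop)⟩

/-- The partial derivatives of `boxMode`. -/
def boxModeGrad (L : ℝ) (n : Fin ν → ℕ) (i : Fin ν) : C(Space ν, ℝ) :=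
  ⟨fun x => cosMode L (n i) (x i) * ∏ l ∈ Finset.univ.erase i, sinMode L (n l) (x l),
    ((continuous_cosMode L (n i)).comp (by fun_prop)).mul
      (continuous_finsetProd _ fun l _ => (continuous_sinMode L (n l)).comp (by fun_prop))⟩

theorem hasLineDerivAt_boxMode (L : ℝ) (n : Fin ν → ℕ) (i : Fin ν) (x : Space ν) :
    HasLineDerivAt ℝ (boxMode L n) (boxModeGrad L n i x) x (EuclideanSpace.single i (1 : ℝ)) :=
  hasLineDerivAt_prod (g := fun l => sinMode L (n l)) (hasDerivAt_sinMode L (n i) (x i))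

/-- The partial derivative is again a product of one-variable functions, with the cosine in place of
the `i`-th sine, so the product rule applies a second time. -/
theorem hasLineDerivAt_boxModeGrad (L : ℝ) (n : Fin ν → ℕ) (i : Fin ν) (x : Space ν) :
    HasLineDerivAt ℝ (boxModeGrad L n i) ((-(waveNumber L (n i) ^ 2) • boxMode L n) x) x
      (EuclideanSpace.single i (1 : ℝ)) := by
  have h := hasLineDerivAt_prod (g := Function.update (fun l => sinMode L (n l)) i
    (cosMode L (n i))) (i := i) (x := x) (d := -(waveNumber L (n i) ^ 2) * sinMode L (n i) (x i))
    (by rw [Function.update_self]; exact hasDerivAt_cosMode L (n i) (x i))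
  have e : ∀ x : Space ν, ∏ l ∈ Finset.univ.erase i, Function.update (fun l => sinMode L (n l)) i
      (cosMode L (n i)) l (x l) = ∏ l ∈ Finset.univ.erase i, sinMode L (n l) (x l) := fun x =>
    Finset.prod_congr rfl fun l hl => by rw [Function.update_of_ne (Finset.ne_of_mem_erase hl)]
  have e2 : (fun x : Space ν => ∏ l, Function.update (fun l => sinMode L (n l)) i
      (cosMode L (n i)) l (x l)) = boxModeGrad L n i := by
    funext x
    rw [← Finset.mul_prod_erase _ _ (Finset.mem_univ i), e, Function.update_self]
    rfl
  rw [e2, e, mul_assoc, Finset.mul_prod_erase Finset.univ (fun l => sinMode L (n l) (x l))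
    (Finset.mem_univ i)] at h
  exact h

/-- Modes are indexed from zero, while the quantum numbers of the energies start at one. -/
theorem dirichletEnergy_succ (L : ℝ) (n : Fin ν → ℕ) :
    dirichletEnergy L (fun i => n i + 1) = 1 / 2 * ∑ i, waveNumber L (n i) ^ 2 := by
  unfold dirichletEnergy waveNumber
  congr 1
  refine Finset.sum_congr rfl fun i _ => ?_
  push_cast
  ring

theorem isDistribKinetic_boxMode (L : ℝ) (n : Fin ν → ℕ) :
    IsDistribKinetic (openBox ν L) (boxLp L (boxMode L n))
      ((dirichletEnergy L (fun i => n i + 1) : ℂ) • boxLp L (boxMode L n)) := by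
  intro φ hφ
  rw [kinetic_eq_sum, ofSchwartz_smul, ofSchwartz_sum, inner_smul_left, sum_inner, inner_smul_right]
  have h : ∀ i, ⟪ofSchwartz (∂_{EuclideanSpace.single i (1 : ℝ)}
      (∂_{EuclideanSpace.single i (1 : ℝ)} φ)), boxLp L (boxMode L n)⟫ =
      -(waveNumber L (n i) ^ 2 : ℝ) * ⟪ofSchwartz φ, boxLp L (boxMode L n)⟫ := by
    intro i
    rw [inner_lineDeriv_boxLp (isTest_lineDeriv hφ _) (hasLineDerivAt_boxMode L n i),
      inner_lineDeriv_boxLp hφ (hasLineDerivAt_boxModeGrad L n i), neg_neg, boxLp_const_mul,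
      inner_smul_right]
    push_cast
    rfl
  simp only [h]
  rw [← Finset.sum_mul, Finset.sum_neg_distrib, dirichletEnergy_succ]
  simp only [map_neg, map_div₀, map_one, map_ofNat]
  push_cast
  ring

/-- The approximants multiply each sine by an edge cutoff. Their values and first derivatives are
bounded uniformly in `j`, are supported in the box and converge pointwise inside it, so dominated
convergence gives both limits. -/
theorem hasDirichletGrad_boxMode {L : ℝ} (hL : 0 < L) (n : Fin ν → ℕ) :
    HasDirichletGrad L (boxLp L (boxMode L n)) fun i => boxLp L (boxModeGrad L n i) := by
  let g : ℕ → Space ν → ℂ := fun j x => ((∏ l, cutMode L (n l) j (x l) : ℝ) : ℂ)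
  have hsupp : ∀ j, Function.support (g j) ⊆
      {x | ∀ l, x l ∈ Set.Icc (-L + 1 / ((j : ℝ) + 1)) (L - 1 / ((j : ℝ) + 1))} := by
    intro j x hx l
    have hx' : ∏ l, cutMode L (n l) j (x l) ≠ 0 := fun h0 => hx (by simp only [g, h0]; simp)
    exact cutMode_support (Finset.prod_ne_zero_iff.mp hx' l (Finset.mem_univ l))
  have hts : ∀ j, tsupport (g j) ⊆
      {x | ∀ l, x l ∈ Set.Icc (-L + 1 / ((j : ℝ) + 1)) (L - 1 / ((j : ℝ) + 1))} := fun j =>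
    closure_minimal (hsupp j) (isCompact_cube _ _ _).isClosed
  have hc : ∀ j, HasCompactSupport (g j) := fun j =>
    (isCompact_cube _ _ _).of_isClosed_subset (isClosed_tsupport _) (hts j)
  have hs : ∀ j, ContDiff ℝ (⊤ : ℕ∞) (g j) := fun j =>
by
    have h : ContDiff ℝ (⊤ : ℕ∞) fun x : Space ν => ∏ l, cutMode L (n l) j (x l) :=
      contDiff_prod fun l _ => (contDiff_cutMode L (n l) j).comp (f := fun x : Space ν => x l)
        (by fun_prop)
    exact Complex.ofRealCLM.contDiff.comp h
  have hd : ∀ j i x, (∂_{EuclideanSpace.single i (1 : ℝ)} ((hc j).toSchwartzMap (hs j))) x =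
      ((cutModeDeriv L (n i) j (x i) * ∏ l ∈ Finset.univ.erase i, cutMode L (n l) j (x l) : ℝ) :
        ℂ) := by
    intro j i x
    rw [SchwartzMap.lineDerivOp_apply]
    refine HasLineDerivAt.lineDeriv ?_
    exact (hasLineDerivAt_prod (g := fun l => cutMode L (n l) j)
      (hasDerivAt_cutMode L (n i) j (x i))).ofReal_comp
  have habs : ∀ (j : ℕ) (s : Finset (Fin ν)) (x : Space ν),
      |∏ l ∈ s, cutMode L (n l) j (x l)| ≤ 1 := fun j s x => by
    rw [Finset.abs_prod]
    exact Finset.prod_le_one (fun _ _ => abs_nonneg _) fun l _ => abs_cutMode_le_one _ _ _ _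
  have hbox : ∀ c : ℝ, MemLp ((box ν L).indicator fun _ => c) 2 (volume : Measure (Space ν)) :=
    fun c => memLp_indicator_const 2 (measurableSet_box ν L) c
      (Or.inr (isCompact_box ν L).measure_lt_top.ne)
  have hlim : ∀ (x : Space ν) (hx : x ∈ openBox ν L) (s : Finset (Fin ν)),
      Tendsto (fun j => ∏ l ∈ s, cutMode L (n l) j (x l)) atTop
        (𝓝 (∏ l ∈ s, sinMode L (n l) (x l))) := fun x hx s =>
    tendsto_finsetProd _ fun l _ => tendsto_cutMode (n l) (hx l)
  have hnot : ∀ x : Space ν, x ∉ box ν L → ∃ l, x l ∉ Set.Icc (-L) L := fun x hx => by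
    simpa [box] using hx
  have hIcc : ∀ {y : ℝ}, y ∈ Set.Ioo (-L) L → y ∈ Set.Icc (-L) L := fun h => ⟨h.1.le, h.2.le⟩
  have hzero : ∀ j (x : Space ν), x ∉ box ν L → ∏ l, cutMode L (n l) j (x l) = 0 := by
    intro j x hx
    obtain ⟨l, hl⟩ := hnot x hx
    refine Finset.prod_eq_zero (Finset.mem_univ l) ?_
    by_contra h0
    exact hl (hIcc (cutMode_support' h0))
  have hzero' : ∀ j i (x : Space ν), x ∉ box ν L →
      cutModeDeriv L (n i) j (x i) * ∏ l ∈ Finset.univ.erase i, cutMode L (n l) j (x l) = 0 := by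
    intro j i x hx
    obtain ⟨l, hl⟩ := hnot x hx
    by_cases hli : l = i
    · subst hli
      rw [show cutModeDeriv L (n l) j (x l) = 0 by
        by_contra h0
        exact hl (cutModeDeriv_support h0), zero_mul]
    · rw [Finset.prod_eq_zero (Finset.mem_erase.mpr ⟨hli, Finset.mem_univ l⟩), mul_zero]
      by_contra h0
      exact hl (hIcc (cutMode_support' h0))
  -- The support keeps the distance `1 / (j + 1)` from the boundary.
  refine ⟨fun j => (hc j).toSchwartzMap (hs j), fun j => ⟨hc j, (hts j).trans fun x hx l => ?_⟩,
    ?_, fun i => ?_⟩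
  · have : 0 < 1 / ((j : ℝ) + 1) := by positivity
    exact ⟨by linarith [(hx l).1], by linarith [(hx l).2]⟩
  · refine tendsto_toLp_of_dominated (fun j => ((hc j).toSchwartzMap (hs j)).memLp 2 volume)
      (memLp_boxFun L (boxMode L n)) _ (hbox 1) (fun j => Eventually.of_forall fun x => ?_) ?_
    · change ‖((∏ l, cutMode L (n l) j (x l) : ℝ) : ℂ)‖ ≤ _
      rw [Complex.norm_real]
      by_cases hx : x ∈ box ν L
      · rw [Set.indicator_of_mem hx]
        exact habs j _ x
      · rw [Set.indicator_of_notMem hx, hzero j x hx, norm_zero]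
    · filter_upwards [ae_openBox_iff_box ν L] with x hx
      change Tendsto (fun j => ((∏ l, cutMode L (n l) j (x l) : ℝ) : ℂ)) atTop _
      by_cases hb : x ∈ box ν L
      · rw [boxFun, Set.indicator_of_mem (hx hb)]
        exact (Complex.continuous_ofReal.tendsto _).comp (hlim x (hx hb) _)
      · rw [boxFun, Set.indicator_of_notMem fun h => hb (openBox_subset_box ν L h)]
        simp only [hzero _ x hb, Complex.ofReal_zero]
        exact tendsto_const_nhds
  · obtain ⟨C, hC1, hC⟩ := exists_abs_cutModeDeriv_le hL (n i)
    refine tendsto_toLp_of_dominated (fun j => (∂_{EuclideanSpace.single i (1 : ℝ)}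
      ((hc j).toSchwartzMap (hs j))).memLp 2 volume)
      (memLp_boxFun L (boxModeGrad L n i)) _ (hbox C) (fun j => Eventually.of_forall fun x => ?_) ?_
    · rw [hd, Complex.norm_real]
      by_cases hx : x ∈ box ν L
      · rw [Set.indicator_of_mem hx, Real.norm_eq_abs, abs_mul]
        exact (mul_le_of_le_one_right (abs_nonneg _) (habs j _ x)).trans (hC j _)
      · rw [Set.indicator_of_notMem hx, hzero' j i x hx, norm_zero]
    · filter_upwards [ae_openBox_iff_box ν L] with x hx
      simp only [hd]
      by_cases hb : x ∈ box ν L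
      · rw [boxFun, Set.indicator_of_mem (hx hb)]
        exact (Complex.continuous_ofReal.tendsto _).comp
          ((tendsto_cutModeDeriv (n i) (hx hb i)).mul (hlim x (hx hb) _))
      · rw [boxFun, Set.indicator_of_notMem fun h => hb (openBox_subset_box ν L h)]
        simp only [hzero' _ i x hb, Complex.ofReal_zero]
        exact tendsto_const_nhds

/-- The functions `boxMode` are eigenfunctions of the Dirichlet Hamiltonian. -/
theorem boxMode_mem_dirichletGraph {L : ℝ} (hL : 0 < L) (n : Fin ν → ℕ) :
    (boxLp L (boxMode L n), (dirichletEnergy L (fun i => n i + 1) : ℂ) • boxLp L (boxMode L n)) ∈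
      dirichletGraph ν L :=
  ⟨isH10_iff.mpr ⟨_, hasDirichletGrad_boxMode hL n⟩,
    (localSpace ν L).smul_mem _ (boxLp_mem_localSpace L _), isDistribKinetic_boxMode L n⟩

/-! ### Orthogonality of the eigenfunctions -/

theorem setIntegral_openBox_prod (L : ℝ) (f : Fin ν → ℝ → ℝ) :
    ∫ x in openBox ν L, ∏ l, f l (x l) = ∏ l, ∫ t in Set.Ioo (-L) L, f l t := by
  rw [← integral_indicator (isOpen_openBox ν L).measurableSet]
  have h : (openBox ν L).indicator (fun x => ∏ l, f l (x l)) = fun x : Space ν =>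
      (fun y : Fin ν → ℝ => ∏ l, (Set.Ioo (-L) L).indicator (f l) (y l)) (WithLp.ofLp x) := by
    funext x
    by_cases hx : x ∈ openBox ν L
    · rw [Set.indicator_of_mem hx]
      exact Finset.prod_congr rfl fun l _ => (Set.indicator_of_mem (hx l) _).symm
    · rw [Set.indicator_of_notMem hx]
      obtain ⟨l, hl⟩ : ∃ l, x l ∉ Set.Ioo (-L) L := by
        by_contra hn
        push Not at hn
        exact hx hn
      exact (Finset.prod_eq_zero (Finset.mem_univ l) (Set.indicator_of_notMem hl _)).symm
  rw [h, (PiLp.volume_preserving_ofLp (Fin ν)).integral_comp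
    (MeasurableEquiv.toLp 2 (Fin ν → ℝ)).symm.measurableEmbedding,
    integral_fintype_prod_volume_eq_prod]
  exact Finset.prod_congr rfl fun l _ => integral_indicator measurableSet_Ioo

/-- The primitive is a sine that vanishes at both end points, as its argument there is zero and `k
π`. -/
theorem integral_cos_mode {L : ℝ} (hL : 0 < L) {k : ℤ} (hk : k ≠ 0) :
    ∫ t in (-L)..L, Real.cos (k * (Real.pi / (2 * L)) * (t + L)) = 0 := by
  have hc : (k : ℝ) * (Real.pi / (2 * L)) ≠ 0 := by
    have := Real.pi_pos
    have : (k : ℝ) ≠ 0 := by exact_mod_cast hk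
    positivity
  have hd : ∀ t ∈ Set.uIcc (-L) L, HasDerivAt
      (fun t => Real.sin (k * (Real.pi / (2 * L)) * (t + L)) / (k * (Real.pi / (2 * L))))
      (Real.cos (k * (Real.pi / (2 * L)) * (t + L))) t := by
    intro t _
    have h : HasDerivAt (fun t => (k : ℝ) * (Real.pi / (2 * L)) * (t + L))
        (k * (Real.pi / (2 * L))) t := by
      simpa using ((hasDerivAt_id t).add_const L).const_mul ((k : ℝ) * (Real.pi / (2 * L)))
    refine (h.sin.div_const _).congr_deriv ?_
    field_simp
  rw [intervalIntegral.integral_eq_sub_of_hasDerivAt hd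
    (Continuous.intervalIntegrable (by fun_prop) _ _)]
  have e : (k : ℝ) * (Real.pi / (2 * L)) * (L + L) = k * Real.pi := by
    field_simp
    ring
  rw [e, Real.sin_int_mul_pi]
  simp

theorem integral_sinMode_mul {L : ℝ} (hL : 0 < L) (m n : ℕ) :
    ∫ t in Set.Ioo (-L) L, sinMode L m t * sinMode L n t = if m = n then L else 0 := by
  rw [← integral_Ioc_eq_integral_Ioo, ← intervalIntegral.integral_of_le (by linarith)]
  -- Product to sum. The frequencies are `m - n` and `m + n + 2`, owing to the index shift, and the
  -- second is never zero.
  have h : ∀ t, sinMode L m t * sinMode L n t =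
      1 / 2 * Real.cos (((m : ℤ) - n : ℤ) * (Real.pi / (2 * L)) * (t + L)) -
        1 / 2 * Real.cos (((m : ℤ) + n + 2 : ℤ) * (Real.pi / (2 * L)) * (t + L)) := by
    intro t
    have e1 : (((m : ℤ) - n : ℤ) : ℝ) * (Real.pi / (2 * L)) * (t + L) =
        waveNumber L m * (t + L) - waveNumber L n * (t + L) := by
      unfold waveNumber
      push_cast
      ring
    have e2 : (((m : ℤ) + n + 2 : ℤ) : ℝ) * (Real.pi / (2 * L)) * (t + L) =
        waveNumber L m * (t + L) + waveNumber L n * (t + L) := by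
      unfold waveNumber
      push_cast
      ring
    rw [e1, e2, Real.cos_sub, Real.cos_add, sinMode, sinMode]
    ring
  simp only [h]
  rw [intervalIntegral.integral_sub (Continuous.intervalIntegrable (by fun_prop) _ _)
    (Continuous.intervalIntegrable (by fun_prop) _ _), intervalIntegral.integral_const_mul,
    intervalIntegral.integral_const_mul, integral_cos_mode hL (k := (m : ℤ) + n + 2) (by positivity)]
  split_ifs with hmn
  · subst hmn
    simp
    ring
  · rw [integral_cos_mode hL (sub_ne_zero.mpr (by exact_mod_cast hmn))]
    simp

theorem inner_boxMode {L : ℝ} (hL : 0 < L) (m n : Fin ν → ℕ) :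
    ⟪boxLp L (boxMode L m), boxLp L (boxMode L n)⟫ = if m = n then (L : ℂ) ^ ν else 0 := by
  rw [inner_boxLp_boxLp]
  have h : ∀ x : Space ν, boxMode L m x * boxMode L n x =
      ∏ l, (sinMode L (m l) (x l) * sinMode L (n l) (x l)) := fun x => by
    rw [Finset.prod_mul_distrib]
    rfl
  simp only [h]
  rw [setIntegral_openBox_prod L fun l t => sinMode L (m l) t * sinMode L (n l) t]
  simp only [integral_sinMode_mul hL]
  split_ifs with hmn
  · subst hmn
    simp
  · obtain ⟨l, hl⟩ := Function.ne_iff.mp hmn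
    rw [Finset.prod_eq_zero (Finset.mem_univ l) (if_neg hl), Complex.ofReal_zero]

/-! ### Completeness of the eigenfunctions -/

theorem boxLp_add (L : ℝ) (F G : C(Space ν, ℝ)) : boxLp L (F + G) = boxLp L F + boxLp L G := by
  refine Lp.ext ?_
  filter_upwards [coeFn_boxLp L F, coeFn_boxLp L G, coeFn_boxLp L (F + G),
    Lp.coeFn_add (boxLp L F) (boxLp L G)] with x h1 h2 h3 h4
  rw [h3, h4, Pi.add_apply, h1, h2, boxFun, boxFun, boxFun]
  by_cases hx : x ∈ openBox ν L
  · simp [Set.indicator_of_mem hx]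
  · simp [Set.indicator_of_notMem hx]

theorem boxLp_neg (L : ℝ) (F : C(Space ν, ℝ)) : boxLp L (-F) = -boxLp L F := by
  have := boxLp_const_mul L (-1) F
  simpa using this

theorem norm_boxLp_le {L ε : ℝ} (hL : 0 ≤ L) (hε : 0 ≤ ε) {F : C(Space ν, ℝ)}
    (h : ∀ x ∈ openBox ν L, |F x| ≤ ε) : ‖boxLp L F‖ ≤ ε * √((2 * L) ^ ν) := by
  have h1 : ‖boxLp L F‖ ^ 2 ≤ ε ^ 2 * (2 * L) ^ ν := by
    rw [boxLp, norm_sq_toLp, ← measureReal_box hL, mul_comm, ← smul_eq_mul,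
      ← setIntegral_const, ← integral_indicator (measurableSet_box ν L)]
    refine integral_mono_of_nonneg (Eventually.of_forall fun x => by positivity)
      ((integrable_indicator_iff (measurableSet_box ν L)).mpr
        (integrableOn_const (isCompact_box ν L).measure_lt_top.ne)) ?_
    · refine Eventually.of_forall fun x => ?_
      by_cases hx : x ∈ openBox ν L
      · simp only [boxFun]
        rw [Set.indicator_of_mem hx, Set.indicator_of_mem (openBox_subset_box ν L hx),
          Complex.norm_real]
        exact pow_le_pow_left₀ (norm_nonneg _) (h x hx) 2
      · simp only [boxFun]
        rw [Set.indicator_of_notMem hx, norm_zero]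
        simpa using Set.indicator_nonneg (fun _ _ => sq_nonneg ε) x
  refine le_of_sq_le_sq ?_ (by positivity)
  rwa [mul_pow, Real.sq_sqrt (by positivity)]

/-- The functions `cos (π (x_i + L) / (2L))`, which separate the points of the box. -/
def cosCoord (L : ℝ) (i : Fin ν) : C(Space ν, ℝ) :=
  ⟨fun x => Real.cos (Real.pi / (2 * L) * (x i + L)), by fun_prop⟩

theorem cosCoord_injOn {L : ℝ} (hL : 0 < L) {x y : Space ν} (hx : x ∈ box ν L) (hy : y ∈ box ν L)
    (h : ∀ i, cosCoord L i x = cosCoord L i y) : x = y := by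
  ext i
  have hm : ∀ {z : Space ν}, z ∈ box ν L →
      Real.pi / (2 * L) * (z i + L) ∈ Set.Icc 0 Real.pi := by
    intro z hz
    have hp := Real.pi_pos
    have h1 := (hz i).1
    have h2 := (hz i).2
    refine ⟨mul_nonneg (by positivity) (by linarith), ?_⟩
    rw [div_mul_eq_mul_div, div_le_iff₀ (by positivity)]
    exact mul_le_mul_of_nonneg_left (by linarith) hp.le
  have := Real.injOn_cos (hm hx) (hm hy) (h i)
  have hp : Real.pi / (2 * L) ≠ 0 := by
    have := Real.pi_pos
    positivity
  have := mul_left_cancel₀ hp this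
  linarith

/-- Twice the product of the cosine with a sine mode is the sum of its two neighbours. The lower
neighbour of the lowest mode is `sin 0` and drops out. -/
theorem cosCoord_mul_boxMode (L : ℝ) (i : Fin ν) (n : Fin ν → ℕ) :
    cosCoord L i * boxMode L n = (1 / 2 : ℝ) • boxMode L (Function.update n i (n i + 1)) +
      (if n i = 0 then 0 else (1 / 2 : ℝ) • boxMode L (Function.update n i (n i - 1))) := by
  have hupd : ∀ (k : ℕ) (x : Space ν), boxMode L (Function.update n i k) x =
      sinMode L k (x i) * ∏ l ∈ Finset.univ.erase i, sinMode L (n l) (x l) := by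
    intro k x
    change ∏ l, sinMode L (Function.update n i k l) (x l) = _
    rw [← Finset.mul_prod_erase _ _ (Finset.mem_univ i), Function.update_self]
    congr 1
    exact Finset.prod_congr rfl fun l hl => by rw [Function.update_of_ne (Finset.ne_of_mem_erase hl)]
  have hn : ∀ x : Space ν, boxMode L n x =
      sinMode L (n i) (x i) * ∏ l ∈ Finset.univ.erase i, sinMode L (n l) (x l) := fun x => by
    rw [← hupd, Function.update_eq_self]
  have hc : ∀ x : Space ν, cosCoord L i x = Real.cos (Real.pi / (2 * L) * (x i + L)) :=
    fun _ => rfl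
  have hadd : ∀ t : ℝ, sinMode L (n i + 1) t =
      Real.sin (waveNumber L (n i) * (t + L)) * Real.cos (Real.pi / (2 * L) * (t + L)) +
      Real.cos (waveNumber L (n i) * (t + L)) * Real.sin (Real.pi / (2 * L) * (t + L)) := by
    intro t
    rw [← Real.sin_add, sinMode]
    congr 1
    unfold waveNumber
    push_cast
    ring
  have hsub : ∀ t : ℝ, (if n i = 0 then 0 else sinMode L (n i - 1) t) =
      Real.sin (waveNumber L (n i) * (t + L)) * Real.cos (Real.pi / (2 * L) * (t + L)) -
      Real.cos (waveNumber L (n i) * (t + L)) * Real.sin (Real.pi / (2 * L) * (t + L)) := by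
    intro t
    rw [← Real.sin_sub]
    split_ifs with h0
    · rw [h0, waveNumber]
      simp
    · obtain ⟨k, hk⟩ := Nat.exists_eq_succ_of_ne_zero h0
      rw [hk, sinMode]
      congr 1
      unfold waveNumber
      simp only [Nat.succ_eq_add_one, Nat.add_sub_cancel]
      push_cast
      ring
  ext x
  have h1 := hadd (x i)
  have h2 := hsub (x i)
  by_cases h0 : n i = 0
  · rw [if_pos h0] at h2 ⊢
    simp only [ContinuousMap.mul_apply, ContinuousMap.add_apply, ContinuousMap.smul_apply, hupd, hn,
      hc, smul_eq_mul, ContinuousMap.zero_apply]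
    rw [h1, ← sub_eq_zero, sinMode]
    linear_combination (-(1 / 2 : ℝ) * ∏ l ∈ Finset.univ.erase i, sinMode L (n l) (x l)) * h2
  · rw [if_neg h0] at h2 ⊢
    simp only [ContinuousMap.mul_apply, ContinuousMap.add_apply, ContinuousMap.smul_apply, hupd, hn,
      hc, smul_eq_mul]
    rw [h1, h2, sinMode]
    ring

theorem boxMode_zero_pos {L : ℝ} (hL : 0 < L) {x : Space ν} (hx : x ∈ openBox ν L) :
    0 < boxMode L 0 x := by
  change 0 < ∏ l, sinMode L 0 (x l)
  refine Finset.prod_pos fun l _ => Real.sin_pos_of_pos_of_lt_pi ?_ ?_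
  · have := Real.pi_pos
    have := (hx l).1
    simp only [waveNumber]
    exact mul_pos (by positivity) (by linarith)
  · have hp := Real.pi_pos
    have := (hx l).2
    simp only [waveNumber, CharP.cast_eq_zero, zero_add, one_mul]
    rw [div_mul_eq_mul_div, div_lt_iff₀ (by positivity)]
    exact mul_lt_mul_of_pos_left (by linarith) hp

/-- The annihilator of `w` among the continuous functions on the box. -/
def boxAnnihilator (L : ℝ) (w : OneParticle ν) : Submodule ℝ C(Space ν, ℝ) where
  carrier := {F | ⟪boxLp L F, w⟫ = 0}
  add_mem' {F G} hF hG := by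
    change ⟪boxLp L (F + G), w⟫ = 0
    rw [boxLp_add, inner_add_left, hF, hG, add_zero]
  zero_mem' := by
    have := boxLp_const_mul L 0 (0 : C(Space ν, ℝ))
    rw [zero_smul, Complex.ofReal_zero, zero_smul] at this
    change ⟪boxLp L 0, w⟫ = 0
    rw [this, inner_zero_left]
  smul_mem' c F hF := by
    change ⟪boxLp L (c • F), w⟫ = 0
    rw [boxLp_const_mul, inner_smul_left, hF, mul_zero]

/-- The span of the modes is stable under multiplication by the functions `cosCoord`, hence by the
algebra they generate. These functions separate the points of the box, so by Stone-Weierstrass the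
algebra is uniformly dense there, and orthogonality passes from its elements to any continuous `g`.
-/
theorem mul_boxMode_mem_annihilator {L : ℝ} (hL : 0 < L) {w : OneParticle ν}
    (h : ∀ n, ⟪boxLp L (boxMode L n), w⟫ = 0) (g : C(Space ν, ℝ)) :
    ⟪boxLp L (g * boxMode L 0), w⟫ = 0 := by
  let A := Algebra.adjoin ℝ (Set.range (cosCoord (ν := ν) L))
  let V : Submodule ℝ C(Space ν, ℝ) := Submodule.span ℝ (Set.range (boxMode L))
  have hVw : V ≤ boxAnnihilator L w :=
    Submodule.span_le.mpr (by rintro _ ⟨n, rfl⟩; exact h n)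
  have hcos : ∀ i, ∀ F ∈ V, cosCoord L i * F ∈ V := by
    intro i F hF
    induction hF using Submodule.span_induction with
    | mem F hF =>
      obtain ⟨n, rfl⟩ := hF
      rw [cosCoord_mul_boxMode]
      refine V.add_mem (V.smul_mem _ (Submodule.subset_span ⟨_, rfl⟩)) ?_
      split_ifs
      · exact V.zero_mem
      · exact V.smul_mem _ (Submodule.subset_span ⟨_, rfl⟩)
    | zero => rw [mul_zero]; exact V.zero_mem
    | add F G _ _ hF hG => rw [mul_add]; exact V.add_mem hF hG
    | smul c F _ hF => rw [mul_smul_comm]; exact V.smul_mem c hF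
  have hA : ∀ p ∈ A, ∀ F ∈ V, p * F ∈ V := by
    intro p hp
    induction hp using Algebra.adjoin_induction with
    | mem p hp => obtain ⟨i, rfl⟩ := hp; exact hcos i
    | algebraMap r =>
      intro F hF
      rw [← Algebra.smul_def]
      exact V.smul_mem r hF
    | add p q _ _ hp hq =>
      intro F hF
      rw [add_mul]
      exact V.add_mem (hp F hF) (hq F hF)
    | mul p q _ _ hp hq =>
      intro F hF
      rw [mul_assoc]
      exact hp _ (hq F hF)
  have hcpt : CompactSpace (box ν L) := isCompact_iff_compactSpace.mp (isCompact_box ν L)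
  let r : C(Space ν, ℝ) →⋆ₐ[ℝ] C(box ν L, ℝ) :=
    ContinuousMap.compStarAlgHom' ℝ ℝ ⟨Subtype.val, continuous_subtype_val⟩
  have hsep : (Subalgebra.map (r : C(Space ν, ℝ) →ₐ[ℝ] C(box ν L, ℝ)) A).SeparatesPoints := by
    intro x y hxy
    by_contra hn
    push Not at hn
    refine hxy (Subtype.ext (cosCoord_injOn hL x.2 y.2 fun i => ?_))
    exact hn (r (cosCoord L i)) ⟨r (cosCoord L i),
      ⟨cosCoord L i, Algebra.subset_adjoin ⟨i, rfl⟩, rfl⟩, rfl⟩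
  have habs : ∀ x, |boxMode L (0 : Fin ν → ℕ) x| ≤ 1 := fun x => by
    change |∏ l, sinMode L _ (x l)| ≤ 1
    rw [Finset.abs_prod]
    exact Finset.prod_le_one (fun _ _ => abs_nonneg _) fun l _ => abs_sinMode_le_one _ _ _
  have key : ∀ ε : ℝ, 0 < ε →
      ‖⟪boxLp L (g * boxMode L 0), w⟫‖ ≤ ε * (√((2 * L) ^ ν) * ‖w‖) := by
    intro ε hε
    obtain ⟨⟨_, ⟨p, hp, rfl⟩⟩, hpg⟩ :=
      ContinuousMap.exists_mem_subalgebra_near_continuous_of_separatesPoints _ hsep (r g)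
        (r g).continuous ε hε
    have h0 : ⟪boxLp L (p * boxMode L 0), w⟫ = 0 :=
      hVw (hA p hp _ (Submodule.subset_span ⟨0, rfl⟩))
    have e : g * boxMode L 0 = p * boxMode L 0 + -((p - g) * boxMode L 0) := by ring
    rw [e, boxLp_add, inner_add_left, h0, zero_add, boxLp_neg, inner_neg_left, norm_neg,
      ← mul_assoc]
    refine (norm_inner_le_norm _ _).trans (mul_le_mul_of_nonneg_right
      (norm_boxLp_le hL.le hε.le fun x hx => ?_) (norm_nonneg _))
    rw [ContinuousMap.mul_apply, abs_mul]
    exact (mul_le_of_le_one_right (abs_nonneg _) (habs x)).trans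
      (hpg ⟨x, openBox_subset_box ν L hx⟩).le
  rw [← norm_le_zero_iff]
  refine ge_of_tendsto (x := 𝓝[>] (0 : ℝ)) (f := fun ε : ℝ => ε * (√((2 * L) ^ ν) * ‖w‖)) ?_ ?_
  · have : Tendsto (fun ε : ℝ => ε * (√((2 * L) ^ ν) * ‖w‖)) (𝓝 0)
        (𝓝 (0 * (√((2 * L) ^ ν) * ‖w‖))) := tendsto_id.mul_const _
    rw [zero_mul] at this
    exact this.mono_left nhdsWithin_le_nhds
  · filter_upwards [self_mem_nhdsWithin] with ε hε using key ε hε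

/-- By the preceding lemma the ground mode times `w` is orthogonal to all test functions in the open
box. The ground mode is strictly positive there and can be divided out. -/
theorem eq_zero_of_inner_boxMode {L : ℝ} (hL : 0 < L) {w : OneParticle ν}
    (hw : w ∈ localSpace ν L) (h : ∀ n, ⟪boxLp L (boxMode L n), w⟫ = 0) : w = 0 := by
  have hw' : ∀ᵐ x, x ∉ box ν L → w x = 0 := hw
  have hloc : LocallyIntegrableOn (fun x => (boxMode L 0 x : ℂ) • w x) (openBox ν L) volume := by
    have h1 : LocallyIntegrable (w : Space ν → ℂ) volume :=
      (Lp.memLp w).locallyIntegrable (by norm_num)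
    exact (h1.locallyIntegrableOn _).continuousOn_smul (isOpen_openBox ν L).isLocallyClosed
      (Complex.continuous_ofReal.comp (boxMode L 0).continuous).continuousOn
  have key := (isOpen_openBox ν L).ae_eq_zero_of_integral_contDiff_smul_eq_zero hloc (by
    intro g hg hgc hgU
    have h2 := mul_boxMode_mem_annihilator hL h ⟨g, hg.continuous⟩
    rw [inner_boxLp, ← integral_indicator (isOpen_openBox ν L).measurableSet] at h2
    rw [← h2]
    refine integral_congr_ae (Eventually.of_forall fun x => ?_)
    by_cases hx : x ∈ openBox ν L
    · simp only [Set.indicator_of_mem hx]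
      simp [mul_assoc]
    · simp only [Set.indicator_of_notMem hx]
      have : g x = 0 := image_eq_zero_of_notMem_tsupport fun hx' => hx (hgU hx')
      rw [this, zero_smul])
  refine Lp.eq_zero_iff_ae_eq_zero.mpr ?_
  filter_upwards [hw', key, ae_openBox_iff_box ν L] with x h1 h2 h3
  by_cases hx : x ∈ box ν L
  · have h4 := h2 (h3 hx)
    have h5 : (boxMode L 0 x : ℂ) ≠ 0 := by
      exact_mod_cast (boxMode_zero_pos hL (h3 hx)).ne'
    exact (smul_eq_zero.mp h4).resolve_left h5
  · exact h1 hx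

/-! ### The Dirichlet Hamiltonian in its eigenbasis -/

instance completeSpace_localSpace (L : ℝ) : CompleteSpace (localSpace ν L) :=
  (isClosed_localSpace L).completeSpace_coe

theorem IsTest.mem_localSpace {L : ℝ} {φ : 𝓢(Space ν, ℂ)} (h : IsTest (openBox ν L) φ) :
    ofSchwartz φ ∈ localSpace ν L := by
  change ∀ᵐ x, x ∉ box ν L → ofSchwartz φ x = 0
  filter_upwards [SchwartzMap.coeFn_toLp φ 2 (volume : Measure (Space ν))] with x hx hb
  have hx' : (ofSchwartz φ : Space ν → ℂ) x = φ x := hx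
  rw [hx']
  exact image_eq_zero_of_notMem_tsupport fun hx' => hb (openBox_subset_box ν L (h.2 hx'))

theorem IsH10.mem_localSpace {L : ℝ} {f : OneParticle ν} (h : IsH10 L f) : f ∈ localSpace ν L := by
  obtain ⟨φ, h1, h2, -⟩ := h
  exact (isClosed_localSpace L).mem_of_tendsto h2 (Eventually.of_forall fun n => (h1 n).mem_localSpace)

/-- The normalised Dirichlet eigenfunctions. -/
def dirichletMode (L : ℝ) (n : Fin ν → ℕ) : localSpace ν L :=
  ⟨((√L ^ ν)⁻¹ : ℂ) • boxLp L (boxMode L n),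
    (localSpace ν L).smul_mem _ (boxLp_mem_localSpace L _)⟩

theorem orthonormal_dirichletMode {L : ℝ} (hL : 0 < L) :
    Orthonormal ℂ (dirichletMode (ν := ν) L) := by
  rw [orthonormal_iff_ite]
  intro m n
  change ⟪((√L ^ ν)⁻¹ : ℂ) • boxLp L (boxMode L m), ((√L ^ ν)⁻¹ : ℂ) • boxLp L (boxMode L n)⟫ = _
  rw [inner_smul_left, inner_smul_right, inner_boxMode hL]
  split_ifs
  · have h1 : (√L : ℂ) ≠ 0 := by exact_mod_cast (Real.sqrt_pos.mpr hL).ne'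
    have h2 : (L : ℂ) = (√L : ℂ) * √L := by exact_mod_cast (Real.mul_self_sqrt hL.le).symm
    rw [map_inv₀, map_pow, Complex.conj_ofReal]
    rw [h2, mul_pow]
    field_simp
  · simp

/-- The Dirichlet eigenfunctions as a Hilbert basis of `E_L`. -/
def dirichletBasis {L : ℝ} (hL : 0 < L) : HilbertBasis (Fin ν → ℕ) ℂ (localSpace ν L) :=
  HilbertBasis.mkOfOrthogonalEqBot (orthonormal_dirichletMode hL) (by
    rw [Submodule.eq_bot_iff]
    intro w hw
    refine Subtype.ext (eq_zero_of_inner_boxMode hL w.2 fun n => ?_)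
    have h1 := Submodule.mem_orthogonal _ _ |>.mp hw (dirichletMode L n)
      (Submodule.subset_span ⟨n, rfl⟩)
    change ⟪((√L ^ ν)⁻¹ : ℂ) • boxLp L (boxMode L n), (w : OneParticle ν)⟫ = 0 at h1
    rw [inner_smul_left] at h1
    refine (mul_eq_zero.mp h1).resolve_left ?_
    simp [(Real.sqrt_pos.mpr hL).ne'])

theorem dirichletBasis_apply {L : ℝ} (hL : 0 < L) (n : Fin ν → ℕ) :
    dirichletBasis hL n = dirichletMode L n := by
  rw [dirichletBasis, HilbertBasis.coe_mkOfOrthogonalEqBot]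

/-- The eigenvalues of the Dirichlet Hamiltonian. -/
def boxEnergy (L : ℝ) (n : Fin ν → ℕ) : ℝ := dirichletEnergy L fun i => n i + 1

theorem groundEnergy_le_boxEnergy (L : ℝ) (n : Fin ν → ℕ) : groundEnergy ν L ≤ boxEnergy L n := by
  unfold groundEnergy boxEnergy dirichletEnergy
  refine mul_le_mul_of_nonneg_left (Finset.sum_le_sum fun i _ => ?_) (by norm_num)
  refine div_le_div_of_nonneg_right (mul_le_mul_of_nonneg_left ?_ (by positivity)) (by positivity)
  refine pow_le_pow_left₀ (by norm_num) ?_ 2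
  push_cast
  linarith [(Nat.cast_nonneg (n i) : (0 : ℝ) ≤ n i)]

theorem dirichletMode_mem_graph {L : ℝ} (hL : 0 < L) (n : Fin ν → ℕ) :
    ((dirichletMode L n : OneParticle ν), (boxEnergy L n : ℂ) • (dirichletMode L n : OneParticle ν))
      ∈ dirichletGraph ν L := by
  have h := (dirichletGraph ν L).smul_mem ((√L ^ ν)⁻¹ : ℂ) (boxMode_mem_dirichletGraph hL n)
  rw [Prod.smul_mk, smul_comm] at h
  exact h

/-- The coefficients of an element of `E_L` in the Dirichlet eigenbasis. -/
def modeCoeff (L : ℝ) (n : Fin ν → ℕ) (f : OneParticle ν) : ℂ :=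
  ⟪(dirichletMode L n : OneParticle ν), f⟫

theorem modeCoeff_eq_repr {L : ℝ} (hL : 0 < L) (n : Fin ν → ℕ) (f : localSpace ν L) :
    (dirichletBasis hL).repr f n = modeCoeff L n (f : OneParticle ν) := by
  rw [HilbertBasis.repr_apply_apply, dirichletBasis_apply]
  rfl

theorem hasSum_modeCoeff {L : ℝ} (hL : 0 < L) {f : OneParticle ν} (hf : f ∈ localSpace ν L) :
    HasSum (fun n => modeCoeff L n f • (dirichletMode L n : OneParticle ν)) f := by
  have h := (dirichletBasis hL).hasSum_repr ⟨f, hf⟩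
  simp only [modeCoeff_eq_repr, dirichletBasis_apply] at h
  exact h.mapL (localSpace ν L).subtypeL

theorem hasSum_inner_modeCoeff {L : ℝ} (hL : 0 < L) {f g : OneParticle ν}
    (hf : f ∈ localSpace ν L) (hg : g ∈ localSpace ν L) :
    HasSum (fun n => (starRingEnd ℂ) (modeCoeff L n f) * modeCoeff L n g) ⟪f, g⟫ := by
  have h := (dirichletBasis hL).hasSum_inner_mul_inner ⟨f, hf⟩ ⟨g, hg⟩
  simp only [dirichletBasis_apply] at h
  have e : ∀ n, (starRingEnd ℂ) (modeCoeff L n f) = ⟪f, (dirichletMode L n : OneParticle ν)⟫ :=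
    fun n => inner_conj_symm _ _
  simp only [e]
  exact h

/-- The operator is the full diagonal one. One direction is symmetry against the eigenvectors; the
other approximates by partial sums, which lie in the graph, and uses that the graph is closed. -/
theorem mem_dirichletGraph_iff {L : ℝ} (hL : 0 < L) {f v : OneParticle ν} :
    (f, v) ∈ dirichletGraph ν L ↔ f ∈ localSpace ν L ∧ v ∈ localSpace ν L ∧
      ∀ n, modeCoeff L n v = boxEnergy L n * modeCoeff L n f := by
  constructor
  · intro h
    refine ⟨h.1.mem_localSpace, h.2.1, fun n => ?_⟩
    have := dirichletGraph_symm (dirichletMode_mem_graph hL n) h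
    rw [modeCoeff, this, inner_smul_left, Complex.conj_ofReal]
    rfl
  · rintro ⟨hf, hv, h⟩
    refine (isClosed_dirichletGraph L).mem_of_tendsto
      ((hasSum_modeCoeff hL hf).prodMk (hasSum_modeCoeff hL hv)) (Eventually.of_forall fun s => ?_)
    refine (dirichletGraph ν L).sum_mem fun n _ => ?_
    have := (dirichletGraph ν L).smul_mem (modeCoeff L n f) (dirichletMode_mem_graph hL n)
    rw [Prod.smul_mk, smul_smul, mul_comm, ← h] at this
    exact this

/-! ### The finite-volume Gibbs states -/

theorem hasSum_norm_sq_modeCoeff {L : ℝ} (hL : 0 < L) {f : OneParticle ν}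
    (hf : f ∈ localSpace ν L) : HasSum (fun n => ‖modeCoeff L n f‖ ^ 2) (‖f‖ ^ 2) := by
  have h := hasSum_inner_modeCoeff hL hf hf
  have e : ∀ z : ℂ, (starRingEnd ℂ) z * z = ((‖z‖ ^ 2 : ℝ) : ℂ) := fun z => by
    rw [mul_comm, Complex.mul_conj, Complex.normSq_eq_norm_sq]
  have e2 : ⟪f, f⟫ = ((‖f‖ ^ 2 : ℝ) : ℂ) := by
    rw [inner_self_eq_norm_sq_to_K]
    push_cast
    rfl
  simp only [e, e2] at h
  exact_mod_cast h

theorem memℓp_modeCoeff {L : ℝ} (hL : 0 < L) (f : localSpace ν L) {c : (Fin ν → ℕ) → ℂ} {C : ℝ}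
    (hc : ∀ n, ‖c n‖ ≤ C) : Memℓp (fun n => c n * modeCoeff L n (f : OneParticle ν)) 2 := by
  refine memℓp_gen ?_
  simp only [ENNReal.toReal_ofNat, Real.rpow_ofNat]
  refine Summable.of_nonneg_of_le (fun n => by positivity) (fun n => ?_)
    ((hasSum_norm_sq_modeCoeff hL f.2).summable.mul_left (C ^ 2))
  rw [norm_mul, mul_pow]
  exact mul_le_mul_of_nonneg_right (pow_le_pow_left₀ (norm_nonneg _) (hc n) 2) (by positivity)

/-- The functions of the Dirichlet Hamiltonian: multiplication of the coefficients by `c`. -/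
theorem exists_modeCoeff_eq {L : ℝ} (hL : 0 < L) (f : localSpace ν L) {c : (Fin ν → ℕ) → ℂ} {C : ℝ}
    (hc : ∀ n, ‖c n‖ ≤ C) :
    ∃ u : localSpace ν L, ∀ n, modeCoeff L n (u : OneParticle ν) =
      c n * modeCoeff L n (f : OneParticle ν) := by
  refine ⟨(dirichletBasis hL).repr.symm ⟨_, memℓp_modeCoeff hL f hc⟩, fun n => ?_⟩
  rw [← modeCoeff_eq_repr hL, LinearIsometryEquiv.apply_symm_apply]

/-- The square root of `(β (H_L - μ))⁻¹` as a map to `ℓ²`. -/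
def gibbsMap {L : ℝ} (hL : 0 < L) {c : (Fin ν → ℕ) → ℂ} {C : ℝ} (hc : ∀ n, ‖c n‖ ≤ C) :
    localSpace ν L →ₗ[ℝ] lp (fun _ : Fin ν → ℕ => ℂ) 2 where
  toFun f := ⟨_, memℓp_modeCoeff hL f hc⟩
  map_add' f g := by
    ext n
    change c n * modeCoeff L n ((f : OneParticle ν) + g) = _ + _
    rw [modeCoeff, inner_add_right, mul_add]
    rfl
  map_smul' r f := by
    ext n
    change c n * modeCoeff L n (r • (f : OneParticle ν)) = r • (c n * modeCoeff L n f)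
    rw [modeCoeff, inner_smul_right_eq_smul, mul_smul_comm]
    rfl

section Shift

variable {L μ : ℝ}

theorem shift_mem_graph (u : (shift (dirichletHamiltonian ν L) μ).domain) :
    ((u : OneParticle ν), shift (dirichletHamiltonian ν L) μ u + (μ : ℂ) • (u : OneParticle ν)) ∈
      dirichletGraph ν L := by
  have h := Submodule.mem_graph_toLinearPMap (g := dirichletGraph ν L)
    (fun p hp h0 => dirichletGraph_single L p hp h0) u
  have e : shift (dirichletHamiltonian ν L) μ u + (μ : ℂ) • (u : OneParticle ν) =
      (dirichletGraph ν L).toLinearPMap u := sub_add_cancel _ _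
  rw [e]
  exact h

theorem exists_shift_eq {f v : OneParticle ν} (h : (f, v) ∈ dirichletGraph ν L) :
    ∃ hf : f ∈ (shift (dirichletHamiltonian ν L) μ).domain,
      shift (dirichletHamiltonian ν L) μ ⟨f, hf⟩ = v - (μ : ℂ) • f := by
  have hf : f ∈ (shift (dirichletHamiltonian ν L) μ).domain := ⟨(f, v), h, rfl⟩
  refine ⟨hf, ?_⟩
  have h2 := (dirichletGraph ν L).sub_mem (shift_mem_graph ⟨f, hf⟩) h
  have h3 := dirichletGraph_single L _ h2 (sub_self f)
  change shift (dirichletHamiltonian ν L) μ ⟨f, hf⟩ + (μ : ℂ) • f - v = 0 at h3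
  rw [eq_sub_iff_add_eq]
  exact sub_eq_zero.mp h3

theorem modeCoeff_shift (hL : 0 < L) (u : (shift (dirichletHamiltonian ν L) μ).domain)
    (n : Fin ν → ℕ) : modeCoeff L n (shift (dirichletHamiltonian ν L) μ u) =
      ((boxEnergy L n - μ : ℝ) : ℂ) * modeCoeff L n (u : OneParticle ν) := by
  have h := ((mem_dirichletGraph_iff hL).mp (shift_mem_graph u)).2.2 n
  rw [modeCoeff, inner_add_right, inner_smul_right] at h
  rw [modeCoeff, eq_sub_of_add_eq h, Complex.ofReal_sub, sub_mul]
  rfl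

theorem exists_shift_eq_of_modeCoeff (hL : 0 < L) {u f : OneParticle ν} (hu : u ∈ localSpace ν L)
    (hf : f ∈ localSpace ν L)
    (h : ∀ n, modeCoeff L n f = ((boxEnergy L n - μ : ℝ) : ℂ) * modeCoeff L n u) :
    ∃ hu : u ∈ (shift (dirichletHamiltonian ν L) μ).domain,
      shift (dirichletHamiltonian ν L) μ ⟨u, hu⟩ = f := by
  have hg : (u, f + (μ : ℂ) • u) ∈ dirichletGraph ν L := by
    refine (mem_dirichletGraph_iff hL).mpr
      ⟨hu, (localSpace ν L).add_mem hf ((localSpace ν L).smul_mem _ hu), fun n => ?_⟩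
    have e : modeCoeff L n (f + (μ : ℂ) • u) = modeCoeff L n f + μ * modeCoeff L n u := by
      rw [modeCoeff, inner_add_right, inner_smul_right]
      rfl
    rw [e, h, Complex.ofReal_sub]
    ring
  obtain ⟨h1, h2⟩ := exists_shift_eq (μ := μ) hg
  exact ⟨h1, by rw [h2, add_sub_cancel_right]⟩

end Shift

theorem boxEnergy_sub_pos {L μ : ℝ} (hμ : μ < groundEnergy ν L) (n : Fin ν → ℕ) :
    0 < boxEnergy L n - μ := by
  linarith [groundEnergy_le_boxEnergy L n]

theorem norm_gibbs_factor_le {L μ β : ℝ} (hβ : 0 < β) (hμ : μ < groundEnergy ν L)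
    (n : Fin ν → ℕ) : ‖((√(β * (boxEnergy L n - μ)) : ℝ) : ℂ)⁻¹‖ ≤
      (√(β * (groundEnergy ν L - μ)))⁻¹ := by
  rw [norm_inv, Complex.norm_real, Real.norm_of_nonneg (Real.sqrt_nonneg _)]
  have h := sub_pos.mpr hμ
  refine inv_anti₀ (Real.sqrt_pos.mpr (by positivity)) (Real.sqrt_le_sqrt ?_)
  exact mul_le_mul_of_nonneg_left (by linarith [groundEnergy_le_boxEnergy L n]) hβ.le

theorem exists_resolvent {L μ : ℝ} (hL : 0 < L) (hμ : μ < groundEnergy ν L)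
    (f : localSpace ν L) : ∃ u : (shift (dirichletHamiltonian ν L) μ).domain,
      (u : OneParticle ν) ∈ localSpace ν L ∧ shift (dirichletHamiltonian ν L) μ u = f := by
  obtain ⟨u, hu⟩ := exists_modeCoeff_eq hL f (C := (groundEnergy ν L - μ)⁻¹)
    (c := fun n => (((boxEnergy L n - μ : ℝ) : ℂ))⁻¹) (fun n => by
      rw [norm_inv, Complex.norm_real, Real.norm_of_nonneg (boxEnergy_sub_pos hμ n).le]
      exact inv_anti₀ (sub_pos.mpr hμ) (by linarith [groundEnergy_le_boxEnergy L n]))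
  obtain ⟨h1, h2⟩ := exists_shift_eq_of_modeCoeff (μ := μ) hL u.2 f.2 fun n => by
    have : ((boxEnergy L n - μ : ℝ) : ℂ) ≠ 0 := by exact_mod_cast (boxEnergy_sub_pos hμ n).ne'
    rw [hu, mul_inv_cancel_left₀ this]
  exact ⟨⟨u, h1⟩, u.2, h2⟩

theorem conj_mul_self_eq (z : ℂ) : (starRingEnd ℂ) z * z = ((‖z‖ ^ 2 : ℝ) : ℂ) := by
  rw [mul_comm, Complex.mul_conj, Complex.normSq_eq_norm_sq]

/-- Mode by mode, the two square roots combine to `1 / (β (E_n - μ))`, and the coefficients of `f`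
are `E_n - μ` times those of `u`. -/
theorem inner_gibbsMap {L μ β : ℝ} (hL : 0 < L) (hβ : 0 < β) (hμ : μ < groundEnergy ν L)
    (k f : localSpace ν L) (u : (shift (dirichletHamiltonian ν L) μ).domain)
    (hu : shift (dirichletHamiltonian ν L) μ u = f) :
    β * inner ℝ (gibbsMap hL (norm_gibbs_factor_le hβ hμ) k)
      (gibbsMap hL (norm_gibbs_factor_le hβ hμ) f) =
      (⟪(k : OneParticle ν), (u : OneParticle ν)⟫).re := by
  have h1 := lp.hasSum_inner (𝕜 := ℝ) (gibbsMap hL (norm_gibbs_factor_le hβ hμ) k)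
    (gibbsMap hL (norm_gibbs_factor_le hβ hμ) f)
  have hul : (u : OneParticle ν) ∈ localSpace ν L :=
    ((mem_dirichletGraph_iff hL).mp (shift_mem_graph u)).1
  have h2 := Complex.reCLM.hasSum (hasSum_inner_modeCoeff hL k.2 hul)
  refine (h1.mul_left β).unique ?_
  convert! h2 using 1
  funext n
  have h3 : modeCoeff L n (f : OneParticle ν) = _ := hu ▸ modeCoeff_shift hL u n
  have hp := boxEnergy_sub_pos hμ n
  change β * ((((√(β * (boxEnergy L n - μ)) : ℝ) : ℂ)⁻¹ * modeCoeff L n f) *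
    (starRingEnd ℂ) (((√(β * (boxEnergy L n - μ)) : ℝ) : ℂ)⁻¹ * modeCoeff L n k)).re =
    ((starRingEnd ℂ) (modeCoeff L n k) * modeCoeff L n u).re
  rw [h3, map_mul, map_inv₀, Complex.conj_ofReal, ← Complex.re_ofReal_mul]
  congr 1
  have h4 : ((√(β * (boxEnergy L n - μ)) : ℝ) : ℂ) * ((√(β * (boxEnergy L n - μ)) : ℝ) : ℂ) =
      (β : ℂ) * ((boxEnergy L n - μ : ℝ) : ℂ) := by
    rw [← Complex.ofReal_mul, Real.mul_self_sqrt (by positivity), Complex.ofReal_mul]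
  have h5 : ((√(β * (boxEnergy L n - μ)) : ℝ) : ℂ) ≠ 0 := by
    exact_mod_cast (Real.sqrt_pos.mpr (by positivity)).ne'
  field_simp
  rw [sq, h4]

theorem norm_sq_gibbsMap {L μ β : ℝ} (hL : 0 < L) (hβ : 0 < β) (hμ : μ < groundEnergy ν L)
    (f : localSpace ν L) (u : (shift (dirichletHamiltonian ν L) μ).domain)
    (hu : shift (dirichletHamiltonian ν L) μ u = f) :
    ⟪(f : OneParticle ν), (u : OneParticle ν)⟫ =
      ((β * ‖gibbsMap hL (norm_gibbs_factor_le hβ hμ) f‖ ^ 2 : ℝ) : ℂ) := by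
  have h1 := inner_gibbsMap hL hβ hμ f f u hu
  rw [real_inner_self_eq_norm_sq] at h1
  rw [h1]
  refine Complex.ext (Complex.ofReal_re _).symm ?_
  rw [Complex.ofReal_im]
  -- Symmetry of the Hamiltonian makes `⟨f, u⟩` real; the preceding lemma only yields its real part.
  have hs := dirichletGraph_symm (shift_mem_graph u) (shift_mem_graph u)
  simp only [hu, inner_add_right, inner_add_left, inner_smul_left, inner_smul_right,
    Complex.conj_ofReal, add_left_inj] at hs
  have h2 := inner_conj_symm (𝕜 := ℂ) (f : OneParticle ν) (u : OneParticle ν)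
  rw [hs] at h2
  exact Complex.conj_eq_iff_im.mp h2

/-- Since `H_L - μ` maps onto `E_L`, the Gibbs condition prescribes every value, and the form is the
square norm of `gibbsMap`. -/
theorem isGibbs_iff {L μ β : ℝ} (hL : 0 < L) (hβ : 0 < β) (hμ : μ < groundEnergy ν L)
    (ω : Functional (localSpace ν L)) :
    IsGibbs L μ β ω ↔ IsState ω ∧ ∀ f, ω (weylIn _ f) =
      Complex.exp (-(1 / 2) * (‖gibbsMap hL (norm_gibbs_factor_le hβ hμ) f‖ : ℂ) ^ 2) := by
  have e : ∀ (f : localSpace ν L) (u : (shift (dirichletHamiltonian ν L) μ).domain),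
      shift (dirichletHamiltonian ν L) μ u = f →
      (-(1 / (2 * β)) * ⟪(f : OneParticle ν), (u : OneParticle ν)⟫ : ℂ) =
        -(1 / 2) * (‖gibbsMap hL (norm_gibbs_factor_le hβ hμ) f‖ : ℂ) ^ 2 := by
    intro f u hu
    have hb : (β : ℂ) ≠ 0 := by exact_mod_cast hβ.ne'
    rw [norm_sq_gibbsMap hL hβ hμ f u hu]
    push_cast
    field_simp
  constructor
  · rintro ⟨h1, h2⟩
    refine ⟨h1, fun f => ?_⟩
    obtain ⟨u, -, hu⟩ := exists_resolvent hL hμ f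
    rw [h2 f u hu, e f u hu]
  · rintro ⟨h1, h2⟩
    exact ⟨h1, fun f u hu => by rw [h2, e f u hu]⟩

theorem existsUnique_gibbs {L μ β : ℝ} (hL : 0 < L) (hβ : 0 < β) (hμ : μ < groundEnergy ν L) :
    ∃! ω : Functional (localSpace ν L), IsGibbs L μ β ω := by
  obtain ⟨ω, h1, -, h2⟩ := exists_gaussian_state (gibbsMap hL (norm_gibbs_factor_le hβ hμ))
  refine ⟨ω, (isGibbs_iff hL hβ hμ ω).mpr ⟨h1, h2⟩, fun ω' h' => functional_ext fun f => ?_⟩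
  rw [((isGibbs_iff hL hβ hμ ω').mp h').2, h2]

theorem continuous_gibbsMap {L C : ℝ} (hL : 0 < L) {c : (Fin ν → ℕ) → ℂ} (hc : ∀ n, ‖c n‖ ≤ C) :
    Continuous (gibbsMap hL hc) := by
  have hC : 0 ≤ C := (norm_nonneg _).trans (hc 0)
  refine AddMonoidHomClass.continuous_of_bound (gibbsMap hL hc) C fun f => ?_
  refine le_of_sq_le_sq ?_ (by positivity)
  have h1 := (hasSum_norm_sq_modeCoeff hL f.2).mul_left (C ^ 2)
  have h2 := lp.hasSum_norm (p := 2) (by norm_num) (gibbsMap hL hc f)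
  simp only [ENNReal.toReal_ofNat, Real.rpow_ofNat] at h2
  rw [mul_pow]
  refine hasSum_le (fun n => ?_) h2 h1
  change ‖c n * modeCoeff L n f‖ ^ 2 ≤ _
  rw [norm_mul, mul_pow]
  exact mul_le_mul_of_nonneg_right (pow_le_pow_left₀ (norm_nonneg _) (hc n) 2) (by positivity)

theorem mem_genDomain_shift {L μ : ℝ} {f v : OneParticle ν} (h : (f, v) ∈ dirichletGraph ν L) :
    f ∈ genDomain (localSpace ν L) (shift (dirichletHamiltonian ν L) μ) := by
  obtain ⟨h1, h2⟩ := exists_shift_eq (μ := μ) h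
  refine ⟨h.1.mem_localSpace, h1, ?_⟩
  rw [h2]
  exact (localSpace ν L).sub_mem h.2.1 ((localSpace ν L).smul_mem _ h.1.mem_localSpace)

theorem dense_genDomain_shift {L : ℝ} (hL : 0 < L) (μ : ℝ) :
    Dense {f : localSpace ν L |
      (f : OneParticle ν) ∈ genDomain (localSpace ν L) (shift (dirichletHamiltonian ν L) μ)} := by
  intro f
  have h := (dirichletBasis hL).hasSum_repr f
  simp only [modeCoeff_eq_repr, dirichletBasis_apply] at h
  refine mem_closure_of_tendsto h (Eventually.of_forall fun s => ?_)
  refine mem_genDomain_shift (v := ∑ n ∈ s, (modeCoeff L n (f : OneParticle ν) * boxEnergy L n) •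
    (dirichletMode L n : OneParticle ν)) ?_
  rw [Submodule.coe_sum, prod_mk_sum]
  refine (dirichletGraph ν L).sum_mem fun n _ => ?_
  have := (dirichletGraph ν L).smul_mem (modeCoeff L n (f : OneParticle ν))
    (dirichletMode_mem_graph hL n)
  rw [Prod.smul_mk, smul_smul] at this
  exact this

/-- In the eigenbasis membership in the graph is one scalar equation per mode, and each of them
survives weak limits. -/
theorem pointwiseClosed_shift {L : ℝ} (hL : 0 < L) (μ : ℝ) :
    PointwiseClosed (localSpace ν L) (shift (dirichletHamiltonian ν L) μ) := by
  refine pointwiseClosed_of_weakly_closed fun u f v hu hv => ?_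
  have hflip : ∀ {w : ℕ → OneParticle ν} {x : OneParticle ν} (n : Fin ν → ℕ),
      (∀ g, Tendsto (fun m => ⟪w m, g⟫) atTop (𝓝 ⟪x, g⟫)) →
      Tendsto (fun m => modeCoeff L n (w m)) atTop (𝓝 (modeCoeff L n x)) := by
    intro w x n h
    have := (Complex.continuous_conj.tendsto _).comp (h (dirichletMode L n : OneParticle ν))
    simpa only [Function.comp_def, inner_conj_symm, modeCoeff] using this
  refine exists_shift_eq_of_modeCoeff hL f.2 v.2 fun n => ?_
  refine tendsto_nhds_unique (hflip n hv) ?_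
  refine ((hflip n hu).const_mul ((boxEnergy L n - μ : ℝ) : ℂ)).congr fun m => ?_
  exact (modeCoeff_shift (μ := μ) hL ⟨(u m : OneParticle ν), (u m).2.2.choose⟩ n).symm

/-- The Gibbs state is the unique weak KMS state with norm-continuous characteristic functional. -/
theorem isGibbs_iff_isWeakKMS {L μ β : ℝ} (hL : 0 < L) (hβ : 0 < β) (hμ : μ < groundEnergy ν L)
    (ω : Functional (localSpace ν L)) :
    IsGibbs L μ β ω ↔ IsWeakKMS (localSpace ν L) (shift (dirichletHamiltonian ν L) μ) β ω ∧
      Continuous fun f : localSpace ν L => ω (weylIn _ f) := by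
  have hcont : Continuous fun f : localSpace ν L => Complex.exp
      (-(1 / 2) * (‖gibbsMap hL (norm_gibbs_factor_le hβ hμ) f‖ : ℂ) ^ 2) := by
    have := continuous_gibbsMap hL (norm_gibbs_factor_le (L := L) hβ hμ)
    fun_prop
  rw [isGibbs_iff hL hβ hμ]
  constructor
  · rintro ⟨h1, h2⟩
    refine ⟨isWeakKMS_of_gaussian (gibbsMap hL (norm_gibbs_factor_le hβ hμ))
      (dense_genDomain_shift hL μ) (pointwiseClosed_shift hL μ) h1 h2 fun k f => ?_, ?_⟩
    · have hg := ((shift (dirichletHamiltonian ν L) μ).domain).smul_mem Complex.I f.2.2.choose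
      rw [inner_gibbsMap hL hβ hμ k _ ⟨_, hg⟩ (LinearPMap.map_smul _ _ ⟨_, f.2.2.choose⟩)]
      change (⟪(k : OneParticle ν), Complex.I • (f : OneParticle ν)⟫).re = _
      rw [inner_smul_right, Complex.I_mul_re]
      rfl
    · simpa only [h2] using hcont
  · rintro ⟨h1, h2⟩
    refine ⟨h1.state, fun f => ?_⟩
    -- Both sides are norm continuous, so it is enough to compare them on the dense domain.
    have key := (dense_genDomain_shift hL μ).induction (P := fun f => ω (weylIn _ f) = Complex.exp
      (-(1 / 2) * (‖gibbsMap hL (norm_gibbs_factor_le hβ hμ) f‖ : ℂ) ^ 2)) ?_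
      (isClosed_eq h2 hcont) f
    · exact key
    · intro k hk
      obtain ⟨u, hul, hu⟩ := exists_resolvent hL hμ k
      -- The vector `-i u` with `(H_L - μ) u = k` solves `i (H_L - μ) f = k`, as the differential
      -- equation along the line through `k` requires.
      have hD : (-Complex.I) • (u : OneParticle ν) ∈
          genDomain (localSpace ν L) (shift (dirichletHamiltonian ν L) μ) :=
        genDomain_smul _ ⟨hul, u.2, by rw [show shift (dirichletHamiltonian ν L) μ
          ⟨(u : OneParticle ν), u.2⟩ = k from hu]; exact k.2⟩
      have hop : genOp (shift (dirichletHamiltonian ν L) μ) ⟨_, hD⟩ =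
          genIncl (shift (dirichletHamiltonian ν L) μ) ⟨(k : OneParticle ν), hk⟩ := by
        refine Subtype.ext ?_
        change Complex.I • shift (dirichletHamiltonian ν L) μ ⟨(-Complex.I) • (u : OneParticle ν), _⟩
          = (k : OneParticle ν)
        have := LinearPMap.map_smul (shift (dirichletHamiltonian ν L) μ) (-Complex.I) u
        rw [hu] at this
        refine (congrArg (Complex.I • ·) this).trans ?_
        simp only [smul_smul]
        simp
      have h3 := h1.apply_weyl hβ.ne' _ _ hop
      refine h3.trans ?_
      congr 1
      have h4 := norm_sq_gibbsMap hL hβ hμ k u hu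
      have h5 : sympl (k : OneParticle ν) ((-Complex.I) • (u : OneParticle ν)) =
          -(β * ‖gibbsMap hL (norm_gibbs_factor_le hβ hμ) k‖ ^ 2) := by
        rw [sympl, inner_smul_right, h4, neg_mul, Complex.neg_im, Complex.I_mul_im,
          Complex.ofReal_re]
      change ((sympl (k : OneParticle ν) ((-Complex.I) • (u : OneParticle ν)) / (2 * β) : ℝ) : ℂ) = _
      rw [h5]
      have hb : (β : ℂ) ≠ 0 := by exact_mod_cast hβ.ne'
      push_cast
      field_simp

/-! ### The Fourier transform -/

theorem fourier_ofSchwartz (φ : 𝓢(Space ν, ℂ)) : 𝓕 (ofSchwartz φ) = ofSchwartz (𝓕 φ) :=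
  SchwartzMap.toLp_fourier_eq φ

theorem coeFn_ofSchwartz (φ : 𝓢(Space ν, ℂ)) : ofSchwartz φ =ᵐ[volume] φ :=
  SchwartzMap.coeFn_toLp φ 2 (volume : Measure (Space ν))

theorem inner_fourier (f g : OneParticle ν) : ⟪(𝓕 f : OneParticle ν), 𝓕 g⟫ = ⟪f, g⟫ :=
  Lp.inner_fourier_eq f g

/-- The symbol is `p² / 2` at `p = 2π ξ`. -/
theorem fourier_kinetic (φ : 𝓢(Space ν, ℂ)) (ξ : Space ν) :
    (𝓕 (kinetic φ) : 𝓢(Space ν, ℂ)) ξ = ((2 * Real.pi ^ 2 * ‖ξ‖ ^ 2 : ℝ) : ℂ) * 𝓕 φ ξ := by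
  have hg : (fun x : Space ν => ‖x‖ ^ 2).HasTemperateGrowth :=
    Function.hasTemperateGrowth_norm_sq _
  have h : kinetic φ = ((2 * Real.pi ^ 2 : ℝ) : ℂ) •
      SchwartzMap.fourierMultiplierCLM ℂ (fun x : Space ν => ‖x‖ ^ 2) φ := by
    rw [kinetic, SchwartzMap.laplacian_eq_fourierMultiplierCLM]
    ext x
    simp only [smul_apply, smul_eq_mul, Complex.real_smul]
    push_cast
    have e : ((‖·‖ ^ 2 : Space ν → ℝ)) = fun x => ‖x‖ ^ 2 := rfl
    rw [e]
    ring
  rw [h, FourierTransform.fourier_smul, SchwartzMap.fourierMultiplierCLM_apply,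
    FourierTransform.fourier_fourierInv_eq, smul_apply,
    SchwartzMap.smulLeftCLM_apply_apply hg, smul_eq_mul, Complex.real_smul]
  push_cast
  ring

/-- The integral defining the Fourier transform of an integrable function agrees with the unitary
Fourier transform. -/
theorem fourier_ae_eq {f : OneParticle ν} (hf : Integrable f) :
    (𝓕 f : OneParticle ν) =ᵐ[volume] 𝓕 (f : Space ν → ℂ) := by
  have hcont : Continuous (𝓕 (f : Space ν → ℂ)) :=
    VectorFourier.fourierIntegral_continuous Real.continuous_fourierChar
      (L := innerₗ (Space ν)) continuous_inner hf
  have hl1 : LocallyIntegrable ((𝓕 f : OneParticle ν) : Space ν → ℂ) volume :=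
    (Lp.memLp _).locallyIntegrable (by norm_num)
  have key := ae_eq_of_integral_contDiff_smul_eq (μ := volume) hl1 hcont.locallyIntegrable (by
    intro g hg hgc
    have hc : HasCompactSupport fun x => (g x : ℂ) :=
      hgc.comp_left (g := fun y : ℝ => (y : ℂ)) (by simp)
    have hs : ContDiff ℝ (⊤ : ℕ∞) fun x => (g x : ℂ) := Complex.ofRealCLM.contDiff.comp hg
    let ψ : 𝓢(Space ν, ℂ) := hc.toSchwartzMap hs
    have h1 : ∀ h : Space ν → ℂ, ∫ x, g x • h x = ∫ x, ψ x • h x := fun h => by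
      refine integral_congr_ae (Eventually.of_forall fun x => ?_)
      exact (Complex.coe_smul _ _).symm
    rw [h1, h1]
    -- Both transforms satisfy the same duality with a test function: the integral one by Fubini,
    -- the unitary one as a tempered distribution.
    have h2 := VectorFourier.integral_fourierIntegral_smul_eq_flip (L := innerₗ (Space ν))
      Real.continuous_fourierChar continuous_inner (ψ.integrable (μ := volume)) hf
    have h3 : (𝓕 (Lp.toTemperedDistribution f : 𝓢'(Space ν, ℂ)) : 𝓢'(Space ν, ℂ)) ψ =
        Lp.toTemperedDistribution (𝓕 f : OneParticle ν) ψ := by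
      rw [Lp.fourier_toTemperedDistribution_eq]
    rw [TemperedDistribution.fourier_apply, Lp.toTemperedDistribution_apply,
      Lp.toTemperedDistribution_apply] at h3
    rw [← h3]
    simpa using! h2)
  exact key

theorem continuous_fourier {f : Space ν → ℂ} (hf : Integrable f) : Continuous (𝓕 f) :=
  VectorFourier.fourierIntegral_continuous Real.continuous_fourierChar
    (L := innerₗ (Space ν)) continuous_inner hf

theorem norm_fourier_le {f : OneParticle ν} (hf : Integrable f) :
    ∀ᵐ ξ, ‖(𝓕 f : OneParticle ν) ξ‖ ≤ ∫ x, ‖f x‖ := by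
  filter_upwards [fourier_ae_eq hf] with ξ h
  rw [h]
  exact VectorFourier.norm_fourierIntegral_le_integral_norm _ _ _ _ _

theorem fourier_zero_eq_integral (f : Space ν → ℂ) : 𝓕 f 0 = ∫ x, f x := by
  rw [Real.fourier_eq]
  simp

/-! ### Approximation by test functions -/

/-- Dilation of a Schwartz function by the factor `j + 1`. -/
def dilate (j : ℕ) (φ : 𝓢(Space ν, ℂ)) : 𝓢(Space ν, ℂ) :=
  SchwartzMap.compCLMOfContinuousLinearEquiv ℂ (ContinuousLinearEquiv.smulLeft
    (Units.mk0 ((j : ℝ) + 1)⁻¹ (by positivity)) : Space ν ≃L[ℝ] Space ν) φ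

theorem dilate_apply (j : ℕ) (φ : 𝓢(Space ν, ℂ)) (x : Space ν) :
    dilate j φ x = φ (((j : ℝ) + 1)⁻¹ • x) := rfl

theorem lineDeriv_dilate (j : ℕ) (φ : 𝓢(Space ν, ℂ)) (v : Space ν) :
    ∂_{v} (dilate j φ) = ((j : ℝ) + 1)⁻¹ • dilate j (∂_{v} φ) := by
  rw [dilate, SchwartzMap.lineDerivOp_compCLMOfContinuousLinearEquiv]
  have h : (ContinuousLinearEquiv.smulLeft (Units.mk0 ((j : ℝ) + 1)⁻¹ (by positivity)) :
    Space ν ≃L[ℝ] Space ν) v = ((j : ℝ) + 1)⁻¹ • v := rfl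
  rw [h, LineDeriv.lineDerivOp_left_smul]
  rfl

/-- The product of two Schwartz functions. -/
def schwartzMul (χ φ : 𝓢(Space ν, ℂ)) : 𝓢(Space ν, ℂ) := SchwartzMap.smulLeftCLM ℂ χ φ

theorem schwartzMul_apply (χ φ : 𝓢(Space ν, ℂ)) (x : Space ν) :
    schwartzMul χ φ x = χ x * φ x := by
  rw [schwartzMul, SchwartzMap.smulLeftCLM_apply_apply χ.hasTemperateGrowth, smul_eq_mul]

theorem lineDeriv_schwartzMul (χ φ : 𝓢(Space ν, ℂ)) (v : Space ν) :
    ∂_{v} (schwartzMul χ φ) = schwartzMul (∂_{v} χ) φ + schwartzMul χ (∂_{v} φ) := by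
  ext x
  rw [add_apply, schwartzMul_apply, schwartzMul_apply, SchwartzMap.lineDerivOp_apply,
    SchwartzMap.lineDerivOp_apply, SchwartzMap.lineDerivOp_apply]
  refine HasLineDerivAt.lineDeriv ?_
  have h1 : HasLineDerivAt ℝ χ (lineDeriv ℝ χ x v) x v :=
    χ.differentiableAt.lineDifferentiableAt.hasLineDerivAt
  have h2 : HasLineDerivAt ℝ φ (lineDeriv ℝ φ x v) x v :=
    φ.differentiableAt.lineDifferentiableAt.hasLineDerivAt
  have h3 := HasDerivAt.mul h1 h2
  simp only [zero_smul, add_zero] at h3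
  have e : (schwartzMul χ φ : Space ν → ℂ) = fun x => χ x * φ x :=
    funext (schwartzMul_apply χ φ)
  rw [e]
  exact h3

theorem schwartzMul_smul_left (c : ℝ) (χ φ : 𝓢(Space ν, ℂ)) :
    schwartzMul (c • χ) φ = (c : ℂ) • schwartzMul χ φ := by
  ext x
  simp only [schwartzMul_apply, smul_apply, Complex.real_smul, smul_eq_mul, mul_assoc]

/-- The dilated factor is uniformly bounded and tends pointwise to `χ 0`. Applied to a cutoff this
gives convergence; applied to its derivatives, boundedness of the error terms. -/
theorem tendsto_dilate_mul (χ φ : 𝓢(Space ν, ℂ)) :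
    Tendsto (fun j => ofSchwartz (schwartzMul (dilate j χ) φ)) atTop
      (𝓝 (χ 0 • ofSchwartz φ)) := by
  rw [← ofSchwartz_smul]
  obtain ⟨C, hC⟩ : ∃ C, ∀ x, ‖χ x‖ ≤ C :=
    ⟨_, fun x => SchwartzMap.norm_le_seminorm ℝ χ x⟩
  refine tendsto_toLp_of_dominated
    (fun j => (schwartzMul (dilate j χ) φ).memLp 2 volume) ((χ 0 • φ).memLp 2 volume)
    (fun x => C * ‖φ x‖) ((φ.memLp 2 volume).norm.const_mul C)
    (fun j => Eventually.of_forall fun x => ?_) (Eventually.of_forall fun x => ?_)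
  · rw [schwartzMul_apply, norm_mul, dilate_apply]
    exact mul_le_mul_of_nonneg_right (hC _) (norm_nonneg _)
  · simp only [schwartzMul_apply, dilate_apply]
    refine Tendsto.mul_const _ ?_
    have h1 : Tendsto (fun j : ℕ => ((j : ℝ) + 1)⁻¹ • x) atTop (𝓝 ((0 : ℝ) • x)) := by
      refine Tendsto.smul_const ?_ x
      exact tendsto_one_div_add_atTop_nhds_zero_nat.congr fun j => one_div _
    rw [zero_smul] at h1
    exact (χ.continuous.tendsto 0).comp h1

theorem kinetic_schwartzMul_dilate (χ φ : 𝓢(Space ν, ℂ)) (j : ℕ) :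
    ofSchwartz (kinetic (schwartzMul (dilate j χ) φ)) = (-(1 / 2 : ℂ)) • ∑ i : Fin ν,
      (((((j : ℝ) + 1)⁻¹ : ℝ) : ℂ) • ((((j : ℝ) + 1)⁻¹ : ℝ) : ℂ) •
        ofSchwartz (schwartzMul (dilate j (∂_{EuclideanSpace.single i (1 : ℝ)}
          (∂_{EuclideanSpace.single i (1 : ℝ)} χ))) φ) +
      ((((j : ℝ) + 1)⁻¹ : ℝ) : ℂ) •
        ofSchwartz (schwartzMul (dilate j (∂_{EuclideanSpace.single i (1 : ℝ)} χ))
          (∂_{EuclideanSpace.single i (1 : ℝ)} φ)) +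
      (((((j : ℝ) + 1)⁻¹ : ℝ) : ℂ) •
        ofSchwartz (schwartzMul (dilate j (∂_{EuclideanSpace.single i (1 : ℝ)} χ))
          (∂_{EuclideanSpace.single i (1 : ℝ)} φ)) +
      ofSchwartz (schwartzMul (dilate j χ) (∂_{EuclideanSpace.single i (1 : ℝ)}
          (∂_{EuclideanSpace.single i (1 : ℝ)} φ))))) := by
  rw [kinetic_eq_sum, ofSchwartz_smul, ofSchwartz_sum]
  simp only [lineDeriv_schwartzMul, LineDeriv.lineDerivOp_add, lineDeriv_dilate,
    schwartzMul_smul_left, LineDeriv.lineDerivOp_smul, ofSchwartz_add, ofSchwartz_smul, smul_add]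

/-- Test functions approximate Schwartz functions in the graph norm of the kinetic energy. -/
theorem exists_test_approx (φ : 𝓢(Space ν, ℂ)) :
    ∃ g : ℕ → 𝓢(Space ν, ℂ), (∀ j, IsTest Set.univ (g j)) ∧
      Tendsto (fun j => ofSchwartz (g j)) atTop (𝓝 (ofSchwartz φ)) ∧
      Tendsto (fun j => ofSchwartz (kinetic (g j))) atTop (𝓝 (ofSchwartz (kinetic φ))) := by
  let b : ContDiffBump (0 : Space ν) := ⟨1, 2, one_pos, one_lt_two⟩
  have hbc : HasCompactSupport fun x => (b x : ℂ) :=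
    b.hasCompactSupport.comp_left (g := fun y : ℝ => (y : ℂ)) (by simp)
  have hbs : ContDiff ℝ (⊤ : ℕ∞) fun x => (b x : ℂ) := Complex.ofRealCLM.contDiff.comp b.contDiff
  let χ : 𝓢(Space ν, ℂ) := hbc.toSchwartzMap hbs
  have hχ0 : χ 0 = 1 := by
    change (b 0 : ℂ) = 1
    rw [b.one_of_mem_closedBall (by simp [b.rIn_pos.le])]
    simp
  have hχc : HasCompactSupport χ := hbc
  refine ⟨fun j => schwartzMul (dilate j χ) φ, fun j => ⟨?_, Set.subset_univ _⟩, ?_, ?_⟩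
  · have h1 : HasCompactSupport (dilate j χ) :=
      hχc.comp_homeomorph (ContinuousLinearEquiv.smulLeft (Units.mk0 ((j : ℝ) + 1)⁻¹
        (by positivity)) : Space ν ≃L[ℝ] Space ν).toHomeomorph
    have e : (schwartzMul (dilate j χ) φ : Space ν → ℂ) = fun x => dilate j χ x * φ x :=
      funext (schwartzMul_apply _ _)
    rw [e]
    exact h1.mul_right
  · have := tendsto_dilate_mul χ φ
    rwa [hχ0, one_smul] at this
  · have hj : Tendsto (fun j : ℕ => ((((j : ℝ) + 1)⁻¹ : ℝ) : ℂ)) atTop (𝓝 0) := by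
      have h1 : Tendsto (fun j : ℕ => ((j : ℝ) + 1)⁻¹) atTop (𝓝 0) :=
        tendsto_one_div_add_atTop_nhds_zero_nat.congr fun j => one_div _
      have := (Complex.continuous_ofReal.tendsto _).comp h1
      rwa [Complex.ofReal_zero] at this
    simp only [kinetic_schwartzMul_dilate]
    rw [kinetic_eq_sum, ofSchwartz_smul, ofSchwartz_sum]
    refine Tendsto.const_smul (tendsto_finsetSum _ fun i _ => ?_) _
    have h1 := hj.smul (hj.smul (tendsto_dilate_mul (∂_{EuclideanSpace.single i (1 : ℝ)}
      (∂_{EuclideanSpace.single i (1 : ℝ)} χ)) φ))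
    have h2 := hj.smul (tendsto_dilate_mul (∂_{EuclideanSpace.single i (1 : ℝ)} χ)
      (∂_{EuclideanSpace.single i (1 : ℝ)} φ))
    have h3 := tendsto_dilate_mul χ (∂_{EuclideanSpace.single i (1 : ℝ)}
      (∂_{EuclideanSpace.single i (1 : ℝ)} φ))
    have h4 := (h1.add h2).add (h2.add h3)
    -- Each derivative falling on the dilated cutoff costs a factor `1 / (j + 1)`, so only the term
    -- with both derivatives on `φ` survives.
    rw [hχ0, one_smul, zero_smul, zero_smul, zero_add, zero_add, zero_add] at h4
    exact h4

/-! ### The form domain of the inverse Hamiltonian -/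

/-- The multiplier of the square root of `H⁻¹` in Fourier space. -/
def invWeight (ξ : Space ν) : ℝ := √2 / (2 * Real.pi * ‖ξ‖)

theorem measurable_invWeight : Measurable (invWeight (ν := ν)) := by
  unfold invWeight
  fun_prop

theorem invWeight_sq (ξ : Space ν) : invWeight ξ ^ 2 = 2 / (2 * Real.pi * ‖ξ‖) ^ 2 := by
  rw [invWeight, div_pow, Real.sq_sqrt (by norm_num)]

theorem invWeight_sq_mul {ξ : Space ν} (hξ : ξ ≠ 0) :
    invWeight ξ ^ 2 * (2 * Real.pi ^ 2 * ‖ξ‖ ^ 2) = 1 := by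
  have h1 := norm_ne_zero_iff.mpr hξ
  have h2 := Real.pi_ne_zero
  rw [invWeight_sq]
  field_simp

theorem aestronglyMeasurable_weight (f : OneParticle ν) :
    AEStronglyMeasurable (fun ξ => (invWeight ξ : ℂ) * f ξ) volume :=
  (Complex.measurable_ofReal.comp measurable_invWeight).aestronglyMeasurable.mul
    (Lp.aestronglyMeasurable f)

/-- The form domain of `H⁻¹`. -/
def formDomain (ν : ℕ) : Submodule ℂ (OneParticle ν) where
  carrier := {f | MemLp (fun ξ => (invWeight ξ : ℂ) * (𝓕 f : OneParticle ν) ξ) 2}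
  add_mem' {f g} hf hg := by
    refine (MemLp.add hf hg).ae_eq ?_
    rw [FourierTransform.fourier_add]
    filter_upwards [Lp.coeFn_add (𝓕 f : OneParticle ν) (𝓕 g)] with ξ h
    rw [h, Pi.add_apply, Pi.add_apply, mul_add]
  zero_mem' := by
    have e : (𝓕 (0 : OneParticle ν) : OneParticle ν) = 0 :=
      map_zero (Lp.fourierTransformₗᵢ (Space ν) ℂ)
    refine MemLp.ae_eq ?_ (MemLp.zero (ε := ℂ) (p := 2) (μ := (volume : Measure (Space ν))))
    rw [e]
    filter_upwards [Lp.coeFn_zero ℂ 2 (volume : Measure (Space ν))] with ξ h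
    rw [h]
    simp
  smul_mem' c f hf := by
    refine (MemLp.const_smul hf c).ae_eq ?_
    rw [FourierTransform.fourier_smul]
    filter_upwards [Lp.coeFn_smul c (𝓕 f : OneParticle ν)] with ξ h
    rw [h, Pi.smul_apply, Pi.smul_apply, smul_eq_mul, smul_eq_mul, mul_left_comm]

/-- The square root of `H⁻¹` in Fourier space. -/
def invSqrt (ν : ℕ) : formDomain ν →ₗ[ℂ] OneParticle ν where
  toFun f := MemLp.toLp _ f.2
  map_add' f g := by
    refine Lp.ext ?_
    filter_upwards [MemLp.coeFn_toLp (f + g).2, MemLp.coeFn_toLp f.2, MemLp.coeFn_toLp g.2,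
      Lp.coeFn_add (MemLp.toLp _ f.2) (MemLp.toLp _ g.2),
      Lp.coeFn_add (𝓕 (f : OneParticle ν) : OneParticle ν) (𝓕 (g : OneParticle ν))]
      with ξ h1 h2 h3 h4 h5
    rw [h1, h4, Pi.add_apply, h2, h3, Submodule.coe_add, FourierTransform.fourier_add, h5,
      Pi.add_apply, mul_add]
  map_smul' c f := by
    refine Lp.ext ?_
    filter_upwards [MemLp.coeFn_toLp (c • f).2, MemLp.coeFn_toLp f.2,
      Lp.coeFn_smul c (MemLp.toLp _ f.2),
      Lp.coeFn_smul c (𝓕 (f : OneParticle ν) : OneParticle ν)] with ξ h1 h2 h3 h4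
    rw [h1, RingHom.id_apply, h3, Pi.smul_apply, h2, Submodule.coe_smul,
      FourierTransform.fourier_smul, h4, Pi.smul_apply, smul_eq_mul, smul_eq_mul, mul_left_comm]

theorem coeFn_invSqrt (f : formDomain ν) :
    invSqrt ν f =ᵐ[volume] fun ξ => (invWeight ξ : ℂ) * (𝓕 (f : OneParticle ν) : OneParticle ν) ξ :=
  MemLp.coeFn_toLp f.2

theorem inverseDensity_eq (f : OneParticle ν) (ξ : Space ν) :
    inverseDensity f ξ = ‖(invWeight ξ : ℂ) * (𝓕 f : OneParticle ν) ξ‖ ^ 2 := by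
  rw [norm_mul, mul_pow, Complex.norm_real, Real.norm_eq_abs, sq_abs, invWeight_sq]
  rfl

theorem mem_formDomain_iff {f : OneParticle ν} :
    f ∈ formDomain ν ↔ Integrable (inverseDensity f) := by
  have e : inverseDensity f = fun ξ => ‖(invWeight ξ : ℂ) * (𝓕 f : OneParticle ν) ξ‖ ^ 2 :=
    funext (inverseDensity_eq f)
  rw [e]
  exact memLp_two_iff_integrable_sq_norm (aestronglyMeasurable_weight _)

theorem norm_sq_invSqrt (f : formDomain ν) : ‖invSqrt ν f‖ ^ 2 = inverseForm (f : OneParticle ν) := by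
  refine (norm_sq_toLp (show MemLp _ 2 volume from f.2)).trans ?_
  exact integral_congr_ae (Eventually.of_forall fun ξ => (inverseDensity_eq _ ξ).symm)

theorem ae_ne_zero (hν : 0 < ν) : ∀ᵐ ξ : Space ν, ξ ≠ 0 := by
  have : Nonempty (Fin ν) := ⟨⟨0, hν⟩⟩
  have : Nontrivial (Space ν) := inferInstance
  exact Measure.ae_ne volume 0

/-- The squared weight is the reciprocal of the kinetic symbol off the origin, which is a null set.
-/
theorem inner_invSqrt (hν : 0 < ν) (f k : formDomain ν) {u : OneParticle ν}
    (h : (𝓕 (k : OneParticle ν) : OneParticle ν) =ᵐ[volume]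
      fun ξ => ((2 * Real.pi ^ 2 * ‖ξ‖ ^ 2 : ℝ) : ℂ) * (𝓕 u : OneParticle ν) ξ) :
    ⟪invSqrt ν f, invSqrt ν k⟫ = ⟪(f : OneParticle ν), u⟫ := by
  rw [← inner_fourier (f : OneParticle ν), L2.inner_def, L2.inner_def]
  refine integral_congr_ae ?_
  filter_upwards [coeFn_invSqrt f, coeFn_invSqrt k, h, ae_ne_zero hν] with ξ h1 h2 h3 h4
  have h5 : (invWeight ξ : ℂ) ^ 2 * ((2 * Real.pi ^ 2 * ‖ξ‖ ^ 2 : ℝ) : ℂ) = 1 := by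
    exact_mod_cast invWeight_sq_mul h4
  rw [h1, h2, h3, RCLike.inner_apply, RCLike.inner_apply, map_mul, Complex.conj_ofReal]
  linear_combination ((𝓕 u : OneParticle ν) ξ *
    (starRingEnd ℂ) ((𝓕 (f : OneParticle ν) : OneParticle ν) ξ)) * h5

/-- In polar coordinates the radial density `r^(ν-1)` turns `r⁻²` into `r^(ν-3)`, integrable at zero
since `ν ≥ 3`. -/
theorem integrableOn_invWeight_sq (hν : 3 ≤ ν) :
    IntegrableOn (fun ξ : Space ν => invWeight ξ ^ 2) (Metric.ball 0 1) := by
  have : Nonempty (Fin ν) := ⟨⟨0, by omega⟩⟩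
  have : Nontrivial (Space ν) := inferInstance
  simp only [invWeight_sq]
  refine (integrableOn_fun_norm_addHaar (volume : Measure (Space ν))
    (f := fun r : ℝ => 2 / (2 * Real.pi * r) ^ 2) (r := 1)).mpr ?_
  rw [finrank_euclideanSpace_fin]
  have hc : ContinuousOn (fun y : ℝ => y ^ (ν - 3) * (1 / (2 * Real.pi ^ 2))) (Set.Icc 0 1) := by
    fun_prop
  refine (hc.integrableOn_Icc.mono_set Set.Ioo_subset_Icc_self).congr_fun (fun y hy => ?_)
    measurableSet_Ioo
  have hy0 : y ≠ 0 := hy.1.ne'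
  have hp := Real.pi_ne_zero
  obtain ⟨m, rfl⟩ : ∃ m, ν = m + 3 := ⟨ν - 3, by omega⟩
  simp only [Nat.add_sub_cancel, smul_eq_mul]
  have : m + 3 - 1 = m + 2 := by omega
  rw [this, pow_add]
  field_simp

/-- Low momenta are controlled by `|f̂| ≤ ‖f‖₁` and the integrability of the weight near zero, high
momenta by Plancherel. -/
theorem exists_inverseForm_le (hν : 3 ≤ ν) : ∃ C : ℝ, 0 ≤ C ∧ ∀ f : OneParticle ν, Integrable f →
    f ∈ formDomain ν ∧ inverseForm f ≤ C * ((∫ x, ‖f x‖) ^ 2 + ‖f‖ ^ 2) := by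
  refine ⟨(∫ ξ in Metric.ball (0 : Space ν) 1, invWeight ξ ^ 2) + 1, by positivity, fun f hf => ?_⟩
  set I : ℝ := ∫ x, ‖f x‖
  have hI : 0 ≤ I := integral_nonneg fun x => norm_nonneg _
  let m : Space ν → ℝ := fun ξ => (Metric.ball (0 : Space ν) 1).indicator
    (fun ξ => invWeight ξ ^ 2) ξ * I ^ 2 + ‖(𝓕 f : OneParticle ν) ξ‖ ^ 2
  have hi1 : Integrable ((Metric.ball (0 : Space ν) 1).indicator fun ξ => invWeight ξ ^ 2) :=
    (integrable_indicator_iff measurableSet_ball).mpr (integrableOn_invWeight_sq hν)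
  have hi2 : Integrable fun ξ => ‖(𝓕 f : OneParticle ν) ξ‖ ^ 2 :=
    (memLp_two_iff_integrable_sq_norm (Lp.aestronglyMeasurable _)).mp (Lp.memLp _)
  have hm : Integrable m := (hi1.mul_const _).add hi2
  have hle : ∀ᵐ ξ, inverseDensity f ξ ≤ m ξ := by
    filter_upwards [norm_fourier_le hf] with ξ h
    rw [inverseDensity_eq, norm_mul, mul_pow, Complex.norm_real, Real.norm_eq_abs, sq_abs]
    by_cases hξ : ξ ∈ Metric.ball (0 : Space ν) 1
    · have h1 : invWeight ξ ^ 2 * ‖(𝓕 f : OneParticle ν) ξ‖ ^ 2 ≤ invWeight ξ ^ 2 * I ^ 2 :=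
        mul_le_mul_of_nonneg_left (pow_le_pow_left₀ (norm_nonneg _) h 2) (sq_nonneg _)
      have h2 : m ξ = invWeight ξ ^ 2 * I ^ 2 + ‖(𝓕 f : OneParticle ν) ξ‖ ^ 2 := by
        simp only [m, Set.indicator_of_mem hξ]
      rw [h2]
      linarith [sq_nonneg ‖(𝓕 f : OneParticle ν) ξ‖]
    · have h2 : m ξ = ‖(𝓕 f : OneParticle ν) ξ‖ ^ 2 := by
        simp only [m, Set.indicator_of_notMem hξ, zero_mul, zero_add]
      rw [h2]
      refine mul_le_of_le_one_left (sq_nonneg _) ?_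
      have h3 : 1 ≤ ‖ξ‖ := by simpa using hξ
      -- Outside the unit ball the squared weight is at most one, as `2 ≤ (2π)²`.
      have h4 := Real.pi_gt_three
      rw [invWeight_sq, div_le_one (by positivity)]
      nlinarith [mul_le_mul h4.le h3 (by norm_num) Real.pi_pos.le]
  have hmeas : AEStronglyMeasurable (inverseDensity f) volume := by
    have e : inverseDensity f = fun ξ => ‖(invWeight ξ : ℂ) * (𝓕 f : OneParticle ν) ξ‖ ^ 2 :=
      funext (inverseDensity_eq f)
    rw [e]
    exact (aestronglyMeasurable_weight _).norm.pow 2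
  have hnn : ∀ ξ, 0 ≤ inverseDensity f ξ := fun ξ => by
    rw [inverseDensity_eq]
    positivity
  have hint : Integrable (inverseDensity f) := hm.mono hmeas (by
    filter_upwards [hle] with ξ h
    rw [Real.norm_of_nonneg (hnn ξ)]
    exact h.trans (le_abs_self _))
  refine ⟨mem_formDomain_iff.mpr hint, ?_⟩
  have h1 : inverseForm f ≤ ∫ ξ, m ξ := integral_mono_ae hint hm hle
  have h2 : ∫ ξ, m ξ = (∫ ξ in Metric.ball (0 : Space ν) 1, invWeight ξ ^ 2) * I ^ 2 + ‖f‖ ^ 2 := by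
    rw [integral_add (hi1.mul_const _) hi2, integral_mul_const, integral_indicator measurableSet_ball,
      ← L2_norm_sq_eq_integral, Lp.norm_fourier_eq]
  have h3 : 0 ≤ ∫ ξ in Metric.ball (0 : Space ν) 1, invWeight ξ ^ 2 := by positivity
  rw [h2] at h1
  nlinarith [sq_nonneg I, sq_nonneg ‖f‖, mul_nonneg h3 (sq_nonneg ‖f‖)]

/-! ### The free Hamiltonian in Fourier space -/

theorem integrable_ofSchwartz (φ : 𝓢(Space ν, ℂ)) : Integrable (ofSchwartz φ : Space ν → ℂ) :=
  (φ.integrable (μ := volume)).congr (coeFn_ofSchwartz φ).symm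

theorem integrable_of_mem_localSpace {L : ℝ} {f : OneParticle ν} (hf : f ∈ localSpace ν L) :
    Integrable (f : Space ν → ℂ) := by
  have hf' : ∀ᵐ x, x ∉ box ν L → f x = 0 := hf
  have hfin : IsFiniteMeasure (volume.restrict (box ν L)) :=
    ⟨by rw [Measure.restrict_apply_univ]; exact (isCompact_box ν L).measure_lt_top⟩
  have h1 : IntegrableOn (f : Space ν → ℂ) (box ν L) :=
    ((Lp.memLp f).restrict (box ν L)).integrable (by norm_num)
  exact h1.integrable_of_ae_notMem_eq_zero hf'

theorem kinetic_add (φ ψ : 𝓢(Space ν, ℂ)) : kinetic (φ + ψ) = kinetic φ + kinetic ψ := by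
  simp only [kinetic_eq_sum, LineDeriv.lineDerivOp_add, Finset.sum_add_distrib, smul_add]

theorem kinetic_smul (c : ℂ) (φ : 𝓢(Space ν, ℂ)) : kinetic (c • φ) = c • kinetic φ := by
  simp only [kinetic_eq_sum, LineDeriv.lineDerivOp_smul, ← Finset.smul_sum]
  rw [smul_comm]

theorem fourier_kinetic_ae (φ : 𝓢(Space ν, ℂ)) :
    (𝓕 (ofSchwartz (kinetic φ)) : OneParticle ν) =ᵐ[volume]
      fun ξ => ((2 * Real.pi ^ 2 * ‖ξ‖ ^ 2 : ℝ) : ℂ) * (𝓕 (ofSchwartz φ) : OneParticle ν) ξ := by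
  rw [fourier_ofSchwartz, fourier_ofSchwartz]
  filter_upwards [coeFn_ofSchwartz (𝓕 (kinetic φ)), coeFn_ofSchwartz (𝓕 φ)] with ξ h1 h2
  rw [h1, h2, fourier_kinetic]

theorem integral_smul_fourier {g : Space ν → ℝ} (hg : ContDiff ℝ (⊤ : ℕ∞) g)
    (hgc : HasCompactSupport g) :
    ∃ φ : 𝓢(Space ν, ℂ), ∀ ξ, 𝓕 φ ξ = (g ξ : ℂ) := by
  have hc : HasCompactSupport fun x => (g x : ℂ) :=
    hgc.comp_left (g := fun y : ℝ => (y : ℂ)) (by simp)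
  have hs : ContDiff ℝ (⊤ : ℕ∞) fun x => (g x : ℂ) := Complex.ofRealCLM.contDiff.comp hg
  refine ⟨𝓕⁻ (hc.toSchwartzMap hs), fun ξ => ?_⟩
  rw [FourierTransform.fourier_fourierInv_eq]
  rfl

theorem inner_eq_integral_fourier (φ : 𝓢(Space ν, ℂ)) (f : OneParticle ν) :
    ⟪ofSchwartz φ, f⟫ = ∫ ξ, (starRingEnd ℂ) (𝓕 φ ξ) * (𝓕 f : OneParticle ν) ξ := by
  rw [← inner_fourier, fourier_ofSchwartz, inner_ofSchwartz]

theorem locallyIntegrable_lp (f : OneParticle ν) : LocallyIntegrable (f : Space ν → ℂ) volume :=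
  (Lp.memLp f).locallyIntegrable (by norm_num)

theorem locallyIntegrable_continuous_mul {c : Space ν → ℝ} (hc : Continuous c) (f : OneParticle ν) :
    LocallyIntegrable (fun ξ => (c ξ : ℂ) * f ξ) volume := by
  rw [← locallyIntegrableOn_univ]
  exact (locallyIntegrable_lp f).locallyIntegrableOn Set.univ |>.continuousOn_smul
    isOpen_univ.isLocallyClosed (Complex.continuous_ofReal.comp hc).continuousOn

/-- The free Hamiltonian is multiplication by `p²/2` in Fourier space. -/
theorem fourier_freeGraph {f u : OneParticle ν} (h : (f, u) ∈ freeGraph ν) :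
    (𝓕 u : OneParticle ν) =ᵐ[volume]
      fun ξ => ((2 * Real.pi ^ 2 * ‖ξ‖ ^ 2 : ℝ) : ℂ) * (𝓕 f : OneParticle ν) ξ := by
  have h' : IsDistribKinetic Set.univ f u := h
  refine ae_eq_of_integral_contDiff_smul_eq (locallyIntegrable_lp _)
    (locallyIntegrable_continuous_mul (by fun_prop) _) fun g hg hgc => ?_
  obtain ⟨φ, hφ⟩ := integral_smul_fourier hg hgc
  -- A function whose Fourier transform is a bump need not have compact support, so the
  -- distributional identity reaches it only through approximation in the graph norm.
  obtain ⟨t, h1, h2, h3⟩ := exists_test_approx φ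
  have key : ⟪ofSchwartz φ, u⟫ = ⟪ofSchwartz (kinetic φ), f⟫ := by
    refine tendsto_nhds_unique (h2.inner tendsto_const_nhds) ?_
    exact (h3.inner tendsto_const_nhds).congr fun j => (h' (t j) (h1 j)).symm
  rw [inner_eq_integral_fourier, inner_eq_integral_fourier] at key
  simp only [fourier_kinetic, hφ, map_mul, Complex.conj_ofReal] at key
  refine Eq.trans ?_ (key.trans ?_)
  · exact integral_congr_ae (Eventually.of_forall fun ξ => Complex.real_smul)
  · refine integral_congr_ae (Eventually.of_forall fun ξ => ?_)
    simp only [Complex.real_smul]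
    ring

/-- The kinetic energy functions lie in the form domain. -/
def kineticForm (hν : 3 ≤ ν) (φ : 𝓢(Space ν, ℂ)) : formDomain ν :=
  ⟨ofSchwartz (kinetic φ), ((exists_inverseForm_le hν).choose_spec.2 _
    (integrable_ofSchwartz (kinetic φ))).1⟩

/-! ### Duality between the form of `H⁻¹` and the Dirichlet energy -/

theorem inner_invSqrt_kineticForm (hν : 3 ≤ ν) (f : formDomain ν) (φ : 𝓢(Space ν, ℂ)) :
    ⟪invSqrt ν f, invSqrt ν (kineticForm hν φ)⟫ = ⟪(f : OneParticle ν), ofSchwartz φ⟫ :=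
  inner_invSqrt (by omega) f _ (fourier_kinetic_ae φ)

theorem norm_sq_invSqrt_kineticForm (hν : 3 ≤ ν) (φ : 𝓢(Space ν, ℂ)) :
    ‖invSqrt ν (kineticForm hν φ)‖ ^ 2 = (⟪ofSchwartz φ, ofSchwartz (kinetic φ)⟫).re := by
  rw [← inner_kinetic_left, ← inner_self_eq_norm_sq (𝕜 := ℂ), inner_invSqrt_kineticForm]
  rfl

/-- Write `⟨f, φ⟩ = ⟨H^(-1/2) f, H^(-1/2) (H φ)⟩` and apply Cauchy-Schwarz; the second factor is the
Dirichlet energy of `φ`. -/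
theorem norm_inner_test_sq_le (hν : 3 ≤ ν) (f : formDomain ν) (φ : 𝓢(Space ν, ℂ)) :
    ‖⟪(f : OneParticle ν), ofSchwartz φ⟫‖ ^ 2 ≤ inverseForm (f : OneParticle ν) *
      (1 / 2 * ∑ i : Fin ν, ‖ofSchwartz (∂_{EuclideanSpace.single i (1 : ℝ)} φ)‖ ^ 2) := by
  have h1 := norm_inner_le_norm (𝕜 := ℂ) (invSqrt ν f) (invSqrt ν (kineticForm hν φ))
  rw [inner_invSqrt_kineticForm] at h1
  refine (pow_le_pow_left₀ (norm_nonneg _) h1 2).trans_eq ?_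
  rw [mul_pow, norm_sq_invSqrt, norm_sq_invSqrt_kineticForm, inner_kinetic]
  congr 1
  have : (1 / 2 * ∑ i : Fin ν, ⟪ofSchwartz (∂_{EuclideanSpace.single i (1 : ℝ)} φ),
      ofSchwartz (∂_{EuclideanSpace.single i (1 : ℝ)} φ)⟫ : ℂ) =
      ((1 / 2 * ∑ i : Fin ν, ‖ofSchwartz (∂_{EuclideanSpace.single i (1 : ℝ)} φ)‖ ^ 2 : ℝ) : ℂ) := by
    simp only [inner_self_eq_norm_sq_to_K]
    push_cast
    rfl
  rw [this, Complex.ofReal_re]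

theorem HasDirichletGrad.norm_inner_sq_le (hν : 3 ≤ ν) (f : formDomain ν) {L : ℝ}
    {w : OneParticle ν} {G : Fin ν → OneParticle ν} (h : HasDirichletGrad L w G) :
    ‖⟪(f : OneParticle ν), w⟫‖ ^ 2 ≤ inverseForm (f : OneParticle ν) *
      (1 / 2 * ∑ i, ‖G i‖ ^ 2) := by
  obtain ⟨φ, -, h2, h3⟩ := h
  have e1 : Tendsto (fun n => ⟪(f : OneParticle ν), ofSchwartz (φ n)⟫) atTop
      (𝓝 ⟪(f : OneParticle ν), w⟫) := tendsto_const_nhds.inner h2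
  refine le_of_tendsto_of_tendsto (e1.norm.pow 2) ?_
    (Eventually.of_forall fun n => norm_inner_test_sq_le hν f (φ n))
  exact ((tendsto_finsetSum _ fun i _ => (h3 i).norm.pow 2).const_mul _).const_mul _

/-- The images of the functions `Hg`, `g` a test function, under the square root of `H⁻¹`. -/
def testKinetic (hν : 3 ≤ ν) : Submodule ℂ (OneParticle ν) where
  carrier := {h | ∃ g, IsTest Set.univ g ∧ invSqrt ν (kineticForm hν g) = h}
  add_mem' := by
    rintro _ _ ⟨g, hg, rfl⟩ ⟨k, hk, rfl⟩
    refine ⟨g + k, hg.add hk, ?_⟩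
    rw [← map_add]
    congr 1
    refine Subtype.ext ?_
    change ofSchwartz (kinetic (g + k)) = ofSchwartz (kinetic g) + ofSchwartz (kinetic k)
    rw [kinetic_add, ofSchwartz_add]
  zero_mem' := by
    refine ⟨0, isTest_zero, ?_⟩
    rw [← map_zero (invSqrt ν)]
    congr 1
    refine Subtype.ext ?_
    have := kinetic_smul (0 : ℂ) (0 : 𝓢(Space ν, ℂ))
    rw [zero_smul, zero_smul] at this
    change ofSchwartz (kinetic 0) = 0
    rw [this, ofSchwartz_zero]
  smul_mem' := by
    rintro c _ ⟨g, hg, rfl⟩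
    refine ⟨c • g, hg.smul c, ?_⟩
    rw [← map_smul]
    congr 1
    refine Subtype.ext ?_
    change ofSchwartz (kinetic (c • g)) = c • ofSchwartz (kinetic g)
    rw [kinetic_smul, ofSchwartz_smul]

theorem kineticForm_sub (hν : 3 ≤ ν) (φ ψ : 𝓢(Space ν, ℂ)) :
    kineticForm hν φ - kineticForm hν ψ = kineticForm hν (φ + (-1 : ℂ) • ψ) := by
  refine Subtype.ext ?_
  change ofSchwartz (kinetic φ) - ofSchwartz (kinetic ψ) = ofSchwartz (kinetic (φ + (-1 : ℂ) • ψ))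
  rw [kinetic_add, kinetic_smul, ofSchwartz_add, ofSchwartz_smul, neg_one_smul, sub_eq_add_neg]

/-- The squared distance is the pairing of `t_j - φ` with its kinetic image, and both factors tend
to zero. -/
theorem tendsto_invSqrt_kineticForm (hν : 3 ≤ ν) {t : ℕ → 𝓢(Space ν, ℂ)} {φ : 𝓢(Space ν, ℂ)}
    (h2 : Tendsto (fun j => ofSchwartz (t j)) atTop (𝓝 (ofSchwartz φ)))
    (h3 : Tendsto (fun j => ofSchwartz (kinetic (t j))) atTop (𝓝 (ofSchwartz (kinetic φ)))) :
    Tendsto (fun j => invSqrt ν (kineticForm hν (t j))) atTop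
      (𝓝 (invSqrt ν (kineticForm hν φ))) := by
  rw [tendsto_iff_norm_sub_tendsto_zero]
  have h4 : ∀ j, ‖invSqrt ν (kineticForm hν (t j)) - invSqrt ν (kineticForm hν φ)‖ ^ 2 =
      (⟪ofSchwartz (t j) - ofSchwartz φ,
        ofSchwartz (kinetic (t j)) - ofSchwartz (kinetic φ)⟫).re := fun j => by
    rw [← map_sub, kineticForm_sub, norm_sq_invSqrt_kineticForm, kinetic_add, kinetic_smul,
      ofSchwartz_add, ofSchwartz_smul, ofSchwartz_add, ofSchwartz_smul]
    simp only [neg_one_smul, ← sub_eq_add_neg]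
  have h5 := (h2.sub_const (ofSchwartz φ)).inner (𝕜 := ℂ) (h3.sub_const (ofSchwartz (kinetic φ)))
  rw [sub_self, inner_zero_left] at h5
  have h6 := (Complex.continuous_re.tendsto _).comp h5
  have h7 := (Real.continuous_sqrt.tendsto _).comp (h6.congr fun j => (h4 j).symm)
  simpa [Function.comp_def, Real.sqrt_sq] using h7

/-- The image of `H φ` is `√2 π |ξ| φ̂`. A vector orthogonal to the images of test functions is, by
graph-norm approximation, orthogonal to those of all Schwartz functions. Letting `φ̂` run through
the real bump functions shows that `|ξ| h` vanishes almost everywhere. -/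
theorem dense_testKinetic (hν : 3 ≤ ν) : (testKinetic hν).topologicalClosure = ⊤ := by
  rw [Submodule.topologicalClosure_eq_top_iff, Submodule.eq_bot_iff]
  intro h hh
  have h1 : ∀ φ : 𝓢(Space ν, ℂ), ⟪invSqrt ν (kineticForm hν φ), h⟫ = 0 := by
    intro φ
    obtain ⟨t, k1, k2, k3⟩ := exists_test_approx φ
    refine tendsto_nhds_unique ((tendsto_invSqrt_kineticForm hν k2 k3).inner tendsto_const_nhds) ?_
    refine tendsto_const_nhds.congr fun j => ?_
    exact ((Submodule.mem_orthogonal _ _).mp hh _ ⟨t j, k1 j, rfl⟩).symm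
  have h2 : ∀ᵐ ξ, ((√2 * Real.pi * ‖ξ‖ : ℝ) : ℂ) * h ξ = 0 := by
    refine ae_eq_zero_of_integral_contDiff_smul_eq_zero
      (locallyIntegrable_continuous_mul (by fun_prop) _) fun g hg hgc => ?_
    obtain ⟨φ, hφ⟩ := integral_smul_fourier hg hgc
    rw [← h1 φ, L2.inner_def]
    refine integral_congr_ae ?_
    filter_upwards [coeFn_invSqrt (kineticForm hν φ), fourier_kinetic_ae φ,
      coeFn_ofSchwartz (𝓕 φ), ae_ne_zero (ν := ν) (by omega)] with ξ e1 e2 e3 e4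
    have e5 : (𝓕 (ofSchwartz φ) : OneParticle ν) ξ = (g ξ : ℂ) := by
      rw [fourier_ofSchwartz, e3, hφ]
    have e6 : (𝓕 (kineticForm hν φ : OneParticle ν) : OneParticle ν) ξ =
        ((2 * Real.pi ^ 2 * ‖ξ‖ ^ 2 : ℝ) : ℂ) * (g ξ : ℂ) := by
      rw [← e5]
      exact e2
    have e7 : invWeight ξ * (2 * Real.pi ^ 2 * ‖ξ‖ ^ 2) = √2 * Real.pi * ‖ξ‖ := by
      have := norm_ne_zero_iff.mpr e4
      have := Real.pi_ne_zero
      unfold invWeight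
      field_simp
    rw [e1, e6, RCLike.inner_apply, Complex.real_smul, ← e7]
    simp only [map_mul, Complex.conj_ofReal, Complex.ofReal_mul]
    ring
  refine Lp.eq_zero_iff_ae_eq_zero.mpr ?_
  filter_upwards [h2, ae_ne_zero (ν := ν) (by omega)] with ξ e1 e2
  refine (mul_eq_zero.mp e1).resolve_left ?_
  have := norm_pos_iff.mpr e2
  have : √2 * Real.pi * ‖ξ‖ ≠ 0 := by positivity
  exact_mod_cast this

/-- Functions in the form domain are approximated by `Hg`, `g` a test function. -/
theorem exists_test_inverseForm_lt (hν : 3 ≤ ν) (f : formDomain ν) {ε : ℝ} (hε : 0 < ε) :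
    ∃ g : 𝓢(Space ν, ℂ), IsTest Set.univ g ∧ ‖invSqrt ν (f - kineticForm hν g)‖ < ε := by
  have h : invSqrt ν f ∈ (testKinetic hν).topologicalClosure := by
    rw [dense_testKinetic]
    trivial
  obtain ⟨_, ⟨g, hg, rfl⟩, hlt⟩ := Metric.mem_closure_iff.mp h ε hε
  refine ⟨g, hg, ?_⟩
  rwa [map_sub, ← dist_eq_norm]

/-! ### The thermodynamic limit of the quadratic forms -/

theorem boxEnergy_eq (L : ℝ) (n : Fin ν → ℕ) :
    boxEnergy L n = Real.pi ^ 2 / (8 * L ^ 2) * ∑ i, ((n i : ℝ) + 1) ^ 2 := by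
  unfold boxEnergy dirichletEnergy
  rw [Finset.mul_sum, Finset.mul_sum]
  refine Finset.sum_congr rfl fun i _ => ?_
  push_cast
  ring

theorem groundEnergy_eq (ν : ℕ) (L : ℝ) : groundEnergy ν L = Real.pi ^ 2 / (8 * L ^ 2) * ν := by
  have h : groundEnergy ν L = boxEnergy L (0 : Fin ν → ℕ) := rfl
  rw [h, boxEnergy_eq]
  simp

theorem tendsto_groundEnergy (ν : ℕ) : Tendsto (groundEnergy ν) atTop (𝓝 0) := by
  have h : groundEnergy ν = fun L => Real.pi ^ 2 / 8 * ν * (L⁻¹ * L⁻¹) := by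
    funext L
    rw [groundEnergy_eq]
    field_simp
  rw [h]
  have := ((tendsto_inv_atTop_zero (𝕜 := ℝ)).mul tendsto_inv_atTop_zero).const_mul
    (Real.pi ^ 2 / 8 * (ν : ℝ))
  simpa using this

theorem groundEnergy_pos (hν : 0 < ν) {L : ℝ} (hL : 0 < L) : 0 < groundEnergy ν L := by
  rw [groundEnergy_eq]
  have := Real.pi_pos
  have : (0 : ℝ) < ν := by exact_mod_cast hν
  positivity

theorem boxEnergy_nonneg (L : ℝ) (n : Fin ν → ℕ) : 0 ≤ boxEnergy L n := by
  rw [boxEnergy_eq]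
  positivity

/-- The excited energies are separated from the chemical potential. -/
theorem boxEnergy_le_mul_sub {L μ : ℝ} (hμ : μ < groundEnergy ν L) {n : Fin ν → ℕ} (hn : n ≠ 0) :
    boxEnergy L n ≤ (((ν : ℝ) + 3) / 3) * (boxEnergy L n - μ) := by
  obtain ⟨j, hj⟩ := Function.ne_iff.mp hn
  have hj' : (1 : ℝ) ≤ n j := by exact_mod_cast Nat.one_le_iff_ne_zero.mpr hj
  -- One quantum number is at least two, so one square is at least four and the others at least one.
  -- Then `S - ν ≥ 3 S / (ν + 3)`, which is the constant in the statement, independent of `L` and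
  -- `μ`.
  have hS : (ν : ℝ) + 3 ≤ ∑ i, ((n i : ℝ) + 1) ^ 2 := by
    have h1 : ∑ i, ((n i : ℝ) + 1) ^ 2 = ((n j : ℝ) + 1) ^ 2 +
        ∑ i ∈ Finset.univ.erase j, ((n i : ℝ) + 1) ^ 2 :=
      (Finset.add_sum_erase _ _ (Finset.mem_univ j)).symm
    have h2 : ∑ i ∈ Finset.univ.erase j, (1 : ℝ) ≤
        ∑ i ∈ Finset.univ.erase j, ((n i : ℝ) + 1) ^ 2 :=
      Finset.sum_le_sum fun i _ => by
        have : (0 : ℝ) ≤ n i := Nat.cast_nonneg _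
        nlinarith
    have h3 : ∑ i : Fin ν, (1 : ℝ) = 1 + ∑ i ∈ Finset.univ.erase j, (1 : ℝ) :=
      (Finset.add_sum_erase _ _ (Finset.mem_univ j)).symm
    have h4 : ∑ i : Fin ν, (1 : ℝ) = ν := by simp
    nlinarith
  have hk : 0 ≤ Real.pi ^ 2 / (8 * L ^ 2) := by positivity
  rw [groundEnergy_eq] at hμ
  rw [boxEnergy_eq]
  set κ := Real.pi ^ 2 / (8 * L ^ 2)
  set S := ∑ i, ((n i : ℝ) + 1) ^ 2
  have hν : (0 : ℝ) ≤ ν := Nat.cast_nonneg ν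
  have h5 : κ * S ≤ ((ν : ℝ) + 3) / 3 * (κ * S - κ * ν) := by
    have : 0 ≤ κ * ν * (S - (ν + 3)) := by
      refine mul_nonneg (by positivity) (by linarith)
    nlinarith
  refine h5.trans (mul_le_mul_of_nonneg_left (by linarith) (by positivity))

/-- The contribution of the excited modes to the finite-volume form. -/
def excitedForm (L μ : ℝ) (f : OneParticle ν) : ℝ :=
  ∑' n, if n = 0 then 0 else ‖modeCoeff L n f‖ ^ 2 / (boxEnergy L n - μ)

/-- The square root of the excited part of the resolvent. -/
def excitedFactor (L μ : ℝ) (n : Fin ν → ℕ) : ℂ :=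
  if n = 0 then 0 else ((√(boxEnergy L n - μ) : ℝ) : ℂ)⁻¹

theorem norm_excitedFactor_le {L μ : ℝ} (hμ : μ < groundEnergy ν L) (n : Fin ν → ℕ) :
    ‖excitedFactor L μ n‖ ≤ (√(groundEnergy ν L - μ))⁻¹ := by
  unfold excitedFactor
  split_ifs
  · rw [norm_zero]
    positivity
  · have := norm_gibbs_factor_le one_pos hμ n
    simpa only [one_mul] using this

theorem norm_sq_excitedFactor_mul {L μ : ℝ} (hμ : μ < groundEnergy ν L) (n : Fin ν → ℕ) (z : ℂ) :
    ‖excitedFactor L μ n * z‖ ^ 2 = if n = 0 then 0 else ‖z‖ ^ 2 / (boxEnergy L n - μ) := by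
  unfold excitedFactor
  split_ifs
  · simp
  · rw [norm_mul, mul_pow, norm_inv, Complex.norm_real, Real.norm_of_nonneg (Real.sqrt_nonneg _),
      inv_pow, Real.sq_sqrt (boxEnergy_sub_pos hμ n).le]
    ring

theorem hasSum_norm_sq_gibbsMap {L C : ℝ} (hL : 0 < L) {c : (Fin ν → ℕ) → ℂ}
    (hc : ∀ n, ‖c n‖ ≤ C) (f : localSpace ν L) :
    HasSum (fun n => ‖c n * modeCoeff L n (f : OneParticle ν)‖ ^ 2) (‖gibbsMap hL hc f‖ ^ 2) := by
  have h2 := lp.hasSum_norm (p := 2) (by norm_num) (gibbsMap hL hc f)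
  simp only [ENNReal.toReal_ofNat, Real.rpow_ofNat] at h2
  exact h2

theorem hasSum_excitedForm {L μ : ℝ} (hL : 0 < L) (hμ : μ < groundEnergy ν L)
    (f : localSpace ν L) :
    HasSum (fun n => if n = 0 then 0 else
      ‖modeCoeff L n (f : OneParticle ν)‖ ^ 2 / (boxEnergy L n - μ))
      (‖gibbsMap hL (norm_excitedFactor_le hμ) f‖ ^ 2) := by
  have h := hasSum_norm_sq_gibbsMap hL (norm_excitedFactor_le hμ) f
  simpa only [norm_sq_excitedFactor_mul hμ] using h

theorem excitedForm_eq {L μ : ℝ} (hL : 0 < L) (hμ : μ < groundEnergy ν L) (f : localSpace ν L) :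
    excitedForm L μ (f : OneParticle ν) = ‖gibbsMap hL (norm_excitedFactor_le hμ) f‖ ^ 2 :=
  (hasSum_excitedForm hL hμ f).tsum_eq

/-- Domain monotonicity: the Dirichlet form is dominated by the form of the whole space. -/
theorem excitedForm_le (hν : 3 ≤ ν) {L μ : ℝ} (hL : 0 < L) (hμ : μ < groundEnergy ν L)
    {f : OneParticle ν} (hf : f ∈ localSpace ν L) (hf' : f ∈ formDomain ν) :
    excitedForm L μ f ≤ ((ν : ℝ) + 3) / 3 * inverseForm f := by
  -- The comparison is made first at zero chemical potential: `u = H_L⁻¹ f`, and `S = ⟨f, u⟩` is the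
  -- Dirichlet energy of `u`.
  obtain ⟨u, hul, hu⟩ := exists_resolvent (μ := 0) hL (groundEnergy_pos (by omega) hL) ⟨f, hf⟩
  have hg := shift_mem_graph u
  rw [hu] at hg
  simp only [Complex.ofReal_zero, zero_smul, add_zero] at hg
  have hc := ((mem_dirichletGraph_iff hL).mp hg).2.2
  have hpos : ∀ n, 0 < boxEnergy L n := fun n => by
    have := boxEnergy_sub_pos (groundEnergy_pos (ν := ν) (by omega) hL) n
    linarith
  have hsum : HasSum (fun n => ‖modeCoeff L n f‖ ^ 2 / boxEnergy L n)
      (⟪f, (u : OneParticle ν)⟫).re := by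
    have h1 := Complex.reCLM.hasSum (hasSum_inner_modeCoeff hL hf hul)
    convert! h1 using 1
    funext n
    have h2 : ((boxEnergy L n : ℝ) : ℂ) ≠ 0 := by exact_mod_cast (hpos n).ne'
    have h3 : modeCoeff L n (u : OneParticle ν) = modeCoeff L n f / boxEnergy L n := by
      rw [hc n]
      field_simp
    rw [h3, mul_div_assoc', conj_mul_self_eq, ← Complex.ofReal_div]
    exact (Complex.ofReal_re _).symm
  set S : ℝ := (⟪f, (u : OneParticle ν)⟫).re with hS
  have hS0 : 0 ≤ S := hsum.nonneg fun n => by have := hpos n; positivity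
  obtain ⟨G, hG⟩ := isH10_iff.mp hg.1
  have h4 := hG.norm_sq_eq hg.2.2
  have h5 := hG.norm_inner_sq_le hν ⟨f, hf'⟩
  have h6 : (⟪(u : OneParticle ν), f⟫).re = S := by
    rw [hS, ← inner_conj_symm, Complex.conj_re]
  rw [← h4, h6] at h5
  have h7 : S ≤ ‖⟪f, (u : OneParticle ν)⟫‖ := Complex.re_le_norm _
  -- Duality gives `S² ≤ ⟨f, H⁻¹ f⟩ S`; divide by `S` when it is positive.
  have h8 : S ≤ inverseForm f := by
    rcases hS0.eq_or_lt with h0 | h0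
    · rw [← h0]
      have := norm_sq_invSqrt ⟨f, hf'⟩
      have h9 : inverseForm f = ‖invSqrt ν ⟨f, hf'⟩‖ ^ 2 := this.symm
      rw [h9]
      positivity
    · have : S * S ≤ inverseForm f * S := by
        refine le_trans ?_ h5
        rw [← sq]
        exact pow_le_pow_left₀ hS0 h7 2
      exact le_of_mul_le_mul_right this h0
  rw [excitedForm_eq hL hμ ⟨f, hf⟩]
  have hC : (0 : ℝ) ≤ ((ν : ℝ) + 3) / 3 := by positivity
  refine (hasSum_le (fun n => ?_) (hasSum_excitedForm hL hμ ⟨f, hf⟩)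
    (hsum.mul_left (((ν : ℝ) + 3) / 3))).trans (mul_le_mul_of_nonneg_left h8 hC)
  split_ifs with hn
  · have := hpos n
    positivity
  · have h10 := boxEnergy_le_mul_sub hμ hn
    have h11 := boxEnergy_sub_pos hμ n
    have h12 := hpos n
    rw [mul_div_assoc', div_le_div_iff₀ h11 h12]
    nlinarith [sq_nonneg ‖modeCoeff L n f‖]

theorem IsTest.kinetic {U : Set (Space ν)} {φ : 𝓢(Space ν, ℂ)} (h : IsTest U φ) :
    IsTest U (kinetic φ) := by
  rw [kinetic_eq_sum]
  refine IsTest.smul _ ?_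
  refine Finset.sum_induction _ (IsTest U) (fun _ _ => IsTest.add) isTest_zero fun i _ => ?_
  exact isTest_lineDeriv (isTest_lineDeriv h _) _

theorem IsTest.mem_dirichletGraph {L : ℝ} {φ : 𝓢(Space ν, ℂ)} (h : IsTest (openBox ν L) φ) :
    (ofSchwartz φ, ofSchwartz (ClassicalBose.kinetic φ)) ∈ dirichletGraph ν L :=
  ⟨⟨fun _ => φ, fun _ => h, tendsto_const_nhds, fun _ => cauchySeq_const _⟩,
    h.kinetic.mem_localSpace, fun ψ _ => (inner_kinetic_left ψ φ).symm⟩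

/-- Summation over modes of `E² / (E - μ) = E + μ + μ² / (E - μ)`. The last term corrects for the
ground mode, which the excited form omits. -/
theorem excitedForm_kinetic {L μ : ℝ} (hL : 0 < L) (hμ : μ < groundEnergy ν L)
    {g : 𝓢(Space ν, ℂ)} (hg : IsTest (openBox ν L) g) :
    excitedForm L μ (ofSchwartz (kinetic g)) =
      (⟪ofSchwartz g, ofSchwartz (kinetic g)⟫).re + μ * ‖ofSchwartz g‖ ^ 2 +
        μ ^ 2 * excitedForm L μ (ofSchwartz g) -
        (groundEnergy ν L + μ) * ‖modeCoeff L 0 (ofSchwartz g)‖ ^ 2 := by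
  have hgl := hg.mem_localSpace
  have hkl := hg.kinetic.mem_localSpace
  have hc := ((mem_dirichletGraph_iff hL).mp hg.mem_dirichletGraph).2.2
  have h1 : HasSum (fun n => boxEnergy L n * ‖modeCoeff L n (ofSchwartz g)‖ ^ 2)
      (⟪ofSchwartz g, ofSchwartz (kinetic g)⟫).re := by
    have h := Complex.reCLM.hasSum (hasSum_inner_modeCoeff hL hgl hkl)
    convert! h using 1
    funext n
    rw [hc n, mul_left_comm, conj_mul_self_eq, ← Complex.ofReal_mul]
    exact (Complex.ofReal_re _).symm
  have h2 := (hasSum_norm_sq_modeCoeff hL hgl).mul_left μ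
  have h3 := (hasSum_excitedForm hL hμ ⟨_, hgl⟩).mul_left (μ ^ 2)
  rw [← excitedForm_eq hL hμ] at h3
  have h4 := hasSum_ite_eq (0 : Fin ν → ℕ)
    ((groundEnergy ν L + μ) * ‖modeCoeff L 0 (ofSchwartz g)‖ ^ 2)
  have h5 := ((h1.add h2).add h3).sub h4
  refine HasSum.tsum_eq ?_
  convert! h5 using 1
  funext n
  by_cases hn : n = 0
  · subst hn
    have : groundEnergy ν L = boxEnergy L (0 : Fin ν → ℕ) := rfl
    simp only [if_true, this]
    ring
  · simp only [if_neg hn]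
    have h6 := (boxEnergy_sub_pos hμ n).ne'
    rw [hc n, norm_mul, Complex.norm_real, Real.norm_of_nonneg (boxEnergy_nonneg L n)]
    field_simp
    ring

theorem norm_modeCoeff_le {L : ℝ} (hL : 0 < L) (n : Fin ν → ℕ) (f : OneParticle ν) :
    ‖modeCoeff L n f‖ ≤ ‖f‖ := by
  have h := norm_inner_le_norm (𝕜 := ℂ) (dirichletMode L n : OneParticle ν) f
  have h2 : ‖(dirichletMode L n : OneParticle ν)‖ = 1 := (orthonormal_dirichletMode hL).1 n
  rwa [h2, one_mul] at h

theorem exists_subset_openBox {K : Set (Space ν)} (hK : IsCompact K) :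
    ∃ L₀ : ℝ, 0 < L₀ ∧ ∀ L, L₀ ≤ L → K ⊆ openBox ν L := by
  obtain ⟨R, hR⟩ := hK.isBounded.exists_norm_le
  refine ⟨max R 0 + 1, by positivity, fun L hL x hx i => ?_⟩
  have h1 : |x i| ≤ ‖x‖ := PiLp.norm_apply_le x i
  have h2 := (abs_le.mp (h1.trans (hR x hx)))
  have h3 := le_max_left R 0
  exact ⟨by linarith, by linarith⟩

/-- In the explicit formula every term but the energy of `g` carries a factor `μ`, `μ²` or `E₀(L) +
μ`, which tends to zero, times a quantity that stays bounded. -/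
theorem tendsto_excitedForm_kinetic (hν : 3 ≤ ν) {μ : ℝ → ℝ}
    (hμ : ∀ L, 0 < L → μ L < groundEnergy ν L) (hμ0 : Tendsto μ atTop (𝓝 0))
    {g : 𝓢(Space ν, ℂ)} (hg : IsTest Set.univ g) :
    Tendsto (fun L => excitedForm L (μ L) (ofSchwartz (kinetic g))) atTop
      (𝓝 (⟪ofSchwartz g, ofSchwartz (kinetic g)⟫).re) := by
  obtain ⟨L₀, hL₀, hsub⟩ := exists_subset_openBox hg.1
  have hgf := ((exists_inverseForm_le hν).choose_spec.2 _ (integrable_ofSchwartz g)).1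
  have hbd1 : ∀ᶠ L in atTop, ‖excitedForm L (μ L) (ofSchwartz g)‖ ≤
      ((ν : ℝ) + 3) / 3 * inverseForm (ofSchwartz g) := by
    filter_upwards [eventually_ge_atTop L₀] with L hL
    have hL0 := hL₀.trans_le hL
    have hgt : IsTest (openBox ν L) g := ⟨hg.1, hsub L hL⟩
    have h := excitedForm_le hν hL0 (hμ L hL0) hgt.mem_localSpace hgf
    rwa [Real.norm_of_nonneg]
    have := excitedForm_eq hL0 (hμ L hL0) ⟨_, hgt.mem_localSpace⟩
    change excitedForm L (μ L) (ofSchwartz g) = _ at this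
    rw [this]
    positivity
  have hbd2 : ∀ᶠ L in atTop, ‖‖modeCoeff L 0 (ofSchwartz g)‖ ^ 2‖ ≤ ‖ofSchwartz g‖ ^ 2 := by
    filter_upwards [eventually_gt_atTop 0] with L hL
    rw [Real.norm_of_nonneg (sq_nonneg _)]
    exact pow_le_pow_left₀ (norm_nonneg _) (norm_modeCoeff_le hL 0 _) 2
  have h1 : Tendsto (fun L => μ L ^ 2 * excitedForm L (μ L) (ofSchwartz g)) atTop (𝓝 0) := by
    have : Tendsto (fun L => μ L ^ 2) atTop (𝓝 0) := by simpa using hμ0.pow 2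
    exact this.zero_mul_isBoundedUnder_le (isBoundedUnder_of_eventually_le hbd1)
  have h2 : Tendsto (fun L => (groundEnergy ν L + μ L) * ‖modeCoeff L 0 (ofSchwartz g)‖ ^ 2)
      atTop (𝓝 0) := by
    have : Tendsto (fun L => groundEnergy ν L + μ L) atTop (𝓝 0) := by
      simpa using (tendsto_groundEnergy ν).add hμ0
    exact this.zero_mul_isBoundedUnder_le (isBoundedUnder_of_eventually_le hbd2)
  have h3 := (((hμ0.mul_const (‖ofSchwartz g‖ ^ 2)).const_add
    (⟪ofSchwartz g, ofSchwartz (kinetic g)⟫).re).add h1).sub h2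
  rw [zero_mul, add_zero, add_zero, sub_zero] at h3
  refine h3.congr' ?_
  filter_upwards [eventually_ge_atTop L₀] with L hL
  have hL0 := hL₀.trans_le hL
  exact (excitedForm_kinetic hL0 (hμ L hL0) ⟨hg.1, hsub L hL⟩).symm

theorem localUnion_le_formDomain (hν : 3 ≤ ν) : localUnion ν ≤ formDomain ν := by
  rintro f ⟨L, -, hf⟩
  exact ((exists_inverseForm_le hν).choose_spec.2 f (integrable_of_mem_localSpace hf)).1

theorem inverseForm_eq_norm_sq {f : OneParticle ν} (hf : f ∈ formDomain ν) :
    inverseForm f = ‖invSqrt ν ⟨f, hf⟩‖ ^ 2 := (norm_sq_invSqrt ⟨f, hf⟩).symm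

/-- The finite-volume forms of the excited modes converge to the form of `H⁻¹`. -/
theorem tendsto_excitedForm (hν : 3 ≤ ν) {μ : ℝ → ℝ}
    (hμ : ∀ L, 0 < L → μ L < groundEnergy ν L) (hμ0 : Tendsto μ atTop (𝓝 0))
    {f : OneParticle ν} (hf : f ∈ localUnion ν) :
    Tendsto (fun L => excitedForm L (μ L) f) atTop (𝓝 (inverseForm f)) := by
  have hff := localUnion_le_formDomain hν hf
  obtain ⟨L₁, hL₁, hfl⟩ := hf
  set N : ℝ := ‖invSqrt ν ⟨f, hff⟩‖ with hN
  set C : ℝ := √(((ν : ℝ) + 3) / 3) with hC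
  -- The square roots are seminorms dominated, uniformly in `L`, by `C` times the norm of `invSqrt`.
  -- Convergence therefore extends from the dense set of `H g` to `f`; the tolerance is chosen so
  -- that the two errors, `C δ` and `δ`, add up to `ε / 2`.
  have key : Tendsto (fun L => √(excitedForm L (μ L) f)) atTop (𝓝 N) := by
    rw [Metric.tendsto_atTop']
    intro ε hε
    obtain ⟨g, hg, hlt⟩ := exists_test_inverseForm_lt hν ⟨f, hff⟩
      (show 0 < ε / (2 * (C + 1)) by positivity)
    set δ : ℝ := ε / (2 * (C + 1)) with hδ
    set k : OneParticle ν := ofSchwartz (kinetic g) with hk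
    have hkN := norm_sq_invSqrt_kineticForm hν g
    have h1 : Tendsto (fun L => √(excitedForm L (μ L) k)) atTop
        (𝓝 ‖invSqrt ν (kineticForm hν g)‖) := by
      have := (Real.continuous_sqrt.tendsto _).comp (tendsto_excitedForm_kinetic hν hμ hμ0 hg)
      rwa [← hkN, Real.sqrt_sq (norm_nonneg _)] at this
    obtain ⟨L₀, hL₀, hsub⟩ := exists_subset_openBox hg.1
    obtain ⟨L₂, hL₂⟩ := (Metric.tendsto_atTop'.mp h1) (ε / 2) (by positivity)
    refine ⟨max L₂ (max L₀ L₁), fun L hL => ?_⟩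
    have hLL2 : L₂ < L := (le_max_left _ _).trans_lt hL
    have hLL0 : L₀ < L := ((le_max_left _ _).trans (le_max_right _ _)).trans_lt hL
    have hLL1 : L₁ < L := ((le_max_right _ _).trans (le_max_right _ _)).trans_lt hL
    have hL0 : 0 < L := hL₀.trans hLL0
    have hfL : f ∈ localSpace ν L := localSpace_mono hLL1.le hfl
    have hgt : IsTest (openBox ν L) g := ⟨hg.1, hsub L hLL0.le⟩
    have hkL : k ∈ localSpace ν L := hgt.kinetic.mem_localSpace
    let F : localSpace ν L := ⟨f, hfL⟩
    let K : localSpace ν L := ⟨k, hkL⟩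
    let T := gibbsMap hL0 (norm_excitedFactor_le (hμ L hL0))
    have e : ∀ u : localSpace ν L, √(excitedForm L (μ L) (u : OneParticle ν)) = ‖T u‖ := fun u => by
      rw [excitedForm_eq hL0 (hμ L hL0), Real.sqrt_sq (norm_nonneg _)]
    have e1 : √(excitedForm L (μ L) f) = ‖T F‖ := e F
    have e2 : √(excitedForm L (μ L) k) = ‖T K‖ := e K
    have hd : f - k ∈ formDomain ν := (formDomain ν).sub_mem hff (kineticForm hν g).2
    have h2 : ‖T (F - K)‖ ≤ C * δ := by
      rw [← e]
      have h3 := excitedForm_le hν hL0 (hμ L hL0) (F - K).2 hd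
      have h4 : inverseForm ((F - K : localSpace ν L) : OneParticle ν) ≤ δ ^ 2 := by
        refine (inverseForm_eq_norm_sq hd).trans_le ?_
        exact pow_le_pow_left₀ (norm_nonneg _) hlt.le 2
      refine (Real.sqrt_le_sqrt (h3.trans (mul_le_mul_of_nonneg_left h4 (by positivity)))).trans_eq ?_
      rw [Real.sqrt_mul (by positivity), Real.sqrt_sq (by positivity)]
    have h3 : |‖T F‖ - ‖T K‖| ≤ C * δ := by
      rw [map_sub] at h2
      exact (abs_norm_sub_norm_le _ _).trans h2
    have h4 : |N - ‖invSqrt ν (kineticForm hν g)‖| < δ := by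
      rw [map_sub] at hlt
      exact (abs_norm_sub_norm_le _ _).trans_lt hlt
    have h5 := hL₂ L hLL2
    rw [Real.dist_eq, e2] at h5
    rw [Real.dist_eq, e1]
    have h6 : (C + 1) * δ = ε / 2 := by
      have hC1 : C + 1 ≠ 0 := by positivity
      rw [hδ]
      field_simp
    have h7 := abs_le.mp h3
    have h8 := abs_lt.mp h4
    have h9 := abs_lt.mp h5
    rw [abs_lt]
    constructor <;> linarith [h7.1, h7.2, h8.1, h8.2, h9.1, h9.2]
  have h1 := key.pow 2
  rw [inverseForm_eq_norm_sq hff]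
  refine h1.congr' ?_
  filter_upwards [eventually_ge_atTop L₁] with L hL
  have hL0 := hL₁.trans_le hL
  have := excitedForm_eq hL0 (hμ L hL0) ⟨f, localSpace_mono hL hfl⟩
  change excitedForm L (μ L) f = _ at this
  rw [Real.sq_sqrt]
  rw [this]
  positivity

/-! ### The condensate and the limit of the Gibbs states -/

theorem modeCoeff_zero_eq {L : ℝ} {f : OneParticle ν} (hf : f ∈ localSpace ν L) :
    modeCoeff L 0 f = ((√L ^ ν)⁻¹ : ℂ) * ∫ x, (boxMode L 0 x : ℂ) * f x := by
  have hf' : ∀ᵐ x, x ∉ box ν L → f x = 0 := hf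
  have h : ∫ x in openBox ν L, (boxMode L 0 x : ℂ) * f x = ∫ x, (boxMode L 0 x : ℂ) * f x := by
    refine setIntegral_eq_integral_of_ae_compl_eq_zero ?_
    filter_upwards [hf', ae_openBox_iff_box ν L] with x h1 h2 hx
    rw [h1 fun hb => hx (h2 hb), mul_zero]
  change ⟪((√L ^ ν)⁻¹ : ℂ) • boxLp L (boxMode L 0), f⟫ = _
  rw [inner_smul_left, inner_boxLp, h]
  congr 1
  simp

/-- At fixed `y` the argument `π (y + L) / (2 L)` tends to `π / 2`: the ground mode flattens out. -/
theorem tendsto_boxMode_zero (x : Space ν) :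
    Tendsto (fun L : ℝ => boxMode L 0 x) atTop (𝓝 1) := by
  have key : ∀ y : ℝ, Tendsto (fun L : ℝ => sinMode L 0 y) atTop (𝓝 1) := fun y => by
    have h1 : Tendsto (fun L : ℝ => Real.pi * y / 2 * L⁻¹ + Real.pi / 2) atTop
        (𝓝 (Real.pi * y / 2 * 0 + Real.pi / 2)) :=
      (tendsto_inv_atTop_zero.const_mul _).add_const _
    have h2 := (Real.continuous_sin.tendsto _).comp h1
    rw [mul_zero, zero_add, Real.sin_pi_div_two] at h2
    refine h2.congr' ?_
    filter_upwards [eventually_gt_atTop 0] with L hL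
    simp only [Function.comp, sinMode, waveNumber]
    congr 1
    field_simp
    push_cast
    ring
  have h := tendsto_finsetProd (Finset.univ : Finset (Fin ν)) fun l _ => key (x l)
  rw [Finset.prod_const_one] at h
  exact h

theorem tendsto_integral_boxMode_zero {f : OneParticle ν} (hf : Integrable f) :
    Tendsto (fun L : ℝ => ∫ x, (boxMode L 0 x : ℂ) * f x) atTop (𝓝 (∫ x, f x)) := by
  refine tendsto_integral_filter_of_dominated_convergence (fun x => ‖f x‖) ?_ ?_ hf.norm ?_
  · refine Eventually.of_forall fun L => ?_
    exact (Complex.continuous_ofReal.comp (boxMode L 0).continuous).aestronglyMeasurable.mul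
      hf.aestronglyMeasurable
  · refine Eventually.of_forall fun L => Eventually.of_forall fun x => ?_
    rw [norm_mul, Complex.norm_real, Real.norm_eq_abs]
    refine mul_le_of_le_one_left (norm_nonneg _) ?_
    change |∏ l, sinMode L 0 (x l)| ≤ 1
    rw [Finset.abs_prod]
    exact Finset.prod_le_one (fun _ _ => abs_nonneg _) fun l _ => abs_sinMode_le_one _ _ _
  · refine Eventually.of_forall fun x => ?_
    have h := ((Complex.continuous_ofReal.tendsto _).comp (tendsto_boxMode_zero x)).mul_const (f x)
    simpa using h

/-- Separates the ground mode from the rest. Its normalisation is `L^(-ν) = 2^ν / |Λ_L|`, which is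
the origin of the factor `2^ν`. -/
theorem norm_sq_gibbsMap_eq {L μ β : ℝ} (hL : 0 < L) (hβ : 0 < β) (hμ : μ < groundEnergy ν L)
    (f : localSpace ν L) :
    ‖gibbsMap hL (norm_gibbs_factor_le hβ hμ) f‖ ^ 2 =
      1 / β * excitedForm L μ (f : OneParticle ν) +
        2 ^ ν * (1 / (volume.real (box ν L) * (β * (groundEnergy ν L - μ)))) *
          ‖∫ x, (boxMode L 0 x : ℂ) * (f : OneParticle ν) x‖ ^ 2 := by
  have h1 := hasSum_norm_sq_gibbsMap hL (norm_gibbs_factor_le hβ hμ) f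
  have h2 := hasSum_excitedForm hL hμ f
  rw [← excitedForm_eq hL hμ] at h2
  have h3 := (h2.mul_left (1 / β)).add (hasSum_ite_eq (0 : Fin ν → ℕ)
    (‖modeCoeff L 0 (f : OneParticle ν)‖ ^ 2 / (β * (groundEnergy ν L - μ))))
  have h0 : ∀ n : Fin ν → ℕ, 0 < boxEnergy L n - μ := boxEnergy_sub_pos hμ
  have h4 := h1.unique (h3.congr_fun fun n => ?_)
  · rw [h4]
    congr 1
    rw [modeCoeff_zero_eq f.2, measureReal_box hL.le, norm_mul, mul_pow, mul_pow]
    have e : ‖((√L ^ ν)⁻¹ : ℂ)‖ ^ 2 = (L ^ ν)⁻¹ := by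
      rw [norm_inv, norm_pow, Complex.norm_real, Real.norm_of_nonneg (Real.sqrt_nonneg _), inv_pow,
        ← pow_mul, mul_comm ν 2, pow_mul, Real.sq_sqrt hL.le]
    rw [e]
    have := sub_pos.mpr hμ
    field_simp
  · have e : ‖((√(β * (boxEnergy L n - μ)) : ℝ) : ℂ)⁻¹ * modeCoeff L n (f : OneParticle ν)‖ ^ 2 =
        ‖modeCoeff L n (f : OneParticle ν)‖ ^ 2 / (β * (boxEnergy L n - μ)) := by
      rw [norm_mul, mul_pow, norm_inv, Complex.norm_real, Real.norm_of_nonneg (Real.sqrt_nonneg _),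
        inv_pow, Real.sq_sqrt (mul_pos hβ (h0 n)).le]
      field_simp
    have := h0 n
    rw [e]
    by_cases hn : n = 0
    · subst hn
      have : boxEnergy L (0 : Fin ν → ℕ) = groundEnergy ν L := by
        simp [boxEnergy, groundEnergy]
      simp [this]
    · simp only [hn, if_false, add_zero]
      field_simp

theorem tendsto_norm_sq_gibbsMap (hν : 3 ≤ ν) {β : ℝ} (hβ : 0 < β) {α : ℝ} {μ : ℝ → ℝ}
    (hμ : ∀ L, 0 < L → μ L < groundEnergy ν L) (hμ0 : Tendsto μ atTop (𝓝 0))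
    (hμα : Tendsto (fun L => 1 / (volume.real (box ν L) * (β * (groundEnergy ν L - μ L)))) atTop
      (𝓝 α)) {L : ℝ} (hL : 0 < L) {f : OneParticle ν} (hf : f ∈ localSpace ν L) :
    Tendsto (fun L' : Set.Ici L => ‖gibbsMap (hL.trans_le L'.2)
        (norm_gibbs_factor_le hβ (hμ L' (hL.trans_le L'.2))) ⟨f, localSpace_mono L'.2 hf⟩‖ ^ 2)
      atTop (𝓝 (1 / β * inverseForm f + 2 ^ ν * α * ‖∫ x, f x‖ ^ 2)) := by
  have h1 := ((tendsto_excitedForm hν hμ hμ0 (localSpace_le_localUnion hL hf)).const_mul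
    (1 / β)).add ((hμα.const_mul (2 ^ ν)).mul
      ((tendsto_integral_boxMode_zero (integrable_of_mem_localSpace hf)).norm.pow 2))
  refine (tendsto_comp_val_Ici_atTop (a := L) (f := fun L' => 1 / β * excitedForm L' (μ L') f +
    2 ^ ν * (1 / (volume.real (box ν L') * (β * (groundEnergy ν L' - μ L')))) *
      ‖∫ x, (boxMode L' 0 x : ℂ) * f x‖ ^ 2)).mpr h1 |>.congr fun L' => ?_
  have h := norm_sq_gibbsMap_eq (hL.trans_le L'.2) hβ (hμ L' (hL.trans_le L'.2))
    ⟨f, localSpace_mono L'.2 hf⟩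
  exact h.symm

/-! ### The free Hamiltonian -/

section Free

theorem free_mem_graph (u : (freeHamiltonian ν).domain) :
    ((u : OneParticle ν), freeHamiltonian ν u) ∈ freeGraph ν :=
  Submodule.mem_graph_toLinearPMap (g := freeGraph ν) (fun p hp h0 => freeGraph_single p hp h0) u

theorem exists_free_eq {f v : OneParticle ν} (h : (f, v) ∈ freeGraph ν) :
    ∃ hf : f ∈ (freeHamiltonian ν).domain, freeHamiltonian ν ⟨f, hf⟩ = v := by
  have hf : f ∈ (freeHamiltonian ν).domain := ⟨(f, v), h, rfl⟩
  refine ⟨hf, ?_⟩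
  have h2 := (freeGraph ν).sub_mem (free_mem_graph ⟨f, hf⟩) h
  exact sub_eq_zero.mp (freeGraph_single _ h2 (sub_self f))

/-- For each fixed test function the distributional equation is a pair of inner products, stable
under weak limits whatever `E₀` is. -/
theorem pointwiseClosed_free (E₀ : Submodule ℂ (OneParticle ν)) :
    PointwiseClosed E₀ (freeHamiltonian ν) := by
  refine pointwiseClosed_of_weakly_closed fun u f v hu hv => ?_
  have hflip : ∀ {w : ℕ → OneParticle ν} {x : OneParticle ν} (g : OneParticle ν),
      (∀ g, Tendsto (fun m => ⟪w m, g⟫) atTop (𝓝 ⟪x, g⟫)) →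
      Tendsto (fun m => ⟪g, w m⟫) atTop (𝓝 ⟪g, x⟫) := by
    intro w x g h
    have := (Complex.continuous_conj.tendsto _).comp (h g)
    simpa only [Function.comp_def, inner_conj_symm] using this
  refine exists_free_eq fun φ hφ => ?_
  refine tendsto_nhds_unique (hflip _ hv) ((hflip (ofSchwartz (kinetic φ)) hu).congr fun m => ?_)
  exact (free_mem_graph ⟨(u m : OneParticle ν), (u m).2.2.choose⟩ φ hφ).symm

/-- The test functions as a subspace of `E`. -/
def testSpace (ν : ℕ) : Submodule ℂ (OneParticle ν) where
  carrier := {f | ∃ φ : 𝓢(Space ν, ℂ), IsTest Set.univ φ ∧ ofSchwartz φ = f}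
  add_mem' := by
    rintro _ _ ⟨φ, h, rfl⟩ ⟨ψ, k, rfl⟩
    exact ⟨φ + ψ, h.add k, ofSchwartz_add φ ψ⟩
  zero_mem' := ⟨0, isTest_zero, ofSchwartz_zero⟩
  smul_mem' := by
    rintro c _ ⟨φ, h, rfl⟩
    exact ⟨c • φ, h.smul c, ofSchwartz_smul c φ⟩

theorem dense_testSpace : Dense (testSpace ν : Set (OneParticle ν)) := by
  rw [Submodule.dense_iff_topologicalClosure_eq_top, Submodule.topologicalClosure_eq_top_iff,
    Submodule.eq_bot_iff]
  exact fun h hh => eq_zero_of_test isOpen_univ (by simp) fun φ hφ =>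
    (Submodule.mem_orthogonal _ _).mp hh _ ⟨φ, hφ, rfl⟩

/-- Test functions are dense in `L²` and mapped to test functions by `H`. -/
theorem dense_genDomain_free {E₀ : Submodule ℂ (OneParticle ν)} (hE : testSpace ν ≤ E₀) :
    Dense {f : E₀ | (f : OneParticle ν) ∈ genDomain E₀ (freeHamiltonian ν)} := by
  intro f
  rw [closure_subtype]
  refine closure_mono ?_ (dense_testSpace (f : OneParticle ν))
  rintro _ ⟨φ, hφ, rfl⟩
  have hm : (ofSchwartz φ, ofSchwartz (kinetic φ)) ∈ freeGraph ν :=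
    fun ψ _ => (inner_kinetic_left ψ φ).symm
  obtain ⟨h1, h2⟩ := exists_free_eq hm
  have h3 := hE ⟨φ, hφ, rfl⟩
  refine ⟨⟨ofSchwartz φ, h3⟩, ⟨h3, h1, ?_⟩, rfl⟩
  rw [h2]
  exact hE ⟨_, hφ.kinetic, rfl⟩

/-- The reason why the condensate does not affect the KMS condition. For integrable functions both
Fourier transforms are continuous, so the relation `û = (p² / 2) f̂` holds at `p = 0` as well. -/
theorem integral_eq_zero_of_freeGraph {f u : OneParticle ν} (h : (f, u) ∈ freeGraph ν)
    (hf : Integrable f) (hu : Integrable u) : ∫ x, u x = 0 := by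
  have h1 : 𝓕 (u : Space ν → ℂ) =ᵐ[volume]
      fun ξ => ((2 * Real.pi ^ 2 * ‖ξ‖ ^ 2 : ℝ) : ℂ) * 𝓕 (f : Space ν → ℂ) ξ := by
    filter_upwards [fourier_freeGraph h, fourier_ae_eq hf, fourier_ae_eq hu] with ξ h1 h2 h3
    rw [← h2, ← h3, h1]
  have hc : Continuous fun ξ : Space ν =>
      ((2 * Real.pi ^ 2 * ‖ξ‖ ^ 2 : ℝ) : ℂ) * 𝓕 (f : Space ν → ℂ) ξ :=
    (by fun_prop : Continuous fun ξ : Space ν => ((2 * Real.pi ^ 2 * ‖ξ‖ ^ 2 : ℝ) : ℂ)).mul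
      (continuous_fourier hf)
  have h2 := congrFun (((continuous_fourier hu).ae_eq_iff_eq volume hc).mp h1) 0
  rw [← fourier_zero_eq_integral, h2]
  simp

end Free

/-! ### The limiting state -/

/-- The functions in `L¹ ∩ L²`. -/
def integrableSpace (ν : ℕ) : Submodule ℂ (OneParticle ν) where
  carrier := {f | Integrable (f : Space ν → ℂ) volume}
  add_mem' {f g} hf hg := by
    have hf' : Integrable (f : Space ν → ℂ) volume := hf
    exact (hf'.add hg).congr (Lp.coeFn_add f g).symm
  zero_mem' := (integrable_zero _ _ _).congr (Lp.coeFn_zero ℂ 2 volume).symm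
  smul_mem' c f hf := by
    have hf' : Integrable (f : Space ν → ℂ) volume := hf
    exact (hf'.smul c).congr (Lp.coeFn_smul c f).symm

theorem integrableSpace_le_formDomain (hν : 3 ≤ ν) : integrableSpace ν ≤ formDomain ν := by
  obtain ⟨C, -, h⟩ := exists_inverseForm_le hν
  exact fun f hf => (h f hf).1

theorem localUnion_le_integrableSpace : localUnion ν ≤ integrableSpace ν := by
  rintro f ⟨L, -, hf⟩
  exact integrable_of_mem_localSpace hf

theorem schwartzSpace_le_integrableSpace : schwartzSpace ν ≤ integrableSpace ν := by
  rintro _ ⟨φ, rfl⟩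
  exact integrable_ofSchwartz φ

/-- The integral as a linear functional. -/
def integralMap (ν : ℕ) : integrableSpace ν →ₗ[ℂ] ℂ where
  toFun f := ∫ x, (f : OneParticle ν) x
  map_add' f g := by
    rw [← integral_add f.2 g.2]
    exact integral_congr_ae (Lp.coeFn_add (f : OneParticle ν) (g : OneParticle ν))
  map_smul' c f := by
    rw [RingHom.id_apply, smul_eq_mul, ← integral_const_mul]
    exact integral_congr_ae (Lp.coeFn_smul c (f : OneParticle ν))

/-- The real-linear map whose square norm is the form of the limiting state. -/
def limitMap (hν : 3 ≤ ν) (α β : ℝ) :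
    integrableSpace ν →ₗ[ℝ] WithLp 2 (OneParticle ν × ℂ) :=
  (WithLp.linearEquiv 2 ℝ (OneParticle ν × ℂ)).symm.toLinearMap ∘ₗ
    LinearMap.prod
      (√(1 / β) • ((invSqrt ν).restrictScalars ℝ ∘ₗ
        (Submodule.inclusion (integrableSpace_le_formDomain hν)).restrictScalars ℝ))
      (√(2 ^ ν * α) • (integralMap ν).restrictScalars ℝ)

theorem norm_sq_limitMap (hν : 3 ≤ ν) {α β : ℝ} (hα : 0 ≤ α) (hβ : 0 < β)
    (f : integrableSpace ν) :
    ‖limitMap hν α β f‖ ^ 2 = 1 / β * inverseForm (f : OneParticle ν) +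
      2 ^ ν * α * ‖∫ x, (f : OneParticle ν) x‖ ^ 2 := by
  rw [WithLp.prod_norm_sq_eq_of_L2]
  change ‖√(1 / β) • invSqrt ν ⟨f, integrableSpace_le_formDomain hν f.2⟩‖ ^ 2 +
    ‖√(2 ^ ν * α) • integralMap ν f‖ ^ 2 = _
  rw [norm_smul, norm_smul, mul_pow, mul_pow, norm_sq_invSqrt, Real.norm_of_nonneg (Real.sqrt_nonneg _),
    Real.norm_of_nonneg (Real.sqrt_nonneg _), Real.sq_sqrt (by positivity),
    Real.sq_sqrt (by positivity)]
  rfl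

theorem limitCharacteristic_eq (hν : 3 ≤ ν) {α β : ℝ} (hα : 0 ≤ α) (hβ : 0 < β)
    (f : integrableSpace ν) : Complex.exp (-(1 / 2) * (‖limitMap hν α β f‖ : ℂ) ^ 2) =
      limitCharacteristic α β (f : OneParticle ν) := by
  rw [limitCharacteristic, ← norm_sq_limitMap hν hα hβ]
  push_cast
  rfl

/-- The condensate component of `v = H f` is zero, so only the form of `H⁻¹` remains and it cancels
`H`. -/
theorem inner_limitMap (hν : 3 ≤ ν) {α β : ℝ} (hβ : 0 < β) (k v : integrableSpace ν)
    {f : OneParticle ν} (hf : Integrable f) (h : (f, (v : OneParticle ν)) ∈ freeGraph ν) :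
    β * inner ℝ (limitMap hν α β k) (limitMap hν α β v) = (⟪(k : OneParticle ν), f⟫).re := by
  have h0 : integralMap ν v = 0 := integral_eq_zero_of_freeGraph h hf v.2
  have h1 := inner_invSqrt (by omega) ⟨k, integrableSpace_le_formDomain hν k.2⟩
    ⟨v, integrableSpace_le_formDomain hν v.2⟩ (fourier_freeGraph h)
  rw [WithLp.prod_inner_apply]
  change β * (inner ℝ (√(1 / β) • invSqrt ν ⟨k, integrableSpace_le_formDomain hν k.2⟩)
    (√(1 / β) • invSqrt ν ⟨v, integrableSpace_le_formDomain hν v.2⟩) +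
    inner ℝ (√(2 ^ ν * α) • integralMap ν k) (√(2 ^ ν * α) • integralMap ν v)) = _
  rw [h0, smul_zero, inner_zero_right, add_zero, real_inner_smul_left, real_inner_smul_right,
    ← mul_assoc √(1 / β), Real.mul_self_sqrt (by positivity), ← mul_assoc, mul_one_div_cancel hβ.ne',
    one_mul, ← field_eq_inner, field, h1]

/-- Gaussian states with the limiting form are weak KMS states for the free Hamiltonian. -/
theorem isWeakKMS_limit (hν : 3 ≤ ν) {α β : ℝ} (hβ : 0 < β) {E₀ : Submodule ℂ (OneParticle ν)}
    (hE : testSpace ν ≤ E₀) (hE' : E₀ ≤ integrableSpace ν) {ω : Functional E₀} (hω : IsState ω)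
    (h : ∀ f : E₀, ω (weylIn E₀ f) =
      Complex.exp (-(1 / 2) * (‖limitMap hν α β ⟨f, hE' f.2⟩‖ : ℂ) ^ 2)) :
    IsWeakKMS E₀ (freeHamiltonian ν) β ω := by
  refine isWeakKMS_of_gaussian
    (limitMap hν α β ∘ₗ (Submodule.inclusion hE').restrictScalars ℝ)
    (dense_genDomain_free hE) (pointwiseClosed_free E₀) hω h fun k f => ?_
  have hf : (Complex.I • (f : OneParticle ν), (genOp (freeHamiltonian ν) f : OneParticle ν)) ∈
      freeGraph ν :=
    (freeGraph ν).smul_mem Complex.I (free_mem_graph ⟨f, f.2.2.choose⟩)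
  refine (inner_limitMap hν hβ ⟨k, hE' k.2⟩ ⟨_, hE' (genOp (freeHamiltonian ν) f).2⟩
    ((integrableSpace ν).smul_mem Complex.I (hE' f.2.1)) hf).trans ?_
  rw [inner_smul_right, Complex.I_mul_re]
  rfl

/-! ### The thermodynamic limit -/

theorem testSpace_le_schwartzSpace : testSpace ν ≤ schwartzSpace ν := by
  rintro _ ⟨φ, -, rfl⟩
  exact ⟨φ, rfl⟩

theorem testSpace_le_localUnion : testSpace ν ≤ localUnion ν := by
  rintro _ ⟨φ, hφ, rfl⟩
  obtain ⟨L, hL, h⟩ := exists_subset_openBox hφ.1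
  have ht : IsTest (openBox ν L) φ := ⟨hφ.1, h L le_rfl⟩
  exact ⟨L, hL, ht.mem_localSpace⟩

/-- By uniqueness the Gibbs state is the Gaussian state already constructed, which is contractive.
-/
theorem IsGibbs.norm_apply_le {L μ β : ℝ} (hL : 0 < L) (hβ : 0 < β) (hμ : μ < groundEnergy ν L)
    {ω : Functional (localSpace ν L)} (h : IsGibbs L μ β ω) (a : weylAlgebra (localSpace ν L)) :
    ‖ω a‖ ≤ ‖a‖ := by
  obtain ⟨ω', -, h2, h3⟩ := exists_gaussian_state (gibbsMap hL (norm_gibbs_factor_le hβ hμ))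
  have e : ω = ω' := functional_ext fun f => by
    rw [h3, ((isGibbs_iff hL hβ hμ ω).mp h).2]
  rw [e]
  exact h2 a

/-- The inclusion of Weyl algebras as a continuous linear map. -/
def weylInclCLM {E₀ E₁ : Submodule ℂ (OneParticle ν)} (h : E₀ ≤ E₁) :
    weylAlgebra E₀ →L[ℂ] weylAlgebra E₁ where
  toFun := weylIncl h
  map_add' _ _ := rfl
  map_smul' _ _ := rfl
  cont := continuous_subtype_val.subtype_mk _

/-- Contractive functionals which converge on the Weyl elements converge pointwise. -/
theorem tendsto_of_tendsto_weylIn {ι : Type*} {l : Filter ι} {E₀ : Submodule ℂ (OneParticle ν)}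
    {F : ι → Functional E₀} {G : Functional E₀} (hF : ∀ i a, ‖F i a‖ ≤ ‖a‖)
    (h : ∀ f, Tendsto (fun i => F i (weylIn E₀ f)) l (𝓝 (G (weylIn E₀ f))))
    (a : weylAlgebra E₀) : Tendsto (fun i => F i a) l (𝓝 (G a)) := by
  refine weylAlgebra_induction (p := fun a => Tendsto (fun i => F i a) l (𝓝 (G a))) ?_ h ?_ ?_ ?_ a
  -- Uniform contractivity makes the set of elements with convergence closed.
  · refine isClosed_of_closure_subset fun a ha => ?_
    refine Metric.tendsto_nhds.mpr fun ε hε => ?_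
    obtain ⟨δ, hδ, hδG⟩ := (Metric.continuousAt_iff (a := a)).mp G.continuous.continuousAt
      (ε / 3) (by positivity)
    obtain ⟨b, hb, hab⟩ := Metric.mem_closure_iff.mp ha (min δ (ε / 3)) (by positivity)
    have hb' : Tendsto (fun i => F i b) l (𝓝 (G b)) := hb
    filter_upwards [Metric.tendsto_nhds.mp hb' (ε / 3) (by positivity)] with i hi
    have h1 : dist (F i a) (F i b) ≤ dist a b := by
      rw [dist_eq_norm, dist_eq_norm, ← map_sub]
      exact hF i _
    have h2 := hδG (x := b) (by rw [dist_comm]; exact hab.trans_le (min_le_left _ _))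
    have h3 := hab.trans_le (min_le_right _ _)
    have h4 := dist_triangle4 (F i a) (F i b) (G b) (G a)
    linarith
  · simp only [map_zero]
    exact tendsto_const_nhds
  · intro a b ha hb
    simp only [map_add]
    exact ha.add hb
  · intro c a ha
    simp only [map_smul]
    exact ha.const_smul c

theorem tendsto_gibbs (hν : 3 ≤ ν) {α β : ℝ} (hβ : 0 < β) {μ : ℝ → ℝ}
    (hμ : ∀ L, 0 < L → μ L < groundEnergy ν L) (hμ0 : Tendsto μ atTop (𝓝 0))
    (hμα : Tendsto (fun L => 1 / (volume.real (box ν L) * (β * (groundEnergy ν L - μ L)))) atTop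
      (𝓝 α)) {ω : (L : ℝ) → Functional (localSpace ν L)}
    (hω : ∀ L, 0 < L → IsGibbs L (μ L) β (ω L)) {ωlim : Functional (localUnion ν)}
    (hlim : ∀ f : localUnion ν, ωlim (weylIn _ f) = limitCharacteristic α β (f : OneParticle ν))
    {L : ℝ} (hL : 0 < L) (c : weylAlgebra (localSpace ν L)) :
    Tendsto (fun L' : Set.Ici L => ω L' (weylIncl (localSpace_mono L'.2) c)) atTop
      (𝓝 (ωlim (weylIncl (localSpace_le_localUnion hL) c))) := by
  have hpos : ∀ L' : Set.Ici L, (0 : ℝ) < L' := fun L' => hL.trans_le L'.2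
  refine tendsto_of_tendsto_weylIn
    (F := fun L' : Set.Ici L => (ω L').comp (weylInclCLM (localSpace_mono L'.2)))
    (G := ωlim.comp (weylInclCLM (localSpace_le_localUnion hL))) (fun L' a => ?_) (fun f => ?_) c
  · exact (hω L' (hpos L')).norm_apply_le (hpos L') hβ (hμ L' (hpos L')) _
  · have h := tendsto_norm_sq_gibbsMap hν hβ hμ hμ0 hμα hL f.2
    have h1 := (Complex.continuous_ofReal.tendsto _).comp
      ((Real.continuous_exp.tendsto _).comp (h.const_mul (-(1 / 2))))
    refine (h1.congr fun L' => ?_).trans_eq ?_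
    · have h2 := ((isGibbs_iff (hpos L') hβ (hμ L' (hpos L')) _).mp (hω L' (hpos L'))).2
        ⟨f, localSpace_mono L'.2 f.2⟩
      refine Eq.trans ?_ h2.symm
      simp only [Function.comp]
      push_cast
      rfl
    · exact congrArg 𝓝 (hlim ⟨f, localSpace_le_localUnion hL f.2⟩).symm

/-! ### Extension by continuity -/

theorem inverseForm_nonneg (f : OneParticle ν) : 0 ≤ inverseForm f :=
  integral_nonneg fun ξ => by unfold inverseDensity; positivity

/-- The constant is the sum of those needed for the two parts: `1/β` times the inverse form is `2/β`
times the half of it that enters `‖·‖_ω²`. -/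
theorem norm_sq_limitMap_le (hν : 3 ≤ ν) {α β : ℝ} (hα : 0 ≤ α) (hβ : 0 < β)
    (f : integrableSpace ν) : ‖limitMap hν α β f‖ ^ 2 ≤
      (2 / β + 2 ^ ν * α) * condensateNormSq (f : OneParticle ν) := by
  rw [norm_sq_limitMap hν hα hβ, condensateNormSq]
  have h1 := inverseForm_nonneg (f : OneParticle ν)
  set I := inverseForm (f : OneParticle ν)
  set N := ‖∫ x, (f : OneParticle ν) x‖ ^ 2
  have hN : 0 ≤ N := by positivity
  have h2 : 0 ≤ 2 / β * N + 2 ^ ν * α * (1 / 2 * I) := by positivity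
  have h3 : 1 / β * I = 2 / β * (1 / 2 * I) := by ring
  linarith

theorem tendsto_limitMap (hν : 3 ≤ ν) {α β : ℝ} (hα : 0 ≤ α) (hβ : 0 < β)
    {u : ℕ → integrableSpace ν} {f : integrableSpace ν}
    (h : Tendsto (fun n => condensateNormSq ((u n : OneParticle ν) - (f : OneParticle ν))) atTop
      (𝓝 0)) :
    Tendsto (fun n => limitMap hν α β (u n)) atTop (𝓝 (limitMap hν α β f)) := by
  rw [tendsto_iff_norm_sub_tendsto_zero]
  have h1 : Tendsto (fun n => ‖limitMap hν α β (u n) - limitMap hν α β f‖ ^ 2) atTop (𝓝 0) := by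
    have h2 := h.const_mul (2 / β + 2 ^ ν * α)
    rw [mul_zero] at h2
    refine squeeze_zero (fun n => by positivity) (fun n => ?_) h2
    rw [← map_sub]
    exact norm_sq_limitMap_le hν hα hβ (u n - f)
  have h3 := (Real.continuous_sqrt.tendsto _).comp h1
  rw [Real.sqrt_zero] at h3
  exact h3.congr fun n => Real.sqrt_sq (norm_nonneg _)

/-- Truncations to boxes approximate an integrable function in the norm of the condensate. -/
theorem exists_tendsto_condensateNormSq (hν : 3 ≤ ν) {f : OneParticle ν} (hf : Integrable f) :
    ∃ u : ℕ → localUnion ν,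
      Tendsto (fun n => condensateNormSq ((u n : OneParticle ν) - f)) atTop (𝓝 0) := by
  obtain ⟨C, hC, hle⟩ := exists_inverseForm_le hν
  let B : ℕ → Set (Space ν) := fun n => box ν ((n : ℝ) + 1)
  have hB : ∀ n, MeasurableSet (B n) := fun n => measurableSet_box ν _
  have hm : ∀ n, MemLp ((B n).indicator (f : Space ν → ℂ)) 2 volume := fun n =>
    (Lp.memLp f).indicator (hB n)
  have hev : ∀ x : Space ν, ∀ᶠ n in atTop, (B n).indicator (f : Space ν → ℂ) x = f x := by
    intro x
    obtain ⟨N, hN⟩ := exists_nat_ge ‖x‖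
    filter_upwards [eventually_ge_atTop N] with n hn
    refine Set.indicator_of_mem (fun i => ?_) _
    have h1 : |x i| ≤ ‖x‖ := PiLp.norm_apply_le x i
    have h2 : (N : ℝ) ≤ n := by exact_mod_cast hn
    exact abs_le.mp (by linarith)
  have hbound : ∀ n x, ‖(B n).indicator (f : Space ν → ℂ) x‖ ≤ ‖f x‖ := fun n x =>
    norm_indicator_le_norm_self _ _
  have hloc : ∀ n, (hm n).toLp ∈ localUnion ν := fun n => by
    refine ⟨(n : ℝ) + 1, by positivity, ?_⟩
    have h : ∀ᵐ x, x ∉ box ν ((n : ℝ) + 1) → ((hm n).toLp : OneParticle ν) x = 0 := by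
      filter_upwards [(hm n).coeFn_toLp] with x hx hx'
      rw [hx]
      exact Set.indicator_of_notMem hx' _
    exact h
  have h2 : Tendsto (fun n => (hm n).toLp) atTop (𝓝 f) := by
    have := tendsto_toLp_of_dominated hm (Lp.memLp f) (fun x => ‖f x‖) (Lp.memLp f).norm
      (fun n => Eventually.of_forall (hbound n))
      (Eventually.of_forall fun x => tendsto_const_nhds.congr' ((hev x).mono fun n h => h.symm))
    rwa [Lp.toLp_coeFn] at this
  -- Convergence is needed in `L¹` as well as in `L²`: `L¹` controls the integral, and both together
  -- control the inverse form.
  have h1 : Tendsto (fun n => ∫ x, ‖((hm n).toLp - f : OneParticle ν) x‖) atTop (𝓝 0) := by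
    have h := tendsto_integral_of_dominated_convergence (μ := volume) (fun x : Space ν => 2 * ‖f x‖)
      (F := fun n x => ‖(B n).indicator (f : Space ν → ℂ) x - f x‖) (f := fun _ => 0)
      (fun n => ((hm n).aestronglyMeasurable.sub (Lp.aestronglyMeasurable f)).norm)
      (hf.norm.const_mul 2) (fun n => Eventually.of_forall fun x => ?_)
      (Eventually.of_forall fun x => tendsto_const_nhds.congr' ((hev x).mono fun n h => ?_))
    · rw [integral_zero] at h
      refine h.congr fun n => integral_congr_ae ?_
      filter_upwards [Lp.coeFn_sub (hm n).toLp f, (hm n).coeFn_toLp] with x e1 e2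
      rw [e1, Pi.sub_apply, e2]
    · rw [norm_norm]
      have := norm_sub_le ((B n).indicator (f : Space ν → ℂ) x) (f x)
      linarith [hbound n x]
    · exact (by rw [h, sub_self, norm_zero] :
        ‖(B n).indicator (f : Space ν → ℂ) x - f x‖ = 0).symm
  refine ⟨fun n => ⟨_, hloc n⟩, ?_⟩
  have h3 := (h1.pow 2).add (((h1.pow 2).add ((h2.sub_const f).norm.pow 2)).const_mul (1 / 2 * C))
  rw [sub_self, norm_zero] at h3
  refine squeeze_zero (fun n => ?_) (fun n => ?_) (h3.trans_eq (by norm_num))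
  · exact add_nonneg (by positivity) (mul_nonneg (by norm_num) (inverseForm_nonneg _))
  · have hi : Integrable (((hm n).toLp - f : OneParticle ν) : Space ν → ℂ) :=
      (integrableSpace ν).sub_mem (localUnion_le_integrableSpace (hloc n)) hf
    refine add_le_add (pow_le_pow_left₀ (norm_nonneg _) (norm_integral_le_integral_norm _) 2) ?_
    rw [mul_assoc]
    exact mul_le_mul_of_nonneg_left (hle _ hi).2 (by norm_num)

theorem extendsByContinuity (hν : 3 ≤ ν) {α β : ℝ} (hα : 0 ≤ α) (hβ : 0 < β)
    {ω : Functional (localUnion ν)} {ω' : Functional (schwartzSpace ν)}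
    (h : ∀ f : localUnion ν, ω (weylIn _ f) = Complex.exp
      (-(1 / 2) * (‖limitMap hν α β ⟨f, localUnion_le_integrableSpace f.2⟩‖ : ℂ) ^ 2))
    (h' : ∀ f : schwartzSpace ν, ω' (weylIn _ f) = Complex.exp
      (-(1 / 2) * (‖limitMap hν α β ⟨f, schwartzSpace_le_integrableSpace f.2⟩‖ : ℂ) ^ 2)) :
    ExtendsByContinuity ω ω' := by
  intro f u hu
  simp only [h, h']
  have h1 := tendsto_limitMap hν hα hβ
    (u := fun n => ⟨u n, localUnion_le_integrableSpace (u n).2⟩)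
    (f := ⟨f, schwartzSpace_le_integrableSpace f.2⟩) hu
  have hc : Continuous fun v : WithLp 2 (OneParticle ν × ℂ) =>
    Complex.exp (-(1 / 2) * (‖v‖ : ℂ) ^ 2) := by fun_prop
  exact (hc.tendsto _).comp h1

/-- Every Schwartz function is a limit of truncations in `‖·‖_ω`, so its Weyl element has only one
possible value. -/
theorem ExtendsByContinuity.unique (hν : 3 ≤ ν) {ω : Functional (localUnion ν)}
    {ω₁ ω₂ : Functional (schwartzSpace ν)} (h₁ : ExtendsByContinuity ω ω₁)
    (h₂ : ExtendsByContinuity ω ω₂) : ω₁ = ω₂ := by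
  refine functional_ext fun f => ?_
  obtain ⟨u, hu⟩ := exists_tendsto_condensateNormSq hν (schwartzSpace_le_integrableSpace f.2)
  exact tendsto_nhds_unique (h₁ f u hu) (h₂ f u hu)

end ClassicalBose

end

/-! ### The main theorem -/

theorem mainTheorem7 (ν : ℕ) (hν : 3 ≤ ν) (β : ℝ) (hβ : 0 < β) (α : ℝ) (hα : 0 ≤ α)
    (μ : ℝ → ℝ) (hμ : ∀ L, 0 < L → μ L < groundEnergy ν L)
    (hμ_zero : Tendsto μ atTop (𝓝 0))
    (hμ_lim : Tendsto
      (fun L => 1 / (volume.real (box ν L) * (β * (groundEnergy ν L - μ L)))) atTop (𝓝 α)) :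
    -- the finite-volume Gibbs states are well defined and are the weak KMS states
    (∀ L, 0 < L → (∃! ω : Functional (localSpace ν L), IsGibbs L (μ L) β ω) ∧
      ∀ ω : Functional (localSpace ν L), IsGibbs L (μ L) β ω ↔
        IsWeakKMS (localSpace ν L) (shift (dirichletHamiltonian ν L) (μ L)) β ω ∧
          Continuous fun f : localSpace ν L => ω (weylIn _ f)) ∧
    -- the form in the exponent of the limit is finite
    (∀ f : OneParticle ν, f ∈ localUnion ν ∨ f ∈ schwartzSpace ν →
      Integrable (inverseDensity f)) ∧
    ∀ ω : (L : ℝ) → Functional (localSpace ν L), (∀ L, 0 < L → IsGibbs L (μ L) β (ω L)) →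
      ∃ ωlim : Functional (localUnion ν),
        -- the thermodynamic limit exists on every local algebra
        (∀ (L : ℝ) (hL : 0 < L) (c : weylAlgebra (localSpace ν L)),
          Tendsto (fun L' : Set.Ici L => ω L' (weylIncl (localSpace_mono L'.2) c)) atTop
            (𝓝 (ωlim (weylIncl (localSpace_le_localUnion hL) c)))) ∧
        -- it is an analytic weak KMS state with the given characteristic functional
        IsState ωlim ∧ IsAnalytic ωlim ∧
        (∀ f : localUnion ν, ωlim (weylIn _ f) = limitCharacteristic α β (f : OneParticle ν)) ∧
        IsWeakKMS (localUnion ν) (freeHamiltonian ν) β ωlim ∧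
        -- it extends by continuity, uniquely, to a weak KMS state over the Schwartz space
        ∃ ωext : Functional (schwartzSpace ν),
          IsState ωext ∧ ExtendsByContinuity ωlim ωext ∧
          (∀ ω' : Functional (schwartzSpace ν), IsState ω' → ExtendsByContinuity ωlim ω' →
            ω' = ωext) ∧
          (∀ f : schwartzSpace ν,
            ωext (weylIn _ f) = limitCharacteristic α β (f : OneParticle ν)) ∧
          IsWeakKMS (schwartzSpace ν) (freeHamiltonian ν) β ωext := by
  refine ⟨fun L hL => ⟨existsUnique_gibbs hL hβ (hμ L hL),
    isGibbs_iff_isWeakKMS hL hβ (hμ L hL)⟩, ?_, fun ω hω => ?_⟩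
  · rintro f (hf | hf)
    · exact mem_formDomain_iff.mp
        (integrableSpace_le_formDomain hν (localUnion_le_integrableSpace hf))
    · exact mem_formDomain_iff.mp
        (integrableSpace_le_formDomain hν (schwartzSpace_le_integrableSpace hf))
  -- Both limiting states are the Gaussian state of the same map, restricted to two subspaces of `L¹
  -- ∩ L²`.
  obtain ⟨ω₁, h1, -, h2⟩ := exists_gaussian_state (limitMap hν α β ∘ₗ
    (Submodule.inclusion (localUnion_le_integrableSpace (ν := ν))).restrictScalars ℝ)
  obtain ⟨ω₂, k1, -, k2⟩ := exists_gaussian_state (limitMap hν α β ∘ₗ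
    (Submodule.inclusion (schwartzSpace_le_integrableSpace (ν := ν))).restrictScalars ℝ)
  have h3 : ∀ f : localUnion ν, ω₁ (weylIn _ f) = limitCharacteristic α β (f : OneParticle ν) :=
    fun f => (h2 f).trans (limitCharacteristic_eq hν hα hβ ⟨f, localUnion_le_integrableSpace f.2⟩)
  have k3 : ∀ f : schwartzSpace ν, ω₂ (weylIn _ f) = limitCharacteristic α β (f : OneParticle ν) :=
    fun f => (k2 f).trans
      (limitCharacteristic_eq hν hα hβ ⟨f, schwartzSpace_le_integrableSpace f.2⟩)
  have hext : ExtendsByContinuity ω₁ ω₂ := extendsByContinuity hν hα hβ h2 k2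
  exact ⟨ω₁, fun L hL c => tendsto_gibbs hν hβ hμ hμ_zero hμ_lim hω h3 hL c, h1,
    isAnalytic_of_gaussian_map _ h1 h2, h3,
    isWeakKMS_limit hν hβ testSpace_le_localUnion localUnion_le_integrableSpace h1 h2,
    ω₂, k1, hext, fun ω' _ h' => h'.unique hν hext, k3,
    isWeakKMS_limit hν hβ testSpace_le_schwartzSpace schwartzSpace_le_integrableSpace k1 k2⟩
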